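/- **Theorem (Split procedure).** There is a single deterministic algorithm Split with the following properties. Let $\mathbb F$ be any finite field, presented by its characteristic $p$ and the minimal polynomial over $\mathbb F_p$ of a generator $\theta$ with $\mathbb F=\mathbb F_p(\theta)$, field elements being given by their coordinates (in binary) with respect to $1,\theta,\theta^2,\dots$. The input is this presentation, a nonzero polynomial $P\in\mathbb F[X,Y]$, given by its dense list of coefficients, and a point $(\alpha,\beta)\in\mathbb F^2$. Split runs in time $\mathrm{poly}(\deg P,\log|\mathbb F|)$ (time counted at the level of bits, $\deg P$ the total degree, and the polynomial bound independent of $\mathbb F$, $P$, $\alpha$, $\beta$) and outputs a pair $(P_1,P_2)$ of polynomials in $\mathbb F[X,Y]$ such that: 1. Let $P=c\prod_{i=1}^s P_i$ be a factorization into irreducibles (with multiplicity, $c\in\mathbb F\setminus\{0\}$), and put - $A=\{i : P_i(\alpha,Y)=\gamma (Y-\beta)^{m} \text{ for some } m\ge 1,\ \gamma\in\mathbb F\setminus\{0\}\}$, - $B=\{i : P_i(\alpha,\beta)\ne 0,\ \deg_Y P_i(\alpha,Y)\ge 1\}$, - $D=\{i : P_i(\alpha,\beta)\neq 0,\ \deg_Y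 P_i(\alpha,Y)=0\}$, and $P_A=\prod_{i\in A}P_i$, $P_B=\prod_{i\in B}P_i$, $P_D=\prod_{i\in D}P_i$. Then there are $R_1,R_2\in\mathbb F[X,Y]$ with $P_1=P_A R_1$, $P_2=P_B R_2$, and $R_1R_2$ divides $P_D$. 2. If $P$ is monic in $Y$ and its irreducible factors $P_i$ are taken monic in $Y$, then $P_1=P_A$ and $P_2=P_B$. 3. Call $P$ stable at $(\alpha,\beta)$ if $\deg P(\alpha,Y)\ge 1$ and either (i) $P(\alpha,Y)=\gamma(Y-\beta)^r$ for some $\gamma\in\mathbb F\setminus\{0\}$ and $r\ge1$, or (ii) $P(\alpha,\beta)\ne0$. If $P$ is stable at $(\alpha,\beta)$, then $(P_1,P_2)=(P,1)$ in case (i) and $(P_1,P_2)=(1,P)$ in case (ii). -/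

import Mathlib

open Polynomial
open scoped Polynomial.Bivariate

/-! ## Machine model

Data are unlabelled binary trees. A program is a term of a small point-free `while` language
(constants, projections, pairing, composition, conditional, loop); it is a finite piece of syntax
and has no access to anything but its input tree. -/

namespace TreeMachine

/-- Binary trees with unlabelled leaves. -/
inductive Data : Type
  | leaf : Data
  | node : Data → Data → Data

namespace Data

/-- Number of leaves and inner nodes. -/
def size : Data → ℕ
  | leaf => 1
  | node l r => l.size + r.size + 1

/-- Left subtree (a leaf is its own left subtree). -/
def left : Data → Data
  | leaf => leaf
  | node l _ => l

/-- Right subtree (a leaf is its own right subtree). -/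
def right : Data → Data
  | leaf => leaf
  | node _ r => r

end Data

/-- Programs. Every program transforms one tree into one tree. -/
inductive Prog : Type
  /-- return a leaf -/
  | leaf : Prog
  /-- return the input -/
  | id : Prog
  /-- return the left subtree of the input -/
  | left : Prog
  /-- return the right subtree of the input -/
  | right : Prog
  /-- run both programs on the input and join the results to a tree -/
  | node (f g : Prog) : Prog
  /-- first `f`, then `g` -/
  | seq (f g : Prog) : Prog
  /-- run `c` on the input; if the result is not a leaf run `f` on the input, otherwise `g` -/
  | ite (c f g : Prog) : Prog
  /-- while the result of `c` on the current tree is not a leaf, replace that tree by the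
  result of `f` on it -/
  | loop (c f : Prog) : Prog

/-- `Runs f x y t`: the program `f` halts on input `x` with output `y` in time `t`.
Each application of an instruction costs the size of the tree it is applied to
(so copying, inspecting and discarding data is paid for symbol by symbol), plus the time of its
sub-programs. -/
inductive Runs : Prog → Data → Data → ℕ → Prop
  | leaf (x : Data) : Runs .leaf x .leaf x.size
  | id (x : Data) : Runs .id x x x.size
  | left (x : Data) : Runs .left x x.left x.size
  | right (x : Data) : Runs .right x x.right x.size
  | node {f g : Prog} {x y z : Data} {s t : ℕ} :
      Runs f x y s → Runs g x z t → Runs (.node f g) x (.node y z) (x.size + s + t)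
  | seq {f g : Prog} {x y z : Data} {s t : ℕ} :
      Runs f x y s → Runs g y z t → Runs (.seq f g) x z (x.size + s + t)
  | ite_true {c f g : Prog} {x a b y : Data} {s t : ℕ} :
      Runs c x (.node a b) s → Runs f x y t → Runs (.ite c f g) x y (x.size + s + t)
  | ite_false {c f g : Prog} {x y : Data} {s t : ℕ} :
      Runs c x .leaf s → Runs g x y t → Runs (.ite c f g) x y (x.size + s + t)
  | loop_stop {c f : Prog} {x : Data} {s : ℕ} :
      Runs c x .leaf s → Runs (.loop c f) x x (x.size + s)
  | loop_step {c f : Prog} {x a b y z : Data} {s t u : ℕ} :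
      Runs c x (.node a b) s → Runs f x y t → Runs (.loop c f) y z u →
      Runs (.loop c f) x z (x.size + s + t + u)

/-- Computations are deterministic: output and running time are determined by the input. -/
theorem Runs.deterministic {f : Prog} {x y : Data} {t : ℕ} (h : Runs f x y t) :
    ∀ {y' : Data} {t' : ℕ}, Runs f x y' t' → y = y' ∧ t = t' := by
  induction h with
  | leaf x => intro y' t' h'; cases h'; exact ⟨rfl, rfl⟩
  | id x => intro y' t' h'; cases h'; exact ⟨rfl, rfl⟩
  | left x => intro y' t' h'; cases h'; exact ⟨rfl, rfl⟩
  | right x => intro y' t' h'; cases h'; exact ⟨rfl, rfl⟩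
  | node _ _ ih₁ ih₂ =>
    intro y' t' h'
    cases h' with
    | node h₁ h₂ =>
      obtain ⟨rfl, rfl⟩ := ih₁ h₁
      obtain ⟨rfl, rfl⟩ := ih₂ h₂
      exact ⟨rfl, rfl⟩
  | seq _ _ ih₁ ih₂ =>
    intro y' t' h'
    cases h' with
    | seq h₁ h₂ =>
      obtain ⟨rfl, rfl⟩ := ih₁ h₁
      obtain ⟨rfl, rfl⟩ := ih₂ h₂
      exact ⟨rfl, rfl⟩
  | ite_true _ _ ih₁ ih₂ =>
    intro y' t' h'
    cases h' with
    | ite_true h₁ h₂ =>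
      obtain ⟨_, rfl⟩ := ih₁ h₁
      obtain ⟨rfl, rfl⟩ := ih₂ h₂
      exact ⟨rfl, rfl⟩
    | ite_false h₁ h₂ => exact absurd (ih₁ h₁).1 (by simp)
  | ite_false _ _ ih₁ ih₂ =>
    intro y' t' h'
    cases h' with
    | ite_true h₁ h₂ => exact absurd (ih₁ h₁).1 (by simp)
    | ite_false h₁ h₂ =>
      obtain ⟨_, rfl⟩ := ih₁ h₁
      obtain ⟨rfl, rfl⟩ := ih₂ h₂
      exact ⟨rfl, rfl⟩
  | loop_stop _ ih₁ =>
    intro y' t' h'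
    cases h' with
    | loop_stop h₁ =>
      obtain ⟨_, rfl⟩ := ih₁ h₁
      exact ⟨rfl, rfl⟩
    | loop_step h₁ h₂ h₃ => exact absurd (ih₁ h₁).1 (by simp)
  | loop_step _ _ _ ih₁ ih₂ ih₃ =>
    intro y' t' h'
    cases h' with
    | loop_stop h₁ => exact absurd (ih₁ h₁).1 (by simp)
    | loop_step h₁ h₂ h₃ =>
      obtain ⟨_, rfl⟩ := ih₁ h₁
      obtain ⟨rfl, rfl⟩ := ih₂ h₂
      obtain ⟨rfl, rfl⟩ := ih₃ h₃
      exact ⟨rfl, rfl⟩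

/-! ## Encodings

Natural numbers are written in binary, lists as right combs, and a finite field is presented in
the usual way as `𝔽_p[θ]` with a generator `θ`: its elements are the coordinate vectors with
respect to the basis `1, θ, …, θ^(r-1)`, and the field itself is given to the machine by `p` and
the minimal polynomial of `θ`. -/

/-- A list as a right comb. -/
def encList : List Data → Data
  | [] => .leaf
  | a :: l => .node a (encList l)

/-- A bit. -/
def encBit : Bool → Data
  | false => .leaf
  | true => .node .leaf .leaf

/-- A natural number in binary, least significant bit first. -/
def encNat (n : ℕ) : Data := encList (n.bits.map encBit)

/-- A residue class modulo `p`, by its representative in `{0, …, p-1}`. -/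
def encZMod {p : ℕ} (a : ZMod p) : Data := encNat a.val

/-- Dense list of coefficients of a polynomial, constant term first, ending with the leading
coefficient; the zero polynomial is the empty list. -/
noncomputable def encPoly {R : Type*} [Semiring R] (enc : R → Data) (f : R[X]) : Data :=
  encList (f.coeffList.reverse.map enc)

section

variable {p : ℕ} {F : Type*} [Field F] [Algebra (ZMod p) F] [Fact p.Prime]

/-- A field element, by its coordinates with respect to the power basis. -/
noncomputable def encField (pb : PowerBasis (ZMod p) F) (a : F) : Data :=
  encList (List.ofFn fun i : Fin pb.dim => encZMod (pb.basis.repr a i))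

/-- A bivariate polynomial, as the list of its coefficients of `Y^0, Y^1, …`, each of them a list
of coefficients of `X^0, X^1, …`. -/
noncomputable def encBiv (pb : PowerBasis (ZMod p) F) (P : F[X][Y]) : Data :=
  encPoly (encPoly (encField pb)) P

/-- The input: presentation of the field, then `P`, `α`, `β`. -/
noncomputable def encInput (pb : PowerBasis (ZMod p) F) (P : F[X][Y]) (α β : F) : Data :=
  encList [encNat p, encPoly encZMod (minpoly (ZMod p) pb.gen), encBiv pb P, encField pb α,
    encField pb β]

/-- The output: a pair of bivariate polynomials. -/
noncomputable def encOutput (pb : PowerBasis (ZMod p) F) (P₁ P₂ : F[X][Y]) : Data :=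
  .node (encBiv pb P₁) (encBiv pb P₂)

end

end TreeMachine

/-! ## Local factor types

`F[X][Y]` is the ring of polynomials in `Y` whose coefficients are polynomials in `X`. -/

namespace BivariateSplit

variable {F : Type*} [Field F]

/-- Total degree of a bivariate polynomial. -/
noncomputable def totalDeg (P : F[X][Y]) : ℕ := P.support.sup fun j => (P.coeff j).natDegree + j

/-- The univariate polynomial `P(α, Y)`. -/
noncomputable def restrict (α : F) (P : F[X][Y]) : F[X] := P.map (evalRingHom α)

/-- `Q(α, Y) = γ (Y - β)^m` with `γ ≠ 0` and `m ≥ 1`. -/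
def IsTypeA (α β : F) (Q : F[X][Y]) : Prop :=
  ∃ m : ℕ, 1 ≤ m ∧ ∃ γ : F, γ ≠ 0 ∧ restrict α Q = C γ * (X - C β) ^ m

/-- `Q(α, β) ≠ 0` and `Q(α, Y)` is not constant. -/
def IsTypeB (α β : F) (Q : F[X][Y]) : Prop :=
  Q.evalEval α β ≠ 0 ∧ 1 ≤ (restrict α Q).natDegree

/-- `Q(α, β) ≠ 0` and `Q(α, Y)` is constant. -/
def IsTypeD (α β : F) (Q : F[X][Y]) : Prop :=
  Q.evalEval α β ≠ 0 ∧ (restrict α Q).natDegree = 0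

/-- `S` is the multiset of the factors in a factorization of `P` into irreducibles, with
multiplicity (the product is `P` up to a nonzero constant). -/
def IsFactorization (S : Multiset F[X][Y]) (P : F[X][Y]) : Prop :=
  (∀ Q ∈ S, Irreducible Q) ∧ Associated S.prod P

theorem exists_isFactorization {P : F[X][Y]} (hP : P ≠ 0) : ∃ S, IsFactorization S P :=
  WfDvdMonoid.exists_factors P hP

open Classical in
/-- Product of the factors of type A. -/
noncomputable def partA (S : Multiset F[X][Y]) (α β : F) : F[X][Y] :=
  (S.filter (IsTypeA α β)).prod

open Classical in
/-- Product of the factors of type B. -/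
noncomputable def partB (S : Multiset F[X][Y]) (α β : F) : F[X][Y] :=
  (S.filter (IsTypeB α β)).prod

open Classical in
/-- Product of the factors of type D. -/
noncomputable def partD (S : Multiset F[X][Y]) (α β : F) : F[X][Y] :=
  (S.filter (IsTypeD α β)).prod

/-- First way of being stable at `(α, β)`: `P(α, Y)` is not constant and equals `γ (Y - β)^r`
with `γ ≠ 0` and `r ≥ 1`. -/
def StableA (P : F[X][Y]) (α β : F) : Prop :=
  1 ≤ (restrict α P).natDegree ∧
    ∃ γ : F, γ ≠ 0 ∧ ∃ r : ℕ, 0 < r ∧ restrict α P = C γ * (X - C β) ^ r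

/-- Second way of being stable at `(α, β)`: `P(α, Y)` is not constant and `P(α, β) ≠ 0`. -/
def StableB (P : F[X][Y]) (α β : F) : Prop :=
  1 ≤ (restrict α P).natDegree ∧ P.evalEval α β ≠ 0

end BivariateSplit

open TreeMachine BivariateSplit

/-! Nothing is ever factored, not even in one variable. The factors are separated by their
restrictions to the line through `(α, β)` with constant first coordinate `α`, and this needs only
linear algebra modulo a power of `X`.

Let `n` exceed both partial degrees of `P`, move `(α, β)` to the origin, and remove all factors `X -
α`, which belong to none of the three types; call the result `Q`. Suppose `Q = T * W`, where `T(0,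
Y)` divides `g(Y) ^ n`, whereas no irreducible factor `q` of `W` has `q(0, Y)` dividing a power of
`g`. Put `N = 2n²` and `G = g ^ (nN)`. Then, up to a constant, `W` is the least nonzero polynomial
`V` with partial degrees below `n` such that `G * V` is a multiple of `Q` modulo `X ^ N`. It
qualifies because `T * H ≡ G` for some `H` (`exists_inverse`, a geometric series). Conversely, an
irreducible factor `q` of `W` divides every such `V`. Otherwise a resultant gives `ρ(X) = a * q + b
* V`, nonzero of degree below `N` (`exists_combination`), so `q` divides `G * ρ` modulo `X ^ N`;
cancelling the power of `X` in `ρ` and putting `X = 0` shows that `q(0, Y)` divides `G`, a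
contradiction (`irreducible_dvd_of_modEq`). Removing the factors one by one gives `W ∣ V`
(`dvd_of_modEq`). "Least" refers to the degree after `Y ↦ X ^ n`, a ring homomorphism that is
injective on polynomials of small degree; hence a multiple of `W` that is not larger than `W` is a
constant multiple. The least solution appears as the first linear dependency in a list of rows
(`BivariateSplit.firstDep_sepRows`), and quotients are found in the same way
(`BivariateSplit.firstDep_quotRows`).

With `g = Y` this gives `T`, which is `P_A * P_D` up to a constant, and the rest `W`. With `g` the
part of `W(0, Y)` prime to `Y`, it splits `W` into `P_B` and the factors that vanish at the point
without being of type A (`exists_split`). If `P(α, β) = 0`, the output is `T` and `P_B`, with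
constants fixed by scaling; if `P(α, β) ≠ 0`, it is `(1, P)`. The case distinction is needed since
`T` would otherwise keep the type D factors that the second stable case assigns to the other side.
For monic factors `P_D = 1`.

For the running time, `PT e f` says that a single program takes `e i` to `f i` for all `i`, so that
the field may vary with the index. This relation is closed under composition, pairing, case
distinction and loops with polynomially many rounds and polynomially bounded states. List
operations, binary arithmetic, field arithmetic, truncated polynomials and elimination are built on
these closure properties. Two variables are reduced to one by `X ↦ X ^ L + α`, `Y ↦ X + β` with
large `L`: divisibility by `X ^ N` after translation becomes vanishing of the first `N * L`
coefficients (`X_pow_dvd_subst_iff`). -/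

namespace TreeMachine

/-! ### Polynomial bounds -/

theorem eval_mono_nat (B : ℕ[X]) : Monotone fun n => B.eval n := by
  intro a b h
  simp only [eval_eq_sum_range]
  gcongr

/-- `s` is bounded by a polynomial in the size of `e`. -/
def PB {ι : Type*} (e : ι → Data) (s : ι → ℕ) : Prop :=
  ∃ B : ℕ[X], ∀ i, s i ≤ B.eval (e i).size

namespace PB
variable {ι κ : Type*} {e : ι → Data} {s t : ι → ℕ}

theorem const (n : ℕ) : PB e fun _ => n := ⟨C n, by simp⟩

theorem size : PB e fun i => (e i).size := ⟨X, by simp⟩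

theorem mono (h : PB e t) (hst : ∀ i, s i ≤ t i) : PB e s :=
  let ⟨B, hB⟩ := h
  ⟨B, fun i => (hst i).trans (hB i)⟩

theorem add (h₁ : PB e s) (h₂ : PB e t) : PB e fun i => s i + t i :=
  let ⟨A, hA⟩ := h₁
  let ⟨B, hB⟩ := h₂
  ⟨A + B, fun i => by simpa using add_le_add (hA i) (hB i)⟩

theorem mul (h₁ : PB e s) (h₂ : PB e t) : PB e fun i => s i * t i :=
  let ⟨A, hA⟩ := h₁
  let ⟨B, hB⟩ := h₂
  ⟨A * B, fun i => by simpa using Nat.mul_le_mul (hA i) (hB i)⟩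

theorem comp {f : ι → Data} (h₁ : PB e fun i => (f i).size) (h₂ : PB f s) : PB e s :=
  let ⟨A, hA⟩ := h₁
  let ⟨B, hB⟩ := h₂
  ⟨B.comp A, fun i => by simpa using (hB i).trans (eval_mono_nat B (hA i))⟩

theorem reindex (h : PB e s) (g : κ → ι) : PB (fun k => e (g k)) fun k => s (g k) :=
  let ⟨A, hA⟩ := h
  ⟨A, fun k => hA (g k)⟩

theorem of_le {f : ι → Data} (h : PB f s) (hf : ∀ i, (f i).size ≤ (e i).size) : PB e s :=
  comp (size.mono hf) h

end PB

/-! ### Polynomial time -/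

theorem Data.size_pos (d : Data) : 0 < d.size := by cases d <;> simp [Data.size]

theorem Data.size_left_le (d : Data) : d.left.size ≤ d.size := by
  cases d <;> simp [Data.size, Data.left]; omega

theorem Data.size_right_le (d : Data) : d.right.size ≤ d.size := by
  cases d <;> simp [Data.size, Data.right]; omega

/-- Every instruction pays at least for what it writes. This is what bounds intermediate results
when polynomial-time computations are composed. -/
theorem Runs.size_le {f : Prog} {x y : Data} {t : ℕ} (h : Runs f x y t) : y.size ≤ t := by
  induction h with
  | leaf x => exact x.size_pos
  | id x => exact le_rfl
  | left x => exact x.size_left_le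
  | right x => exact x.size_right_le
  | @node _ _ x => have := x.size_pos; simp only [Data.size]; omega
  | _ => omega

/-- One program computes `f i` from `e i`, for all `i`, in time polynomial in the size of `e i`. -/
def PT {ι : Type*} (e f : ι → Data) : Prop :=
  ∃ (q : Prog) (t : ι → ℕ), PB e t ∧ ∀ i, Runs q (e i) (f i) (t i)

namespace PT
variable {ι κ : Type*} {e f g c : ι → Data}

theorem out_size (h : PT e f) : PB e fun i => (f i).size :=
  let ⟨_, _, ht, hr⟩ := h
  ht.mono fun i => (hr i).size_le

theorem congr (h : PT e f) (hfg : ∀ i, f i = g i) : PT e g := by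
  rwa [← funext hfg]

theorem id : PT e e := ⟨.id, _, PB.size, fun _ => Runs.id _⟩

/-- The intermediate tree has size polynomial in the input by `out_size`, so a time bound in terms
of it is also one in terms of the input. -/
theorem trans (h₁ : PT e f) (h₂ : PT f g) : PT e g :=
  let ⟨q, _, hs, hq⟩ := h₁
  let ⟨r, _, ht, hr⟩ := h₂
  ⟨.seq q r, _, (PB.size.add hs).add (PB.comp h₁.out_size ht), fun i => (hq i).seq (hr i)⟩

theorem leaf : PT e fun _ => .leaf := ⟨.leaf, _, PB.size, fun _ => Runs.leaf _⟩

theorem left (h : PT e f) : PT e fun i => (f i).left :=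
  h.trans ⟨.left, _, PB.size, fun _ => Runs.left _⟩

theorem right (h : PT e f) : PT e fun i => (f i).right :=
  h.trans ⟨.right, _, PB.size, fun _ => Runs.right _⟩

theorem node (h₁ : PT e f) (h₂ : PT e g) : PT e fun i => .node (f i) (g i) :=
  let ⟨q, _, hs, hq⟩ := h₁
  let ⟨r, _, ht, hr⟩ := h₂
  ⟨.node q r, _, (PB.size.add hs).add ht, fun i => (hq i).node (hr i)⟩

theorem const (d : Data) : PT e fun _ => d := by
  induction d with
  | leaf => exact leaf
  | node _ _ h₁ h₂ => exact h₁.node h₂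

theorem of_node_left (h : PT e fun i => .node (f i) (g i)) : PT e f := h.left
theorem of_node_right (h : PT e fun i => .node (f i) (g i)) : PT e g := h.right

theorem reindex (h : PT e f) (p : κ → ι) : PT (fun k => e (p k)) fun k => f (p k) :=
  let ⟨q, _, ht, hr⟩ := h
  ⟨q, _, ht.reindex p, fun k => hr (p k)⟩

/-- A computation from `e` is also one from data that begin with `e`. -/
theorem wk (h : PT e f) {p : κ → ι} {r : κ → Data} :
    PT (fun k => .node (e (p k)) (r k)) fun k => f (p k) :=
  (of_node_left id).trans (h.reindex p)

theorem var₁ {a b d : κ → Data} : PT (fun k => .node (a k) (.node (b k) (d k))) b := id.right.left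

theorem var₂ {a b d : κ → Data} : PT (fun k => .node (a k) (.node (b k) (d k))) d := id.right.right

/-- Definition by cases whether `c` is a leaf, each branch in its own range of indices. -/
theorem ite_leaf' {r : ι → Data} (hc : PT e c)
    (hf : PT (fun i : {i // c i ≠ .leaf} => e i) fun i => f i)
    (hg : PT (fun i : {i // c i = .leaf} => e i) fun i => g i)
    (hrf : ∀ i, c i ≠ .leaf → r i = f i) (hrg : ∀ i, c i = .leaf → r i = g i) : PT e r := by
  classical
  obtain ⟨qc, s, hs, hqc⟩ := hc
  obtain ⟨qf, t, ⟨T, hT⟩, hqf⟩ := hf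
  obtain ⟨qg, u, ⟨U, hU⟩, hqg⟩ := hg
  -- The bounds `T` and `U` are known only on the index ranges of their own branches, but as
  -- polynomials they can be evaluated everywhere, and their sum covers both cases.
  have key : ∀ i, ∃ w, Runs (.ite qc qf qg) (e i) (r i) w ∧
      w ≤ (e i).size + s i + (T.eval (e i).size + U.eval (e i).size) := by
    intro i
    by_cases h : c i = .leaf
    · rw [hrg i h]
      refine ⟨_, Runs.ite_false (h ▸ hqc i) (hqg ⟨i, h⟩), ?_⟩
      have := hU ⟨i, h⟩
      simp only at this; omega
    · rw [hrf i h]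
      have h1 := hqc i
      have h2 := hT ⟨i, h⟩
      have h3 := hqf ⟨i, h⟩
      cases hd : c i with
      | leaf => exact absurd hd h
      | node a b =>
        rw [hd] at h1
        refine ⟨_, Runs.ite_true h1 h3, ?_⟩
        simp only at h2; omega
  choose w hw hwb using key
  exact ⟨_, w, ((PB.size.add hs).add (PB.add ⟨T, fun _ => le_rfl⟩ ⟨U, fun _ => le_rfl⟩)).mono hwb,
    hw⟩

/-- Iteration. -/
theorem loop {st c : ι → ℕ → Data} {n : ι → ℕ} (hn : PB (fun i => st i 0) n)
    (hsz : ∃ s, PB (fun i => st i 0) s ∧ ∀ i, ∀ k ≤ n i, (st i k).size ≤ s i)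
    (hc : PT (fun q : {q : ι × ℕ // q.2 ≤ n q.1} => st q.1.1 q.1.2) fun q => c q.1.1 q.1.2)
    (hc₁ : ∀ i, ∀ k < n i, c i k ≠ .leaf) (hc₂ : ∀ i, c i (n i) = .leaf)
    (hf : PT (fun q : {q : ι × ℕ // q.2 < n q.1} => st q.1.1 q.1.2)
      fun q => st q.1.1 (q.1.2 + 1)) :
    PT (fun i => st i 0) fun i => st i (n i) := by
  obtain ⟨s, hs, hst⟩ := hsz
  obtain ⟨qc, tc, ⟨A, hA⟩, hqc⟩ := hc
  obtain ⟨qf, tf, ⟨B, hB⟩, hqf⟩ := hf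
  -- Induction on the number `j` of rounds left, since `Runs.loop_step` prepends a round. The factor
  -- `j + 1` counts the evaluations of the condition, which happen once more than the rounds.
  have key : ∀ i, ∀ j ≤ n i, ∃ t, Runs (.loop qc qf) (st i (n i - j)) (st i (n i)) t ∧
      t ≤ (j + 1) * (s i + A.eval (s i) + B.eval (s i)) := by
    intro i j
    induction j with
    | zero =>
      intro _
      have h1 := hqc ⟨(i, n i), le_rfl⟩
      simp only [hc₂] at h1
      refine ⟨_, Runs.loop_stop h1, ?_⟩
      have h2 := hA ⟨(i, n i), le_rfl⟩
      have h3 := eval_mono_nat A (hst i _ le_rfl)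
      have h4 := hst i _ le_rfl
      simp only at h2 h3; simp only [Nat.sub_zero]; omega
    | succ j ih =>
      intro hj
      obtain ⟨t, ht, htb⟩ := ih (by omega)
      have hlt : n i - (j + 1) < n i := by omega
      have h1 := hqc ⟨(i, n i - (j + 1)), hlt.le⟩
      have h2 := hqf ⟨(i, n i - (j + 1)), hlt⟩
      have h3 := hA ⟨(i, n i - (j + 1)), hlt.le⟩
      have h4 := hB ⟨(i, n i - (j + 1)), hlt⟩
      have h5 := hst i _ hlt.le
      have h6 := eval_mono_nat A h5
      have h7 := eval_mono_nat B h5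
      have h8 := hc₁ i _ hlt
      simp only at h1 h2 h3 h4 h6 h7
      rw [show n i - (j + 1) + 1 = n i - j by omega] at h2
      cases hd : c i (n i - (j + 1)) with
      | leaf => exact absurd hd h8
      | node a b =>
        rw [hd] at h1
        refine ⟨_, Runs.loop_step h1 h2 ht, ?_⟩
        have : (j + 1 + 1) * (s i + A.eval (s i) + B.eval (s i)) =
          (j + 1) * (s i + A.eval (s i) + B.eval (s i)) +
            (s i + A.eval (s i) + B.eval (s i)) := by ring
        omega
  have key' : ∀ i, ∃ t, Runs (.loop qc qf) (st i 0) (st i (n i)) t ∧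
      t ≤ (n i + 1) * (s i + A.eval (s i) + B.eval (s i)) := by
    intro i; simpa using key i (n i) le_rfl
  choose t ht htb using key'
  have hev : ∀ B : ℕ[X], PB (fun i => st i 0) fun i => B.eval (s i) := by
    intro B
    obtain ⟨S, hS⟩ := hs
    exact ⟨B.comp S, fun i => by simpa using eval_mono_nat B (hS i)⟩
  exact ⟨_, t, ((hn.add (.const 1)).mul ((hs.add (hev A)).add (hev B))).mono htb, ht⟩

end PT

/-! ### Lists -/

@[simp] theorem encList_nil : encList [] = .leaf := rfl
@[simp] theorem encList_cons (a : Data) (l : List Data) :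
  encList (a :: l) = .node a (encList l) := rfl

theorem length_le_size_encList (l : List Data) : l.length ≤ (encList l).size := by
  induction l with
  | nil => simp
  | cons a l ih => simp only [List.length_cons, encList_cons, Data.size]; omega

theorem size_encList_drop_le (l : List Data) (k : ℕ) :
    (encList (l.drop k)).size ≤ (encList l).size := by
  induction l generalizing k with
  | nil => simp
  | cons a l ih =>
    cases k with
    | zero => simp
    | succ k => simp only [List.drop_succ_cons, encList_cons, Data.size]; have := ih k; omega

theorem size_le_size_encList {l : List Data} {a : Data} (h : a ∈ l) :
    a.size ≤ (encList l).size := by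
  induction l with
  | nil => simp at h
  | cons b l ih =>
    simp only [encList_cons, Data.size]
    rcases List.mem_cons.1 h with rfl | h
    · omega
    · have := ih h; omega

theorem size_encList_le (l : List Data) (b : ℕ) (h : ∀ a ∈ l, a.size ≤ b) :
    (encList l).size ≤ l.length * (b + 1) + 1 := by
  induction l with
  | nil => simp [Data.size]
  | cons a l ih =>
    have h1 := ih fun a ha => h a (by simp [ha])
    have h2 := h a (by simp)
    simp only [encList_cons, Data.size, List.length_cons, Nat.succ_mul]; omega

theorem size_encList_append (l k : List Data) :
    (encList (l ++ k)).size + 1 = (encList l).size + (encList k).size := by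
  induction l with
  | nil => simp [Data.size]; omega
  | cons a l ih => simp only [List.cons_append, encList_cons, Data.size]; omega

namespace PT
universe u v w
variable {ι : Type*} {e : ι → Data}

/-- Folding over a list, the accumulator being of size polynomial in the size of the input. -/
theorem foldl' {γ : ι → Type v} {δ : ι → Type w} {eγ : ∀ i, γ i → Data} {eδ : ∀ i, δ i → Data}
    {l : ∀ i, List (γ i)} {a : ∀ i, δ i} {s : ∀ i, δ i → γ i → δ i}
    (hl : PT e fun i => encList ((l i).map (eγ i))) (ha : PT e fun i => eδ i (a i))
    (hsz : ∃ b, PB e b ∧ ∀ i l', l' <+: l i → (eδ i (l'.foldl (s i) (a i))).size ≤ b i)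
    (hs : PT (fun q : {q : Σ i, List (γ i) × γ i // q.2.1 ++ [q.2.2] <+: l q.1} =>
        .node (e q.1.1) (.node (eδ q.1.1 (q.1.2.1.foldl (s q.1.1) (a q.1.1))) (eγ _ q.1.2.2)))
      fun q => eδ q.1.1 (s _ (q.1.2.1.foldl (s q.1.1) (a q.1.1)) q.1.2.2)) :
    PT e fun i => eδ i ((l i).foldl (s i) (a i)) := by
  obtain ⟨b, hb, hbs⟩ := hsz
  let acc : ∀ i, ℕ → δ i := fun i k => ((l i).take k).foldl (s i) (a i)
  -- The state of the loop keeps the whole input beside the accumulator and the remaining list,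
  -- because the step may use the input.
  let st : ι → ℕ → Data := fun i k =>
    .node (e i) (.node (eδ i (acc i k)) (encList (((l i).drop k).map (eγ i))))
  have h0 : PT e fun i => st i 0 := by
    simpa [st, acc] using id.node (ha.node hl)
  have hle : ∀ i, (e i).size ≤ (st i 0).size := fun i => by simp only [st, Data.size]; omega
  have hl' : PB (fun i => st i 0) fun i => (encList ((l i).map (eγ i))).size :=
    hl.out_size.of_le hle
  have hlen : PB (fun i => st i 0) fun i => (l i).length :=
    hl'.mono fun i => by simpa using length_le_size_encList ((l i).map (eγ i))
  have hmain : PT (fun i => st i 0) fun i => st i (l i).length := by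
    refine loop (c := fun i k => encList (((l i).drop k).map (eγ i))) hlen ?_ ?_ ?_ ?_ ?_
    · refine ⟨_, ((PB.size.add (hb.of_le hle)).add hl').add (.const 2), fun i k hk => ?_⟩
      have h1 := hbs i _ (List.take_prefix k (l i))
      have h2 := size_encList_drop_le ((l i).map (eγ i)) k
      have h3 := hle i
      rw [← List.map_drop] at h2
      simp only [acc, st, Data.size] at *; omega
    · exact id.right.right
    · intro i k hk
      simp only [List.drop_eq_getElem_cons hk, List.map_cons, encList_cons]; exact Data.noConfusion
    · simp
    · have hs' := hs.reindex
        (fun q : {q : ι × ℕ // q.2 < (l q.1).length} =>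
          ⟨⟨q.1.1, (l q.1.1).take q.1.2, (l q.1.1)[q.1.2]'q.2⟩, by
            rw [List.take_concat_get']
            exact List.take_prefix _ _⟩)
      have hst : ∀ q : {q : ι × ℕ // q.2 < (l q.1).length}, st q.1.1 q.1.2 =
          .node (e q.1.1) (.node (eδ _ (acc q.1.1 q.1.2))
            (.node (eγ _ ((l q.1.1)[q.1.2]'q.2))
              (encList (((l q.1.1).drop (q.1.2 + 1)).map (eγ _))))) := by
        intro q
        simp only [st]
        rw [List.drop_eq_getElem_cons q.2]; rfl
      have hst' : ∀ q : {q : ι × ℕ // q.2 < (l q.1).length}, st q.1.1 (q.1.2 + 1) =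
          .node (e q.1.1) (.node (eδ _ (s _ (acc q.1.1 q.1.2) ((l q.1.1)[q.1.2]'q.2)))
              (encList (((l q.1.1).drop (q.1.2 + 1)).map (eγ _)))) := by
        intro q
        simp only [st, acc]
        rw [← List.take_concat_get' _ _ q.2, List.foldl_append]; rfl
      rw [funext hst, funext hst']
      have hi := id (e := fun q : {q : ι × ℕ // q.2 < (l q.1).length} =>
        Data.node (e q.1.1) (.node (eδ _ (acc q.1.1 q.1.2))
            (.node (eγ _ ((l q.1.1)[q.1.2]'q.2))
              (encList (((l q.1.1).drop (q.1.2 + 1)).map (eγ _))))))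
      exact hi.left.node (((hi.left.node (hi.right.left.node hi.right.right.left)).trans hs').node
        hi.right.right.right)
  have := (h0.trans hmain).right.left
  simpa [st, acc, Data.left, Data.right] using this

end PT
end TreeMachine

/-! ### Truth values and list operations in polynomial time. -/

namespace TreeMachine

/-- A truth value. -/
noncomputable def encProp (p : Prop) : Data :=
  open Classical in if p then .node .leaf .leaf else .leaf

theorem encProp_of {p : Prop} (h : p) : encProp p = .node .leaf .leaf := by simp [encProp, h]
theorem encProp_of_not {p : Prop} (h : ¬p) : encProp p = .leaf := by simp [encProp, h]

theorem encProp_eq_leaf {p : Prop} : encProp p = .leaf ↔ ¬p := by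
  by_cases h : p <;> simp [encProp, h]

theorem size_encProp_le (p : Prop) : (encProp p).size ≤ 3 := by
  by_cases h : p <;> simp [encProp, h, Data.size]

/-- A natural number in unary. -/
def unary (n : ℕ) : Data := encList (List.replicate n .leaf)

theorem size_unary (n : ℕ) : (unary n).size = 2 * n + 1 := by
  induction n with
  | zero => rfl
  | succ n ih => simp only [unary, List.replicate_succ, encList_cons, Data.size] at *; omega

theorem size_encList_flatten_le (L : List (List Data)) :
    (encList L.flatten).size ≤ (encList (L.map encList)).size := by
  induction L with
  | nil => simp
  | cons l L ih =>
    have := size_encList_append l L.flatten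
    simp only [List.flatten_cons, List.map_cons, encList_cons, Data.size]; omega

namespace PT
universe u v w v' w'
variable {ι : Type u} {e : ι → Data}

theorem ite_leaf {c f g r : ι → Data} (hc : PT e c) (hf : PT e f) (hg : PT e g)
    (hrf : ∀ i, c i ≠ .leaf → r i = f i) (hrg : ∀ i, c i = .leaf → r i = g i) : PT e r :=
  ite_leaf' hc (hf.reindex _) (hg.reindex _) hrf hrg

theorem ite {p : ι → Prop} [∀ i, Decidable (p i)] {α : ι → Type v} {eα : ∀ i, α i → Data}
    {a b : ∀ i, α i} (hp : PT e fun i => encProp (p i)) (ha : PT e fun i => eα i (a i))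
    (hb : PT e fun i => eα i (b i)) : PT e fun i => eα i (if p i then a i else b i) := by
  refine ite_leaf hp ha hb (fun i h => ?_) fun i h => ?_
  · rw [ne_eq, encProp_eq_leaf, not_not] at h; rw [if_pos h]
  · rw [encProp_eq_leaf] at h; rw [if_neg h]

theorem eq_leaf {c : ι → Data} (hc : PT e c) : PT e fun i => encProp (c i = .leaf) :=
  ite_leaf hc (const .leaf) (const (.node .leaf .leaf)) (fun _ h => encProp_of_not h)
    fun _ h => encProp_of h

theorem not {p : ι → Prop} (hp : PT e fun i => encProp (p i)) : PT e fun i => encProp (¬p i) :=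
  hp.eq_leaf.congr fun i => by rw [encProp_eq_leaf]

theorem and {p q : ι → Prop} (hp : PT e fun i => encProp (p i))
    (hq : PT e fun i => encProp (q i)) : PT e fun i => encProp (p i ∧ q i) :=
  ite_leaf hp hq (const .leaf) (fun i h => by
    rw [ne_eq, encProp_eq_leaf, not_not] at h; simp [h]) fun i h => by
    rw [encProp_eq_leaf] at h; simp [h, encProp]

variable {γ : ι → Type v} {δ : ι → Type w} {eγ : ∀ i, γ i → Data} {eδ : ∀ i, δ i → Data}
  {l l₂ : ∀ i, List (γ i)}

/-- The convenient form of `foldl'`: the step is computed for every accumulator, reachable or not.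
The size bound is still required only along the actual computation. -/
theorem foldl {a : ∀ i, δ i} {s : ∀ i, δ i → γ i → δ i}
    (hl : PT e fun i => encList ((l i).map (eγ i))) (ha : PT e fun i => eδ i (a i))
    (hsz : ∃ b, PB e b ∧ ∀ i l', l' <+: l i → (eδ i (l'.foldl (s i) (a i))).size ≤ b i)
    (hs : PT (fun q : Σ i, δ i × γ i =>
        .node (e q.1) (.node (eδ q.1 q.2.1) (eγ q.1 q.2.2)))
      fun q => eδ q.1 (s q.1 q.2.1 q.2.2)) :
    PT e fun i => eδ i ((l i).foldl (s i) (a i)) :=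
  foldl' hl ha hsz (hs.reindex fun q : {q : Σ i, List (γ i) × γ i // q.2.1 ++ [q.2.2] <+: l q.1} =>
    ⟨q.1.1, q.1.2.1.foldl (s q.1.1) (a q.1.1), q.1.2.2⟩)

theorem nil : PT e fun i => encList (([] : List (γ i)).map (eγ i)) := leaf

theorem cons {a : ∀ i, γ i} (ha : PT e fun i => eγ i (a i))
    (hl : PT e fun i => encList ((l i).map (eγ i))) :
    PT e fun i => encList ((a i :: l i).map (eγ i)) := ha.node hl

theorem singleton {a : ∀ i, γ i} (ha : PT e fun i => eγ i (a i)) :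
    PT e fun i => encList ([a i].map (eγ i)) := ha.node leaf

theorem tail (hl : PT e fun i => encList ((l i).map (eγ i))) :
    PT e fun i => encList ((l i).tail.map (eγ i)) :=
  hl.right.congr fun i => by cases l i <;> rfl

theorem eq_nil (hl : PT e fun i => encList ((l i).map (eγ i))) :
    PT e fun i => encProp (l i = []) :=
  hl.eq_leaf.congr fun i => by cases l i <;> simp

theorem reverse (hl : PT e fun i => encList ((l i).map (eγ i))) :
    PT e fun i => encList ((l i).reverse.map (eγ i)) := by
  have hkey : ∀ (l : List Data), (encList l.reverse).size = (encList l).size := by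
    intro l
    induction l with
    | nil => rfl
    | cons a l ih =>
      have := size_encList_append l.reverse [a]
      simp only [List.reverse_cons, encList_cons, encList_nil, Data.size] at *; omega
  have hrev : ∀ i (l acc : List (γ i)), l.foldl (fun acc x => x :: acc) acc = l.reverse ++ acc := by
    intro i l
    induction l with
    | nil => simp
    | cons a l ih => simp [ih]
  have := foldl (eδ := fun i (l : List (γ i)) => encList (l.map (eγ i)))
    (s := fun i acc x => x :: acc) (a := fun i => []) hl nil
    ⟨_, hl.out_size, fun i l' h => by
      obtain ⟨k, hk⟩ := h
      have := size_encList_append (l'.map (eγ i)) (k.map (eγ i))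
      have hp := (encList (k.map (eγ i))).size_pos
      have h3 := hkey (l'.map (eγ i))
      simp only [hrev, List.append_nil, ← hk, List.map_append,
        List.map_reverse]
      omega⟩ (var₂.node var₁)
  simpa using this

theorem foldr {a : ∀ i, δ i} {s : ∀ i, γ i → δ i → δ i}
    (hl : PT e fun i => encList ((l i).map (eγ i))) (ha : PT e fun i => eδ i (a i))
    (hsz : ∃ b, PB e b ∧ ∀ i l', l' <:+ l i → (eδ i (l'.foldr (s i) (a i))).size ≤ b i)
    (hs : PT (fun q : Σ i, δ i × γ i =>
        .node (e q.1) (.node (eδ q.1 q.2.1) (eγ q.1 q.2.2)))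
      fun q => eδ q.1 (s q.1 q.2.2 q.2.1)) :
    PT e fun i => eδ i ((l i).foldr (s i) (a i)) := by
  obtain ⟨b, hb, hbs⟩ := hsz
  have := foldl (s := fun i acc x => s i x acc) hl.reverse ha ⟨b, hb, fun i l' h => by
    have := hbs i l'.reverse (by simpa using List.reverse_suffix.2 h)
    simpa using this⟩ hs
  simpa using this

theorem append (hl : PT e fun i => encList ((l i).map (eγ i)))
    (hl₂ : PT e fun i => encList ((l₂ i).map (eγ i))) :
    PT e fun i => encList ((l i ++ l₂ i).map (eγ i)) := by
  have := foldr (eδ := fun i (l : List (γ i)) => encList (l.map (eγ i)))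
    (s := fun i x acc => x :: acc) (a := l₂) hl hl₂
    ⟨_, hl.out_size.add hl₂.out_size, fun i l' h => by
      obtain ⟨k, hk⟩ := h
      have h1 := size_encList_append (k.map (eγ i)) (l'.map (eγ i))
      have h2 := size_encList_append (l'.map (eγ i)) ((l₂ i).map (eγ i))
      have hp := (encList (k.map (eγ i))).size_pos
      simp only [List.foldr_cons_eq_append', ← hk, List.map_append]
      omega⟩ (var₂.node var₁)
  simpa using this

theorem map {f : ∀ i, γ i → δ i} (hl : PT e fun i => encList ((l i).map (eγ i)))
    (hf : PT (fun q : Σ i, γ i => .node (e q.1) (eγ q.1 q.2)) fun q => eδ q.1 (f q.1 q.2)) :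
    PT e fun i => encList (((l i).map (f i)).map (eδ i)) := by
  obtain ⟨B, hB⟩ := hf.out_size
  have hrev : ∀ i (l : List (γ i)) (acc : List (δ i)),
      l.foldl (fun acc x => f i x :: acc) acc = (l.map (f i)).reverse ++ acc := by
    intro i l
    induction l with
    | nil => simp
    | cons a l ih => intro acc; simp [ih]
  have hlen : PB e fun i => (l i).length :=
    hl.out_size.mono fun i => by simpa using length_le_size_encList ((l i).map (eγ i))
  have hB' : PB e fun i => B.eval ((e i).size + (encList ((l i).map (eγ i))).size + 1) := by
    obtain ⟨A, hA⟩ := hl.out_size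
    refine ⟨B.comp (X + A + 1), fun i => ?_⟩
    simp only [eval_comp, eval_add, eval_X, eval_one]
    exact eval_mono_nat B (by have := hA i; simp only at this; omega)
  have := (foldl (eδ := fun i (l : List (δ i)) => encList (l.map (eδ i)))
    (s := fun i acc x => f i x :: acc) (a := fun i => []) hl nil
    ⟨_, (hlen.mul (hB'.add (.const 1))).add (.const 1), fun i l' h => by
      rw [hrev, List.append_nil]
      refine (size_encList_le _ (B.eval ((e i).size + (encList ((l i).map (eγ i))).size + 1))
        ?_).trans ?_
      · intro d hd
        simp only [List.mem_map, List.mem_reverse] at hd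
        obtain ⟨_, ⟨x, hx, rfl⟩, rfl⟩ := hd
        refine (hB ⟨i, x⟩).trans (eval_mono_nat B ?_)
        have := size_le_size_encList (List.mem_map_of_mem (f := eγ i) (h.subset hx))
        simp only [Data.size]; omega
      · have := h.length_le
        simp only [List.length_map, List.length_reverse]; gcongr⟩
    (((of_node_left id).node var₂ |>.trans (hf.reindex fun q : Σ i, List (δ i) × γ i =>
      (⟨q.1, q.2.2⟩ : Σ i, γ i))).node var₁)).reverse
  simpa [hrev] using this

theorem flatten {L : ∀ i, List (List (γ i))}
    (hL : PT e fun i => encList ((L i).map fun l => encList (l.map (eγ i)))) :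
    PT e fun i => encList ((L i).flatten.map (eγ i)) := by
  have hfl : ∀ i (L : List (List (γ i))), L.foldr (fun x acc => x ++ acc) [] = L.flatten := by
    intro i L
    induction L with
    | nil => rfl
    | cons a L ih => simp [ih]
  have := foldr (eγ := fun i (l : List (γ i)) => encList (l.map (eγ i)))
    (eδ := fun i (l : List (γ i)) => encList (l.map (eγ i)))
    (s := fun i x acc => x ++ acc) (a := fun i => []) hL nil
    ⟨_, hL.out_size, fun i l' h => by
      obtain ⟨k, hk⟩ := h
      have h1 := size_encList_append (k.map fun l => encList (l.map (eγ i)))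
        (l'.map fun l => encList (l.map (eγ i)))
      have h2 := size_encList_flatten_le (l'.map (List.map (eγ i)))
      have hp := (encList (k.map fun l => encList (l.map (eγ i)))).size_pos
      simp only [hfl, ← hk, List.map_append, List.map_flatten, List.map_map] at *
      have h3 : encList ∘ List.map (eγ i) = fun l => encList (l.map (eγ i)) := rfl
      rw [h3] at h2
      omega⟩ (append var₂ var₁)
  simpa [hfl] using this

theorem flatMap {f : ∀ i, γ i → List (δ i)} (hl : PT e fun i => encList ((l i).map (eγ i)))
    (hf : PT (fun q : Σ i, γ i => .node (e q.1) (eγ q.1 q.2))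
      fun q => encList ((f q.1 q.2).map (eδ q.1))) :
    PT e fun i => encList (((l i).flatMap (f i)).map (eδ i)) := by
  simpa [List.flatMap] using flatten (map (eδ := fun i (l : List (δ i)) => encList (l.map (eδ i))) hl hf)

/-- A fold over the first list whose accumulator holds the unused end of the second list and the
pairs produced so far, in reverse order. -/
theorem zip {m : ∀ i, List (δ i)} (hl : PT e fun i => encList ((l i).map (eγ i)))
    (hm : PT e fun i => encList ((m i).map (eδ i))) :
    PT e fun i => encList (((l i).zip (m i)).map fun x => .node (eγ i x.1) (eδ i x.2)) := by
  let s : ∀ i, List (δ i) × List (γ i × δ i) → γ i → List (δ i) × List (γ i × δ i) :=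
    fun i acc x => match acc with
      | ([], o) => ([], o)
      | (y :: r, o) => (r, (x, y) :: o)
  let eP : ∀ i, γ i × δ i → Data := fun i x => .node (eγ i x.1) (eδ i x.2)
  have hrev : ∀ i (l : List (γ i)) (m o), l.foldl (s i) (m, o) =
      (m.drop l.length, (l.zip m).reverse ++ o) := by
    intro i l
    induction l with
    | nil => simp
    | cons a l ih =>
      intro m o
      cases m with
      | nil => simp only [List.foldl_cons, s, ih]; simp
      | cons b m => simp only [List.foldl_cons, s, ih]; simp
  have hlen : PB e fun i => (l i).length :=
    hl.out_size.mono fun i => by simpa using length_le_size_encList ((l i).map (eγ i))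
  have h := foldl (eδ := fun i (x : List (δ i) × List (γ i × δ i)) =>
      .node (encList (x.1.map (eδ i))) (encList (x.2.map (eP i))))
    (s := s) (a := fun i => (m i, [])) hl (hm.node leaf)
    ⟨_, (hm.out_size.add ((hlen.mul (((hl.out_size.add hm.out_size).add (.const 1)).add (.const 1))).add
        (.const 1))).add (.const 1), fun i l' h => by
      rw [hrev]
      have h1 := size_encList_drop_le ((m i).map (eδ i)) l'.length
      rw [← List.map_drop] at h1
      have h2 := size_encList_le (((l'.zip (m i)).reverse).map (eP i))
        ((encList ((l i).map (eγ i))).size + (encList ((m i).map (eδ i))).size + 1) (by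
          intro d hd
          simp only [List.mem_map, List.mem_reverse] at hd
          obtain ⟨⟨x, y⟩, hxy, rfl⟩ := hd
          obtain ⟨hx, hy⟩ := List.of_mem_zip hxy
          have h1 := size_le_size_encList (List.mem_map_of_mem (f := eγ i) (h.subset hx))
          have h2 := size_le_size_encList (List.mem_map_of_mem (f := eδ i) hy)
          simp only [eP, Data.size]; omega)
      have h3 : (((l'.zip (m i)).reverse).map (eP i)).length ≤ (l i).length := by
        have := h.length_le
        simp only [List.length_map, List.length_reverse, List.length_zip]; omega
      have h4 := Nat.mul_le_mul_right
        ((encList ((l i).map (eγ i))).size + (encList ((m i).map (eδ i))).size + 1 + 1) h3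
      simp only [Data.size, List.append_nil]
      omega⟩
    (ite_leaf (c := fun q => encList (q.2.1.1.map (eδ _)))
      (f := fun q => .node (encList (q.2.1.1.map (eδ _))).right
        (.node (.node (eγ _ q.2.2) (encList (q.2.1.1.map (eδ _))).left)
          (encList (q.2.1.2.map (eP _)))))
      (g := fun q => .node .leaf (encList (q.2.1.2.map (eP _))))
      var₁.left (var₁.left.right.node ((var₂.node var₁.left.left).node var₁.right))
      (leaf.node var₁.right) (by
        rintro ⟨i, ⟨_ | ⟨y, r⟩, o⟩, x⟩ h
        · simp at h
        · rfl) (by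
        rintro ⟨i, ⟨_ | ⟨y, r⟩, o⟩, x⟩ h
        · rfl
        · simp at h))
  have := (of_node_right h).reverse
  simpa [hrev] using this

theorem zipWith {m : ∀ i, List (δ i)} {ε : ι → Type v'} {eε : ∀ i, ε i → Data}
    {f : ∀ i, γ i → δ i → ε i} (hl : PT e fun i => encList ((l i).map (eγ i)))
    (hm : PT e fun i => encList ((m i).map (eδ i)))
    (hf : PT (fun q : Σ i, γ i × δ i => .node (e q.1) (.node (eγ q.1 q.2.1) (eδ q.1 q.2.2)))
      fun q => eε q.1 (f q.1 q.2.1 q.2.2)) :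
    PT e fun i => encList ((List.zipWith (f i) (l i) (m i)).map (eε i)) := by
  refine (map (f := fun i x => f i x.1 x.2) (zip hl hm) hf).congr fun i => ?_
  rw [List.zip, List.map_zipWith]

theorem all {p : ∀ i, γ i → Prop} (hl : PT e fun i => encList ((l i).map (eγ i)))
    (hp : PT (fun q : Σ i, γ i => .node (e q.1) (eγ q.1 q.2)) fun q => encProp (p q.1 q.2)) :
    PT e fun i => encProp (∀ x ∈ l i, p i x) := by
  have := foldr (eδ := fun _ => encProp) (s := fun i x acc => p i x ∧ acc) (a := fun _ => True)
    hl ((const (.node .leaf .leaf)).congr fun _ => (encProp_of trivial).symm)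
    ⟨_, .const 3, fun i l' _ => size_encProp_le _⟩
    (and (((of_node_left id).node var₂).trans (hp.reindex fun q : Σ i, Prop × γ i =>
      (⟨q.1, q.2.2⟩ : Σ i, γ i))) var₁)
  refine this.congr fun i => congrArg _ ?_
  induction l i with
  | nil => simp
  | cons a l ih => simp [ih]

/-! ### Unary numbers -/

theorem length (hl : PT e fun i => encList ((l i).map (eγ i))) :
    PT e fun i => unary (l i).length :=
  (map (eδ := fun _ (_ : Unit) => .leaf) (f := fun _ _ => ()) hl leaf).congr fun i => by
    simp [unary]

variable {n k : ι → ℕ}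

theorem unary_list (hn : PT e fun i => unary (n i)) :
    PT e fun i => encList ((List.replicate (n i) ()).map fun _ => .leaf) := by
  simpa [unary] using hn

theorem unary_const (n : ℕ) : PT e fun _ => unary n := const _

theorem unary_add (hn : PT e fun i => unary (n i)) (hk : PT e fun i => unary (k i)) :
    PT e fun i => unary (n i + k i) := by
  refine (append hn.unary_list hk.unary_list).congr fun i => ?_
  simp [unary]

theorem unary_mul (hn : PT e fun i => unary (n i)) (hk : PT e fun i => unary (k i)) :
    PT e fun i => unary (n i * k i) := by
  refine (flatMap (eδ := fun _ (_ : Unit) => .leaf)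
    (f := fun i _ => List.replicate (k i) ()) hn.unary_list
    (hk.unary_list.wk (p := fun q : Σ _, Unit => q.1))).congr fun i => ?_
  simp [unary]

theorem unary_bound (hn : PT e fun i => unary (n i)) : PB e n :=
  hn.out_size.mono fun i => by rw [size_unary]; omega

theorem range (hn : PT e fun i => unary (n i)) :
    PT e fun i => encList ((List.range (n i)).map unary) := by
  have hf : ∀ m : ℕ, (List.replicate m ()).foldr (fun _ (acc : List ℕ) => acc ++ [acc.length]) [] =
      List.range m := by
    intro m
    induction m with
    | zero => rfl
    | succ m ih => rw [List.replicate_succ, List.foldr_cons, ih, List.range_succ]; simp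
  have hb := hn.unary_bound
  have := foldr (eδ := fun _ (l : List ℕ) => encList (l.map unary))
    (s := fun _ _ acc => acc ++ [acc.length]) (a := fun _ => []) hn.unary_list nil
    ⟨_, (hb.mul ((((PB.const 2).mul hb).add (.const 1)).add (.const 1))).add (.const 1),
      fun i l' h => by
      obtain ⟨m, hm, rfl⟩ : ∃ m, m ≤ n i ∧ l' = List.replicate m () :=
        ⟨l'.length, by simpa using h.length_le, List.eq_replicate_of_mem (by simp)⟩
      rw [hf]
      refine (size_encList_le _ (2 * n i + 1) ?_).trans ?_
      · intro d hd
        simp only [List.mem_map, List.mem_range] at hd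
        obtain ⟨x, hx, rfl⟩ := hd
        rw [size_unary]; omega
      · simp only [List.length_map, List.length_range]; gcongr⟩
    (append var₁ (singleton (length var₁)))
  simpa [hf] using this

/-- Zipping with a list of length `n` cuts the other list off after `n` entries, so no counter is
needed. -/
theorem take (hn : PT e fun i => unary (n i)) (hl : PT e fun i => encList ((l i).map (eγ i))) :
    PT e fun i => encList (((l i).take (n i)).map (eγ i)) := by
  refine (zipWith (f := fun _ x _ => x) hl hn.unary_list var₁).congr fun i => ?_
  congr 2
  generalize n i = n
  induction n generalizing hl with
  | zero => simp
  | succ n _ =>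
    clear hl hn
    generalize l i = l
    generalize n + 1 = m
    induction l generalizing m with
    | nil => simp
    | cons a l ih =>
      cases m with
      | zero => simp
      | succ m => simp [List.replicate_succ, ih]

theorem drop (hn : PT e fun i => unary (n i)) (hl : PT e fun i => encList ((l i).map (eγ i))) :
    PT e fun i => encList (((l i).drop (n i)).map (eγ i)) := by
  have hf : ∀ i (k : List Unit), k.foldr (fun _ (acc : List (γ i)) => acc.tail) (l i) =
      (l i).drop k.length := by
    intro i k
    induction k with
    | nil => rfl
    | cons _ k ih => rw [List.foldr_cons, ih]; simp
  have := foldr (eδ := fun i (l : List (γ i)) => encList (l.map (eγ i)))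
    (s := fun _ _ acc => acc.tail) (a := l) hn.unary_list hl
    ⟨_, hl.out_size, fun i l' h => by
      rw [hf, List.map_drop]
      exact size_encList_drop_le _ _⟩ (tail var₁)
  simpa [hf] using this

end PT
end TreeMachine

namespace TreeMachine

/-! ### Binary numbers -/

theorem encNat_zero : encNat 0 = .leaf := by simp [encNat]

theorem encNat_eq_leaf {n : ℕ} : encNat n = .leaf ↔ n = 0 := by
  constructor
  · intro h
    by_contra hn
    have : n.bits ≠ [] := fun h0 => by
      have := Nat.size_eq_bits_len n
      rw [h0] at this
      exact hn (Nat.size_eq_zero.1 this.symm)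
    cases hb : n.bits with
    | nil => exact this hb
    | cons b l => simp [encNat, hb] at h
  · rintro rfl; exact encNat_zero

theorem encNat_bit (b : Bool) (n : ℕ) (h : n = 0 → b = true) :
    encNat (Nat.bit b n) = .node (encBit b) (encNat n) := by
  simp [encNat, Nat.bits_append_bit n b h]

theorem right_encNat (n : ℕ) : (encNat n).right = encNat (n / 2) := by
  rw [← Nat.div2_val]
  simp only [encNat, Nat.div2_bits_eq_tail]
  cases n.bits <;> rfl

theorem left_encNat (n : ℕ) : (encNat n).left = encBit n.bodd := by
  simp only [encNat, Nat.bodd_eq_bits_head]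
  cases n.bits <;> rfl

theorem size_encBit_le (b : Bool) : (encBit b).size ≤ 3 := by cases b <;> simp [encBit, Data.size]

theorem size_encNat_le (n : ℕ) : (encNat n).size ≤ n.size * 4 + 1 := by
  refine (size_encList_le _ 3 ?_).trans ?_
  · simp only [List.mem_map]; rintro _ ⟨b, _, rfl⟩; exact size_encBit_le b
  · simp [Nat.size_eq_bits_len]

theorem natSize_le (n : ℕ) : n.size ≤ (encNat n).size := by
  have := length_le_size_encList (n.bits.map encBit)
  rwa [List.length_map, Nat.size_eq_bits_len] at this

theorem size_encNat_mono {m n : ℕ} (h : m ≤ n) : (encNat m).size ≤ (encNat n).size * 4 + 1 := by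
  have := size_encNat_le m
  have := Nat.size_le_size h
  have := natSize_le n
  omega

theorem size_encZMod_le {p : ℕ} [Fact p.Prime] (x : ZMod p) :
    (encZMod x).size ≤ (encNat p).size * 4 + 1 :=
  size_encNat_mono (ZMod.val_lt x).le

/-- Double and add. It serves for products of natural numbers and of residue classes alike. -/
theorem foldr_bits_smul {M : Type*} [AddMonoid M] (n : ℕ) (b : M) :
    n.bits.foldr (fun t acc => acc + acc + if t = true then b else 0) 0 = n • b := by
  induction n using Nat.binaryRec' with
  | zero => simp
  | bit t n h ih =>
    rw [Nat.bits_append_bit _ _ h, List.foldr_cons, ih, Nat.bit_val]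
    cases t <;> simp [add_nsmul, two_mul]

theorem foldr_bits_pow {M : Type*} [Monoid M] (n : ℕ) (b : M) :
    n.bits.foldr (fun t acc => acc * acc * if t = true then b else 1) 1 = b ^ n := by
  induction n using Nat.binaryRec' with
  | zero => simp
  | bit t n h ih =>
    rw [Nat.bits_append_bit _ _ h, List.foldr_cons, ih, Nat.bit_val]
    cases t <;> simp [pow_add, two_mul]

/-- One step of the subtraction of binary numbers: the numbers, the borrow, the output bits. -/
def subStep (s : ℕ × ℕ × Bool × List Bool) (_ : Unit) : ℕ × ℕ × Bool × List Bool :=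
  (s.1 / 2, s.2.1 / 2,
    (!s.1.bodd && (s.2.1.bodd || s.2.2.1)) || (s.2.1.bodd && s.2.2.1),
    (xor s.1.bodd (xor s.2.1.bodd s.2.2.1)) :: s.2.2.2)

/-- Value of a list of bits, most significant bit first. -/
def bitsVal (o : List Bool) : ℕ := o.foldl (fun n b => n + n + if b = true then 1 else 0) 0

theorem bitsVal_aux (o : List Bool) (n : ℕ) :
    o.foldl (fun n b => n + n + if b = true then 1 else 0) n = n * 2 ^ o.length + bitsVal o := by
  induction o generalizing n with
  | nil => simp [bitsVal]
  | cons b o ih =>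
    rw [bitsVal, List.foldl_cons, List.foldl_cons, ih, ih (0 + 0 + _), List.length_cons, pow_succ]
    ring

theorem bitsVal_cons (b : Bool) (o : List Bool) :
    bitsVal (b :: o) = (if b = true then 1 else 0) * 2 ^ o.length + bitsVal o := by
  rw [bitsVal, List.foldl_cons, bitsVal_aux]; simp

theorem bitsVal_lt (o : List Bool) : bitsVal o < 2 ^ o.length := by
  induction o with
  | nil => simp [bitsVal]
  | cons b o ih =>
    rw [bitsVal_cons, List.length_cons, pow_succ]
    split <;> omega

/-- The last clause is the invariant of subtraction with borrow: the difference still to be formed,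
shifted by the number of bits already written, plus the value of those bits, does not change. -/
theorem subStep_foldl (l : List Unit) (s : ℕ × ℕ × Bool × List Bool) :
    (l.foldl subStep s).1 = s.1 / 2 ^ l.length ∧ (l.foldl subStep s).2.1 = s.2.1 / 2 ^ l.length ∧
    (l.foldl subStep s).2.2.2.length = s.2.2.2.length + l.length ∧
    ((l.foldl subStep s).1 - (l.foldl subStep s).2.1 - (l.foldl subStep s).2.2.1.toNat : ℤ) *
      2 ^ (s.2.2.2.length + l.length) + bitsVal (l.foldl subStep s).2.2.2 =
      (s.1 - s.2.1 - s.2.2.1.toNat : ℤ) * 2 ^ s.2.2.2.length + bitsVal s.2.2.2 := by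
  induction l generalizing s with
  | nil => simp
  | cons u l ih =>
    obtain ⟨h1, h2, h3, h4⟩ := ih (subStep s u)
    rw [List.foldl_cons]
    refine ⟨?_, ?_, ?_, ?_⟩
    · rw [h1]; simp [subStep, Nat.div_div_eq_div_mul, pow_succ, mul_comm]
    · rw [h2]; simp [subStep, Nat.div_div_eq_div_mul, pow_succ, mul_comm]
    · rw [h3]; simp [subStep]; omega
    · have h5 : (subStep s u).2.2.2.length = s.2.2.2.length + 1 := by simp [subStep]
      rw [h5] at h4
      rw [List.length_cons, show s.2.2.2.length + (l.length + 1) = s.2.2.2.length + 1 + l.length by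
        omega, h4]
      obtain ⟨x, y, c, o⟩ := s
      have hx := Nat.bodd_add_div2 x
      have hy := Nat.bodd_add_div2 y
      rw [Nat.div2_val] at hx hy
      simp only [subStep, bitsVal_cons, pow_succ]
      have key : ((x / 2 : ℕ) - (y / 2 : ℕ) -
          ((!x.bodd && (y.bodd || c) || y.bodd && c).toNat : ℕ) : ℤ) * 2 +
          (if (xor x.bodd (xor y.bodd c)) = true then 1 else 0 : ℕ) = x - y - c.toNat := by
        rw [show (x : ℤ) = x.bodd.toNat + 2 * (x / 2 : ℕ) by exact_mod_cast hx.symm,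
          show (y : ℤ) = y.bodd.toNat + 2 * (y / 2 : ℕ) by exact_mod_cast hy.symm]
        generalize x / 2 = x', y / 2 = y', x.bodd = a, y.bodd = b
        cases a <;> cases b <;> cases c <;> simp <;> ring
      rw [← key]; push_cast; ring

/-- After enough rounds both numbers are used up, so the invariant reads `a - b = value - borrow * 2
^ length`. As the value is less than `2 ^ length`, the final borrow decides whether `a < b`. -/
theorem sub_eq_subStep (a b : ℕ) (l : List Unit) (ha : a < 2 ^ l.length) (hb : b < 2 ^ l.length) :
    a - b = if (l.foldl subStep (a, b, false, [])).2.2.1 = true then 0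
      else bitsVal (l.foldl subStep (a, b, false, [])).2.2.2 := by
  obtain ⟨h1, h2, h3, h4⟩ := subStep_foldl l (a, b, false, [])
  have h5 := bitsVal_lt (l.foldl subStep (a, b, false, [])).2.2.2
  simp only [Nat.div_eq_of_lt ha] at h1
  simp only [Nat.div_eq_of_lt hb] at h2
  rw [h1, h2] at h4
  rw [h3] at h5
  have hb0 : bitsVal [] = 0 := rfl
  have hP : (2 ^ l.length : ℤ) = ((2 ^ l.length : ℕ) : ℤ) := by push_cast; rfl
  simp only [List.length_nil, zero_add, hb0, Bool.toNat_false, hP] at h4 h5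
  generalize 2 ^ l.length = P at *
  split
  · rename_i h
    rw [h] at h4
    simp at h4; omega
  · rename_i h
    rw [Bool.not_eq_true] at h
    rw [h] at h4
    simp at h4; omega

theorem bits_two_pow (k : ℕ) : (2 ^ k).bits = List.replicate k false ++ [true] := by
  induction k with
  | zero => simp
  | succ k ih => rw [pow_succ, mul_comm, Nat.bit0_bits _ (by positivity), ih]; rfl

namespace PT
universe u v w
variable {ι : Type u} {e : ι → Data} {a b n : ι → ℕ}

theorem bool_cases {t : ι → Bool} {f : ι → Bool → Data} (ht : PT e fun i => encBit (t i))
    (h₁ : PT e fun i => f i true) (h₀ : PT e fun i => f i false) : PT e fun i => f i (t i) := by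
  refine ite_leaf ht h₁ h₀ (fun i h => ?_) fun i h => ?_ <;>
  · cases ht : t i <;> simp [ht, encBit] at h ⊢

theorem nat_div2 (ha : PT e fun i => encNat (a i)) : PT e fun i => encNat (a i / 2) :=
  ha.right.congr fun _ => right_encNat _

theorem nat_bodd (ha : PT e fun i => encNat (a i)) : PT e fun i => encBit (a i).bodd :=
  ha.left.congr fun _ => left_encNat _

theorem nat_bits (ha : PT e fun i => encNat (a i)) :
    PT e fun i => encList ((a i).bits.map encBit) := ha

theorem nat_bit {t : ι → Bool} (ha : PT e fun i => encNat (a i)) (ht : PT e fun i => encBit (t i)) :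
    PT e fun i => encNat (a i + a i + if t i = true then 1 else 0) := by
  refine bool_cases (f := fun i t => encNat (a i + a i + if t = true then 1 else 0)) ht ?_ ?_
  · refine ((const (encBit true)).node ha).congr fun i => ?_
    rw [← encNat_bit _ _ (by simp), Nat.bit_val]; simp [two_mul]
  · refine ite_leaf ha ((const (encBit false)).node ha) leaf (fun i h => ?_) fun i h => ?_
    · rw [ne_eq, encNat_eq_leaf] at h
      rw [← encNat_bit _ _ (by simp [h]), Nat.bit_val]; simp [two_mul]
    · rw [encNat_eq_leaf] at h
      simp [h, encNat_zero]

theorem nat_bitsVal {o : ι → List Bool} (ho : PT e fun i => encList ((o i).map encBit)) :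
    PT e fun i => encNat (bitsVal (o i)) := by
  refine foldl (eδ := fun _ => encNat) (s := fun _ n t => n + n + if t = true then 1 else 0)
    (a := fun _ => 0) ho (leaf.congr fun _ => encNat_zero.symm)
    ⟨_, ((ho.out_size).mul (.const 4)).add (.const 1), fun i l' h => ?_⟩ (nat_bit var₁ var₂)
  refine (size_encNat_le _).trans ?_
  have h1 := Nat.size_le.2 (bitsVal_lt l')
  have h2 := h.length_le
  have h3 := length_le_size_encList ((o i).map encBit)
  rw [List.length_map] at h3
  simp only [bitsVal] at h1; omega

theorem nat_sub (ha : PT e fun i => encNat (a i)) (hb : PT e fun i => encNat (b i)) :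
    PT e fun i => encNat (a i - b i) := by
  let l : ι → List Unit := fun i =>
    List.replicate ((a i).bits.length + (b i).bits.length) ()
  have hl : PT e fun i => encList ((l i).map fun _ => .leaf) :=
    (unary_add ha.nat_bits.length hb.nat_bits.length).unary_list
  have hll : ∀ i, (l i).length = (a i).size + (b i).size := fun i => by
    simp [l, Nat.size_eq_bits_len]
  let eS : ℕ × ℕ × Bool × List Bool → Data := fun s =>
    .node (encNat s.1) (.node (encNat s.2.1) (.node (encBit s.2.2.1)
      (encList (s.2.2.2.map encBit))))
  have hlen : PB e fun i => (l i).length :=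
    (ha.out_size.add hb.out_size).mono fun i => by
      rw [hll]; exact add_le_add (natSize_le _) (natSize_le _)
  have hf : PT e fun i => eS ((l i).foldl subStep (a i, b i, false, [])) := by
    refine foldl (eδ := fun _ => eS) (s := fun _ => subStep)
      (a := fun i => (a i, b i, false, [])) hl (ha.node (hb.node ((const _).node leaf)))
      ⟨_, ((((ha.out_size.mul (.const 4)).add (.const 1)).add
        ((hb.out_size.mul (.const 4)).add (.const 1))).add
        ((hlen.mul (.const (3 + 1))).add (.const 1))).add (.const 6), fun i l' h => ?_⟩ ?_
    · obtain ⟨h1, h2, h3, -⟩ := subStep_foldl l' (a i, b i, false, [])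
      have h4 := size_encNat_mono (Nat.div_le_self (a i) (2 ^ l'.length))
      have h5 := size_encNat_mono (Nat.div_le_self (b i) (2 ^ l'.length))
      have h6 := size_encBit_le (l'.foldl subStep (a i, b i, false, [])).2.2.1
      have h7 := size_encList_le ((l'.foldl subStep (a i, b i, false, [])).2.2.2.map encBit) 3 (by
        simp only [List.mem_map]; rintro _ ⟨b, _, rfl⟩; exact size_encBit_le b)
      have h8 := h.length_le
      simp only [List.length_map, h3, List.length_nil, zero_add] at h7
      simp only [eS, Data.size, h1, h2]; omega
    · have h1 : PT (fun q : Σ _ : ι, (ℕ × ℕ × Bool × List Bool) × Unit =>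
          .node (e q.1) (.node (eS q.2.1) .leaf)) fun q => encNat q.2.1.1 := var₁.left
      have h2 : PT (fun q : Σ _ : ι, (ℕ × ℕ × Bool × List Bool) × Unit =>
          .node (e q.1) (.node (eS q.2.1) .leaf)) fun q => encNat q.2.1.2.1 := var₁.right.left
      have h3 : PT (fun q : Σ _ : ι, (ℕ × ℕ × Bool × List Bool) × Unit =>
          .node (e q.1) (.node (eS q.2.1) .leaf)) fun q => encBit q.2.1.2.2.1 :=
        var₁.right.right.left
      have h4 : PT (fun q : Σ _ : ι, (ℕ × ℕ × Bool × List Bool) × Unit =>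
          .node (e q.1) (.node (eS q.2.1) .leaf)) fun q => encList (q.2.1.2.2.2.map encBit) :=
        var₁.right.right.right
      have key : ∀ f : Bool → Bool → Bool → Bool,
          PT (fun q : Σ _ : ι, (ℕ × ℕ × Bool × List Bool) × Unit =>
          .node (e q.1) (.node (eS q.2.1) .leaf)) fun q =>
            encBit (f q.2.1.1.bodd q.2.1.2.1.bodd q.2.1.2.2.1) := fun f =>
        bool_cases (f := fun q t => encBit (f t q.2.1.2.1.bodd q.2.1.2.2.1)) h1.nat_bodd
          (bool_cases (f := fun q t => encBit (f true t q.2.1.2.2.1)) h2.nat_bodd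
            (bool_cases (f := fun q t => encBit (f true true t)) h3 (const _) (const _))
            (bool_cases (f := fun q t => encBit (f true false t)) h3 (const _) (const _)))
          (bool_cases (f := fun q t => encBit (f false t q.2.1.2.2.1)) h2.nat_bodd
            (bool_cases (f := fun q t => encBit (f false true t)) h3 (const _) (const _))
            (bool_cases (f := fun q t => encBit (f false false t)) h3 (const _) (const _)))
      exact h1.nat_div2.node (h2.nat_div2.node
        ((key fun x y c => (!x && (y || c)) || (y && c)).node
          ((key fun x y c => xor x (xor y c)).node h4)))
  have ho : PT e fun i => encNat (bitsVal ((l i).foldl subStep (a i, b i, false, [])).2.2.2) :=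
    nat_bitsVal hf.right.right.right
  have hc : PT e fun i => encBit ((l i).foldl subStep (a i, b i, false, [])).2.2.1 :=
    hf.right.right.left
  refine (bool_cases (f := fun i t => encNat (if t = true then 0 else
    bitsVal ((l i).foldl subStep (a i, b i, false, [])).2.2.2)) hc (const _) ho).congr fun i => ?_
  rw [← sub_eq_subStep]
  · rw [hll]; exact (Nat.lt_size_self _).trans_le (Nat.pow_le_pow_right (by simp) (by omega))
  · rw [hll]; exact (Nat.lt_size_self _).trans_le (Nat.pow_le_pow_right (by simp) (by omega))

theorem nat_eq_zero (ha : PT e fun i => encNat (a i)) : PT e fun i => encProp (a i = 0) :=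
  ha.eq_leaf.congr fun i => by rw [encNat_eq_leaf]

theorem nat_lt (ha : PT e fun i => encNat (a i)) (hb : PT e fun i => encNat (b i)) :
    PT e fun i => encProp (a i < b i) :=
  (nat_sub hb ha).nat_eq_zero.not.congr fun i => congrArg _ (by rw [eq_iff_iff]; omega)

theorem nat_two_pow (hn : PT e fun i => unary (n i)) : PT e fun i => encNat (2 ^ n i) := by
  refine (append (l := fun i => List.replicate (n i) ()) (l₂ := fun i => [])
    (eγ := fun _ _ => .leaf) hn.unary_list nil).trans ?_ |>.congr (f := fun i =>
      encNat (2 ^ n i)) fun _ => rfl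
  have := append (e := fun i => encList ((List.replicate (n i) () ++ []).map fun _ => .leaf))
    (l := fun i => List.replicate (n i) false) (l₂ := fun _ => [true]) (eγ := fun _ => encBit)
    (id.congr fun i => by simp [encBit]) (const _)
  refine this.congr fun i => ?_
  rw [encNat, bits_two_pow]

theorem nat_add (ha : PT e fun i => encNat (a i)) (hb : PT e fun i => encNat (b i)) :
    PT e fun i => encNat (a i + b i) := by
  have h := nat_two_pow (unary_add (unary_add ha.nat_bits.length hb.nat_bits.length)
    (unary_const 1))
  -- Addition comes from subtraction: `a + b = M - ((M - a) - b)` for a power of two `M > a + b`, so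
  -- that no difference is truncated.
  refine (nat_sub h (nat_sub (nat_sub h ha) hb)).congr fun i => congrArg _ ?_
  have h1 : a i < 2 ^ ((a i).bits.length + (b i).bits.length) := by
    rw [Nat.size_eq_bits_len, Nat.size_eq_bits_len]
    exact (Nat.lt_size_self _).trans_le (Nat.pow_le_pow_right (by simp) (by omega))
  have h2 : b i < 2 ^ ((a i).bits.length + (b i).bits.length) := by
    rw [Nat.size_eq_bits_len, Nat.size_eq_bits_len]
    exact (Nat.lt_size_self _).trans_le (Nat.pow_le_pow_right (by simp) (by omega))
  rw [pow_succ]; omega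

theorem nat_mul (ha : PT e fun i => encNat (a i)) (hb : PT e fun i => encNat (b i)) :
    PT e fun i => encNat (a i * b i) := by
  have := foldr (eδ := fun _ => encNat)
    (s := fun i t acc => acc + acc + if t = true then b i else 0)
    (a := fun _ => 0) ha.nat_bits (leaf.congr fun _ => encNat_zero.symm)
    ⟨_, ((ha.out_size.add hb.out_size).mul (.const 4)).add (.const 1), fun i l' h => by
      refine (size_encNat_le _).trans ?_
      -- The extra summand `b i` makes the induction work: doubling the left side leaves room for
      -- one more `b i`.
      have h1 : l'.foldr (fun t acc => acc + acc + if t = true then b i else 0) 0 + b i ≤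
          2 ^ l'.length * b i := by
        clear h
        induction l' with
        | nil => simp
        | cons t l' ih =>
          rw [List.foldr_cons, List.length_cons, pow_succ]
          split <;> linarith
      have h2 : l'.foldr (fun t acc => acc + acc + if t = true then b i else 0) 0 <
          2 ^ ((a i).bits.length + (b i).size) := by
        have h3 := Nat.lt_size_self (b i)
        have h4 : 2 ^ l'.length * b i < 2 ^ l'.length * 2 ^ (b i).size := by gcongr
        have h5 := Nat.pow_le_pow_right (n := 2) (by simp) h.length_le
        have h6 := Nat.mul_le_mul_right (2 ^ (b i).size) h5
        rw [pow_add]; omega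
      have h3 := Nat.size_le.2 h2
      have h4 := natSize_le (b i)
      have h5 := natSize_le (a i)
      rw [Nat.size_eq_bits_len] at h3
      omega⟩
    (nat_add (nat_add var₁ var₁)
      (bool_cases (f := fun (q : Σ _ : ι, ℕ × Bool) t => encNat (if t = true then b q.1 else 0)) var₂
        hb.wk (const _)))
  refine this.congr fun i => congrArg _ ?_
  rw [foldr_bits_smul, smul_eq_mul]

theorem nat_pow (ha : PT e fun i => encNat (a i)) (hn : PT e fun i => unary (n i)) :
    PT e fun i => encNat (a i ^ n i) := by
  have hf : ∀ i (l : List Unit), l.foldr (fun _ acc => acc * a i) 1 = a i ^ l.length := by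
    intro i l
    induction l with
    | nil => rfl
    | cons _ l ih => rw [List.foldr_cons, ih, List.length_cons, pow_succ]
  have := foldr (eδ := fun _ => encNat) (s := fun i _ acc => acc * a i)
    (a := fun _ => 1) hn.unary_list (const _)
    ⟨_, (((ha.out_size.mul hn.unary_bound).add (.const 1)).mul (.const 4)).add (.const 1),
      fun i l' h => by
      rw [hf]
      refine (size_encNat_le _).trans ?_
      have h1 : a i ^ l'.length < 2 ^ ((encNat (a i)).size * n i + 1) := by
        have h2 := h.length_le
        rw [List.length_replicate] at h2
        calc a i ^ l'.length ≤ (2 ^ (encNat (a i)).size) ^ l'.length := by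
              gcongr
              exact (Nat.lt_size_self (a i)).le.trans
                (Nat.pow_le_pow_right (by simp) (natSize_le _))
          _ ≤ 2 ^ ((encNat (a i)).size * n i) := by
              rw [← pow_mul]; exact Nat.pow_le_pow_right (by simp) (by gcongr)
          _ < _ := Nat.pow_lt_pow_right (by simp) (by omega)
      have h2 := Nat.size_le.2 h1
      omega⟩ (nat_mul var₁ ha.wk)
  simpa [hf] using this

/-! ### Residue classes -/

variable {p : ι → ℕ} [∀ i, Fact (p i).Prime] {x y : ∀ i, ZMod (p i)}

theorem zmod_zero : PT e fun i => encZMod (0 : ZMod (p i)) :=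
  leaf.congr fun i => by rw [encZMod, ZMod.val_zero, encNat_zero]

theorem zmod_one : PT e fun i => encZMod (1 : ZMod (p i)) :=
  (const (encNat 1)).congr fun i => by
    have : Fact (1 < p i) := ⟨(Fact.out : (p i).Prime).one_lt⟩
    rw [encZMod, ZMod.val_one]

theorem zmod_eq_zero (hx : PT e fun i => encZMod (x i)) : PT e fun i => encProp (x i = 0) :=
  hx.eq_leaf.congr fun i => by rw [encZMod, encNat_eq_leaf, ZMod.val_eq_zero]

theorem zmod_add (hp : PT e fun i => encNat (p i)) (hx : PT e fun i => encZMod (x i))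
    (hy : PT e fun i => encZMod (y i)) : PT e fun i => encZMod (x i + y i) := by
  classical
  have h : PT e fun i => encNat ((x i).val + (y i).val) := nat_add hx hy
  refine (ite (eα := fun _ => encNat) (nat_lt h hp) h (nat_sub h hp)).congr fun i => ?_
  rw [encZMod, ZMod.val_add]
  have h1 := ZMod.val_lt (x i)
  have h2 := ZMod.val_lt (y i)
  split
  · rename_i h; rw [Nat.mod_eq_of_lt h]
  · rw [Nat.mod_eq_sub_mod (by omega), Nat.mod_eq_of_lt (by omega)]

theorem zmod_neg (hp : PT e fun i => encNat (p i)) (hx : PT e fun i => encZMod (x i)) :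
    PT e fun i => encZMod (-x i) := by
  classical
  refine (ite (eα := fun _ => encNat) (nat_eq_zero hx) (const (encNat 0))
    (nat_sub hp hx)).congr fun i => ?_
  rw [encZMod, ZMod.neg_val]
  simp only [ZMod.val_eq_zero]

/-- Double and add, with reduction modulo `p` in every addition, so that the accumulator never
grows. -/
theorem zmod_mul (hp : PT e fun i => encNat (p i)) (hx : PT e fun i => encZMod (x i))
    (hy : PT e fun i => encZMod (y i)) : PT e fun i => encZMod (x i * y i) := by
  have := foldr (eδ := fun i => encZMod (p := p i))
    (s := fun i t acc => acc + acc + if t = true then y i else 0)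
    (a := fun _ => 0) (nat_bits hx) zmod_zero
    ⟨_, (hp.out_size.mul (.const 4)).add (.const 1), fun i l' _ => size_encZMod_le _⟩
    (zmod_add hp.wk (zmod_add hp.wk var₁ var₁)
      (bool_cases (f := fun (q : Σ i, ZMod (p i) × Bool) t =>
        encZMod (if t = true then y q.1 else 0)) var₂ hy.wk
        (by simpa using zmod_zero (p := fun q : Σ i, ZMod (p i) × Bool => p q.1))))
  refine this.congr fun i => congrArg _ ?_
  rw [foldr_bits_smul, nsmul_eq_mul, ZMod.natCast_zmod_val]

end PT
end TreeMachine

namespace TreeMachine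

/-! ### Coefficient vectors -/

/-- The first `m` coefficients of `f`. -/
def vec {R : Type*} [Semiring R] (m : ℕ) (f : R[X]) : List R := (List.range m).map f.coeff

section vec
variable {R : Type*} [Semiring R]

@[simp] theorem length_vec (m : ℕ) (f : R[X]) : (vec m f).length = m := by simp [vec]

@[simp] theorem getElem_vec (m : ℕ) (f : R[X]) (k : ℕ) (h : k < (vec m f).length) :
    (vec m f)[k] = f.coeff k := by simp [vec]

theorem vec_eq_iff {m : ℕ} {f g : R[X]} : vec m f = vec m g ↔ ∀ k < m, f.coeff k = g.coeff k := by
  simp [vec]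

theorem vec_succ (m : ℕ) (f : R[X]) : vec (m + 1) f = f.coeff 0 :: vec m f.divX := by
  simp [vec, List.range_succ_eq_map, coeff_divX, Function.comp_def]

theorem vec_X_mul (m : ℕ) (f : R[X]) : vec (m + 1) (X * f) = 0 :: vec m f := by
  simp [vec, List.range_succ_eq_map, Function.comp_def]

theorem take_vec (k m : ℕ) (f : R[X]) : (vec m f).take k = vec (min k m) f := by
  simp [vec, ← List.map_take, List.take_range]

theorem zipWith_vec (m : ℕ) (F : R → R → R) (f g h : R[X])
    (H : ∀ k, F (f.coeff k) (g.coeff k) = h.coeff k) :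
    List.zipWith F (vec m f) (vec m g) = vec m h := by
  simp [vec, List.zipWith_map, H]

theorem map_vec (m : ℕ) (F : R → R) (f h : R[X]) (H : ∀ k, F (f.coeff k) = h.coeff k) :
    (vec m f).map F = vec m h := by
  simp [vec, H]

/-- Horner's rule. -/
theorem foldr_vec {S : Type*} [CommSemiring S] (m : ℕ) (f : R[X]) (φ : R → S) (x b : S) :
    (vec m f).foldr (fun t acc => x * acc + φ t * b) 0 =
      (∑ k ∈ Finset.range m, φ (f.coeff k) * x ^ k) * b := by
  induction m generalizing f with
  | zero => simp [vec]
  | succ m ih =>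
    rw [vec_succ, List.foldr_cons, ih, Finset.sum_range_succ', add_mul]
    simp only [coeff_divX, pow_succ, pow_zero, mul_one, Finset.mul_sum, Finset.sum_mul]
    congr 1
    exact Finset.sum_congr rfl fun k _ => by ring

theorem encPoly_eq (enc : R → Data) (f : R[X]) :
    encPoly enc f = encList ((vec f.degree.succ f).map enc) := by
  rw [encPoly, coeffList, ← List.map_reverse, List.reverse_reverse, vec]

theorem encPoly_of_ne (enc : R → Data) {f : R[X]} (h : f ≠ 0) :
    encPoly enc f = encList ((vec (f.natDegree + 1) f).map enc) := by
  rw [encPoly_eq, withBotSucc_degree_eq_natDegree_add_one h]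

end vec

/-! ### Presented finite fields -/

universe u v w v'

/-- A finite field with a generator over its prime field. -/
structure FieldPres where
  p : ℕ
  [prime : Fact p.Prime]
  F : Type u
  [field : Field F]
  [finite : Finite F]
  [algebra : Algebra (ZMod p) F]
  pb : PowerBasis (ZMod p) F

attribute [instance] FieldPres.prime FieldPres.field FieldPres.finite FieldPres.algebra

namespace FieldPres
variable (c : FieldPres.{u})

/-- The presentation of the field. -/
noncomputable def pres : Data :=
  .node (encNat c.p) (encPoly encZMod (minpoly (ZMod c.p) c.pb.gen))

/-- The encoding of the elements. -/
noncomputable def enc (a : c.F) : Data := encField c.pb a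

/-- The polynomial of degree less than the degree of the field that represents `a`. -/
noncomputable def rep (a : c.F) : (ZMod c.p)[X] :=
  ∑ i : Fin c.pb.dim, monomial i (c.pb.basis.repr a i)

theorem coeff_rep (a : c.F) (i : Fin c.pb.dim) : (c.rep a).coeff i = c.pb.basis.repr a i := by
  simp only [rep, finsetSum_coeff, coeff_monomial]
  rw [Finset.sum_eq_single i]
  · simp
  · intro j _ h; rw [if_neg (fun h' => h (Fin.ext h'))]
  · simp

theorem degree_rep_lt (a : c.F) : (c.rep a).degree < c.pb.dim := by
  refine (degree_sum_le _ _).trans_lt ((Finset.sup_lt_iff ?_).2 fun i _ => ?_)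
  · exact WithBot.bot_lt_coe _
  · exact (degree_monomial_le _ _).trans_lt (by exact_mod_cast i.2)

theorem aeval_rep (a : c.F) : aeval c.pb.gen (c.rep a) = a := by
  rw [rep, map_sum]
  conv_rhs => rw [← c.pb.basis.sum_repr a]
  refine Finset.sum_congr rfl fun i _ => ?_
  rw [aeval_monomial, c.pb.basis_eq_pow, Algebra.smul_def]

/-- A nonzero polynomial that vanishes at the generator has degree at least `dim`, so
representatives of smaller degree are unique. Each field operation below is described on coordinates
by exhibiting a representative. -/
theorem rep_eq {a : c.F} {f : (ZMod c.p)[X]} (h : aeval c.pb.gen f = a)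
    (hf : f.degree < c.pb.dim) : c.rep a = f := by
  by_contra hne
  have h0 : c.rep a - f ≠ 0 := sub_ne_zero.2 hne
  have h1 := c.pb.dim_le_natDegree_of_root h0 (by rw [map_sub, aeval_rep, h, sub_self])
  have h2 : (c.rep a - f).degree < c.pb.dim :=
    (degree_sub_le _ _).trans_lt (max_lt (c.degree_rep_lt a) hf)
  rw [degree_eq_natDegree h0] at h2
  have : (c.rep a - f).natDegree < c.pb.dim := by exact_mod_cast h2
  omega

theorem enc_eq (a : c.F) : c.enc a = encList ((vec c.pb.dim (c.rep a)).map encZMod) := by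
  rw [enc, encField]
  congr 1
  rw [vec, List.map_map]
  apply List.ext_getElem
  · simp
  · intro k h1 h2
    simp only [List.length_ofFn] at h1
    simp only [List.getElem_ofFn, List.getElem_map, List.getElem_range, Function.comp]
    rw [c.coeff_rep a ⟨k, h1⟩]

theorem rep_add (a b : c.F) : c.rep (a + b) = c.rep a + c.rep b :=
  c.rep_eq (by simp [aeval_rep])
    ((degree_add_le _ _).trans_lt (max_lt (c.degree_rep_lt a) (c.degree_rep_lt b)))

theorem rep_neg (a : c.F) : c.rep (-a) = -c.rep a :=
  c.rep_eq (by simp [aeval_rep]) (by rw [degree_neg]; exact c.degree_rep_lt a)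

theorem rep_zero : c.rep 0 = 0 := c.rep_eq (by simp) (by simp)

theorem rep_smul (t : ZMod c.p) (a : c.F) : c.rep (algebraMap _ _ t * a) = C t * c.rep a :=
  c.rep_eq (by simp [aeval_rep]) (by rw [← smul_eq_C_mul]; exact (degree_smul_le _ _).trans_lt (c.degree_rep_lt a))

theorem rep_algebraMap (t : ZMod c.p) : c.rep (algebraMap _ _ t) = C t :=
  c.rep_eq (by simp) (degree_C_le.trans_lt (by exact_mod_cast c.pb.dim_pos))

theorem natDegree_minpoly : (minpoly (ZMod c.p) c.pb.gen).natDegree = c.pb.dim :=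
  c.pb.natDegree_minpoly

theorem minpoly_monic : (minpoly (ZMod c.p) c.pb.gen).Monic :=
  minpoly.monic c.pb.isIntegral_gen

/-- Multiplication by `X` raises the degree to at most `dim`, so subtracting one multiple of the
monic minimal polynomial completes the reduction. -/
theorem rep_gen_mul (a : c.F) : c.rep (c.pb.gen * a) = X * c.rep a -
    C ((X * c.rep a).coeff c.pb.dim) * minpoly (ZMod c.p) c.pb.gen := by
  refine c.rep_eq (by simp [aeval_rep]) ?_
  have hd : (X * c.rep a).natDegree ≤ c.pb.dim := by
    by_cases h : c.rep a = 0
    · simp [h]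
    · rw [natDegree_X_mul h]
      have := c.degree_rep_lt a
      rw [degree_eq_natDegree h] at this
      have : (c.rep a).natDegree < c.pb.dim := by exact_mod_cast this
      omega
  rw [degree_lt_iff_coeff_zero]
  intro m hm
  rw [coeff_sub, coeff_C_mul]
  rcases eq_or_lt_of_le hm with rfl | hm
  · have : (minpoly (ZMod c.p) c.pb.gen).coeff c.pb.dim = 1 := by
      rw [← c.natDegree_minpoly]; exact c.minpoly_monic
    rw [this]; simp
  · rw [coeff_eq_zero_of_natDegree_lt (hd.trans_lt hm),
      coeff_eq_zero_of_natDegree_lt (c.natDegree_minpoly.trans_lt hm)]; simp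

theorem pres_eq : c.pres = .node (encNat c.p) (encList
    ((vec (c.pb.dim + 1) (minpoly (ZMod c.p) c.pb.gen)).map encZMod)) := by
  rw [pres, encPoly_of_ne _ c.minpoly_monic.ne_zero, natDegree_minpoly]

theorem size_enc_le (a : c.F) :
    (c.enc a).size ≤ c.pb.dim * ((encNat c.p).size * 4 + 1 + 1) + 1 := by
  rw [enc_eq]
  refine (size_encList_le _ ((encNat c.p).size * 4 + 1) ?_).trans (by simp)
  simp only [List.mem_map]; rintro _ ⟨t, _, rfl⟩; exact size_encZMod_le t

theorem eq_zero_iff (a : c.F) : (∀ t ∈ vec c.pb.dim (c.rep a), t = 0) ↔ a = 0 := by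
  constructor
  · intro h
    rw [← c.aeval_rep a]
    have : c.rep a = 0 := by
      ext k
      by_cases hk : k < c.pb.dim
      · exact h _ (by simp only [vec, List.mem_map, List.mem_range]; exact ⟨k, hk, rfl⟩)
      · exact coeff_eq_zero_of_degree_lt ((c.degree_rep_lt a).trans_le (by exact_mod_cast not_lt.1 hk))
    rw [this, map_zero]
  · rintro rfl t ht
    rw [rep_zero] at ht
    simp only [vec, coeff_zero, List.mem_map] at ht
    obtain ⟨_, _, rfl⟩ := ht; rfl

/-- Horner's rule in the generator: a product in the field needs only multiplications by the
generator, multiplications by scalars, and additions. -/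
theorem mul_eq_foldr (a b : c.F) : a * b = (vec c.pb.dim (c.rep a)).foldr
    (fun t acc => c.pb.gen * acc + algebraMap _ _ t * b) 0 := by
  rw [foldr_vec]
  conv_lhs => rw [← c.aeval_rep a]
  rw [aeval_eq_sum_range' (n := c.pb.dim)]
  · simp [Algebra.smul_def]
  · by_cases h : c.rep a = 0
    · simpa [h] using c.pb.dim_pos
    · have := c.degree_rep_lt a
      rw [degree_eq_natDegree h] at this
      exact_mod_cast this

theorem natCard : Nat.card c.F = c.p ^ c.pb.dim := by
  have := c.pb.finite
  have := Module.natCard_eq_pow_finrank (K := ZMod c.p) (V := c.F)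
  rw [this, Nat.card_zmod, c.pb.finrank]

end FieldPres

namespace PT
variable {ι : Type v} {e : ι → Data} {c : ι → FieldPres.{u}}

theorem pres_p (hc : PT e fun i => (c i).pres) : PT e fun i => encNat (c i).p := hc.left

theorem pres_minpoly (hc : PT e fun i => (c i).pres) : PT e fun i => encList
    ((vec ((c i).pb.dim + 1) (minpoly (ZMod (c i).p) (c i).pb.gen)).map encZMod) :=
  hc.right.congr fun i => by rw [FieldPres.pres_eq]; rfl

theorem pres_dim (hc : PT e fun i => (c i).pres) : PT e fun i => unary (c i).pb.dim :=
  (length (tail (pres_minpoly hc))).congr fun i => by simp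

/-- The elements of the fields are of bounded size. -/
theorem size_enc_bound (hc : PT e fun i => (c i).pres) :
    ∃ b : ι → ℕ, PB e b ∧ ∀ i a, ((c i).enc a).size ≤ b i :=
  ⟨_, ((pres_dim hc).unary_bound.mul ((((pres_p hc).out_size.mul (.const 4)).add (.const 1)).add
    (.const 1))).add (.const 1), fun i a => (c i).size_enc_le a⟩

variable {a b : ∀ i, (c i).F}

theorem coords (ha : PT e fun i => (c i).enc (a i)) :
    PT e fun i => encList ((vec (c i).pb.dim ((c i).rep (a i))).map encZMod) :=
  ha.congr fun i => (c i).enc_eq _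

theorem of_coords {l : ∀ i, List (ZMod (c i).p)} (hl : PT e fun i => encList ((l i).map encZMod))
    (h : ∀ i, l i = vec (c i).pb.dim ((c i).rep (a i))) : PT e fun i => (c i).enc (a i) :=
  hl.congr fun i => by rw [(c i).enc_eq, h]

theorem field_eq_zero (ha : PT e fun i => (c i).enc (a i)) : PT e fun i => encProp (a i = 0) :=
  (all (p := fun _ t => t = 0) (coords ha) (of_node_right id).zmod_eq_zero).congr fun i => by
    rw [(c i).eq_zero_iff]

theorem field_add (hc : PT e fun i => (c i).pres) (ha : PT e fun i => (c i).enc (a i))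
    (hb : PT e fun i => (c i).enc (b i)) : PT e fun i => (c i).enc (a i + b i) :=
  of_coords (zipWith (f := fun _ x y => x + y) (coords ha) (coords hb)
    (zmod_add hc.pres_p.wk var₁ var₂)) fun i =>
    zipWith_vec _ _ _ _ _ fun k => by rw [FieldPres.rep_add, coeff_add]

theorem field_neg (hc : PT e fun i => (c i).pres) (ha : PT e fun i => (c i).enc (a i)) :
    PT e fun i => (c i).enc (-a i) :=
  of_coords (map (f := fun _ x => -x) (coords ha) (zmod_neg hc.pres_p.wk (of_node_right id)))
    fun i => map_vec _ _ _ _ fun k => by rw [FieldPres.rep_neg, coeff_neg]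

theorem field_sub (hc : PT e fun i => (c i).pres) (ha : PT e fun i => (c i).enc (a i))
    (hb : PT e fun i => (c i).enc (b i)) : PT e fun i => (c i).enc (a i - b i) :=
  (field_add hc ha (field_neg hc hb)).congr fun i => by rw [sub_eq_add_neg]

theorem field_smul {t : ∀ i, ZMod (c i).p} (hc : PT e fun i => (c i).pres)
    (ht : PT e fun i => encZMod (t i)) (ha : PT e fun i => (c i).enc (a i)) :
    PT e fun i => (c i).enc (algebraMap _ _ (t i) * a i) :=
  of_coords (map (f := fun i x => t i * x) (coords ha)
      (zmod_mul hc.pres_p.wk ht.wk (of_node_right id)))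
    fun i => map_vec _ _ _ _ fun k => by rw [FieldPres.rep_smul, coeff_C_mul]

theorem field_algebraMap {t : ∀ i, ZMod (c i).p} (hc : PT e fun i => (c i).pres)
    (ht : PT e fun i => encZMod (t i)) : PT e fun i => (c i).enc (algebraMap _ _ (t i)) := by
  -- The minimal polynomial, with all coefficients replaced by zero, supplies a list of zeros that
  -- is long enough.
  have hl := map (eδ := fun i => encZMod (p := (c i).p)) (f := fun _ _ => 0) (pres_minpoly hc)
    zmod_zero
  refine of_coords (take (pres_dim hc) (cons ht hl)) fun i => ?_
  rw [map_vec (h := 0) _ _ _ (by simp), (c i).rep_algebraMap]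
  have : t i :: vec ((c i).pb.dim + 1) 0 = vec ((c i).pb.dim + 1 + 1) (C (t i)) := by
    rw [vec_succ ((c i).pb.dim + 1)]; simp
  rw [this, take_vec]
  congr 1; omega

theorem field_zero (hc : PT e fun i => (c i).pres) : PT e fun i => (c i).enc 0 :=
  (field_algebraMap hc zmod_zero).congr fun i => by rw [map_zero]

theorem field_one (hc : PT e fun i => (c i).pres) : PT e fun i => (c i).enc 1 :=
  (field_algebraMap hc zmod_one).congr fun i => by rw [map_one]

theorem field_gen_mul (hc : PT e fun i => (c i).pres) (ha : PT e fun i => (c i).enc (a i)) :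
    PT e fun i => (c i).enc ((c i).pb.gen * a i) := by
  have hX : PT e fun i => encList ((vec ((c i).pb.dim + 1) (X * (c i).rep (a i))).map encZMod) :=
    (cons zmod_zero (coords ha)).congr fun i => by rw [vec_X_mul]
  have ht : PT e fun i => encZMod ((X * (c i).rep (a i)).coeff (c i).pb.dim) :=
    (drop (pres_dim hc) hX).left.congr fun i => by
      rw [List.drop_eq_getElem_cons (by simp)]; simp [Data.left]
  have hz := zipWith (eε := fun i => encZMod (p := (c i).p))
    (f := fun i x y => x + -((X * (c i).rep (a i)).coeff (c i).pb.dim * y)) hX (pres_minpoly hc)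
    (zmod_add hc.pres_p.wk var₁ (zmod_neg hc.pres_p.wk (zmod_mul hc.pres_p.wk ht.wk var₂)))
  refine of_coords (take (pres_dim hc) hz) fun i => ?_
  rw [zipWith_vec (h := (c i).rep ((c i).pb.gen * a i)), take_vec]
  · congr 1; omega
  · intro k; rw [FieldPres.rep_gen_mul]; simp [sub_eq_add_neg]

theorem field_mul (hc : PT e fun i => (c i).pres) (ha : PT e fun i => (c i).enc (a i))
    (hb : PT e fun i => (c i).enc (b i)) : PT e fun i => (c i).enc (a i * b i) := by
  obtain ⟨B, hB, hs⟩ := size_enc_bound hc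
  exact (foldr (eδ := fun i => (c i).enc)
    (s := fun i t acc => (c i).pb.gen * acc + algebraMap _ _ t * b i) (coords ha) (field_zero hc)
    ⟨B, hB, fun i l' _ => hs i _⟩
    (field_add hc.wk (field_gen_mul hc.wk var₁) (field_smul hc.wk var₂ hb.wk))).congr fun i => by
      rw [FieldPres.mul_eq_foldr]

theorem field_pow {n : ι → ℕ} (hc : PT e fun i => (c i).pres) (ha : PT e fun i => (c i).enc (a i))
    (hn : PT e fun i => encNat (n i)) : PT e fun i => (c i).enc (a i ^ n i) := by
  obtain ⟨B, hB, hs⟩ := size_enc_bound hc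
  refine (foldr (eδ := fun i => (c i).enc)
    (s := fun i t acc => acc * acc * if t = true then a i else 1) (nat_bits hn) (field_one hc)
    ⟨B, hB, fun i l' _ => hs i _⟩
    (field_mul hc.wk (field_mul hc.wk var₁ var₁)
      (bool_cases (f := fun (q : Σ i, (c i).F × Bool) t =>
        (c q.1).enc (if t = true then a q.1 else 1)) var₂ ha.wk
        (by simpa using field_one hc.wk)))).congr fun i => by
      rw [foldr_bits_pow]

/-- For `a ≠ 0` the inverse is the power with exponent `|F| - 2`, computed by repeated squaring.
Zero is treated apart because the exponent is `0` when `|F| = 2`. -/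
theorem field_inv (hc : PT e fun i => (c i).pres) (ha : PT e fun i => (c i).enc (a i)) :
    PT e fun i => (c i).enc (a i)⁻¹ := by
  classical
  have hn : PT e fun i => encNat (Nat.card (c i).F - 2) :=
    (nat_sub (nat_pow hc.pres_p hc.pres_dim) (const (encNat 2))).congr fun i => by
      rw [(c i).natCard]
  refine (ite (eα := fun i => (c i).enc) (field_eq_zero ha) (field_zero hc)
    (field_pow hc ha hn)).congr fun i => congrArg _ ?_
  split
  · rename_i h; rw [h, inv_zero]
  · rename_i h
    have := Fintype.ofFinite (c i).F
    refine eq_inv_of_mul_eq_one_left ?_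
    have h2 : 1 < Nat.card (c i).F := Finite.one_lt_card
    rw [← pow_succ, show Nat.card (c i).F - 2 + 1 = Fintype.card (c i).F - 1 by
      rw [← Nat.card_eq_fintype_card]; omega]
    exact FiniteField.pow_card_sub_one_eq_one _ h

end PT
end TreeMachine

namespace TreeMachine

/-! ### Truncated polynomials -/

universe u v w v'

theorem coeff_iterate_divX {R : Type*} [Semiring R] (f : R[X]) (L k : ℕ) :
    (divX^[L] f).coeff k = f.coeff (k + L) := by
  induction L generalizing k with
  | zero => rfl
  | succ L ih => rw [Function.iterate_succ_apply', coeff_divX, ih]; congr 1; omega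

theorem X_pow_mul_iterate_divX {R : Type*} [CommSemiring R] {f : R[X]} {L : ℕ} (h : X ^ L ∣ f) :
    X ^ L * divX^[L] f = f := by
  ext k
  rw [coeff_X_pow_mul']
  split
  · rename_i hk; rw [coeff_iterate_divX, Nat.sub_add_cancel hk]
  · rename_i hk; exact ((X_pow_dvd_iff.1 h) k (not_le.1 hk)).symm

open Classical in
/-- Divide by `X ^ L` if possible, `n` times. -/
noncomputable def strip {R : Type*} [Semiring R] (L n : ℕ) (f : R[X]) : R[X] :=
  (fun f => if X ^ L ∣ f then divX^[L] f else f)^[n] f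

theorem forall_vec_eq_zero {R : Type*} [CommSemiring R] {f : R[X]} {L : ℕ} :
    (∀ t ∈ vec L f, t = 0) ↔ X ^ L ∣ f := by
  rw [X_pow_dvd_iff]; simp [vec]

theorem degree_iterate_divX_le {R : Type*} [Semiring R] (f : R[X]) (L : ℕ) :
    (divX^[L] f).degree ≤ f.degree := by
  rw [degree_le_iff_coeff_zero]
  intro m hm
  rw [coeff_iterate_divX]
  exact coeff_eq_zero_of_degree_lt (hm.trans_le (by exact_mod_cast Nat.le_add_right m L))

/-- Substitution of `x` and `y` into a bivariate polynomial. -/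
noncomputable def subst {K : Type*} [CommSemiring K] (x y : K[X]) : K[X][Y] →+* K[X] :=
  eval₂RingHom (eval₂RingHom C x) y

/-- The length `M` may depend on the coefficient. This covers both the input, whose rows end at
their leading coefficients, and computed polynomials, whose rows all have length `n`. -/
theorem subst_eq_sum {K : Type*} [CommSemiring K] (x y : K[X]) {P : K[X][Y]} {N : ℕ}
    (h : P.degree < N) (M : K[X] → ℕ) (hM : ∀ q : K[X], q ∈ Set.range P.coeff → q.degree < M q) :
    subst x y P = ∑ j ∈ Finset.range N,
      (∑ i ∈ Finset.range (M (P.coeff j)), C ((P.coeff j).coeff i) * x ^ i) * y ^ j := by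
  have key : ∀ {R S : Type _} [CommSemiring R] [CommSemiring S] (φ : R →+* S) (y : S) (P : R[X])
      (N : ℕ), P.degree < N → P.eval₂ φ y = ∑ j ∈ Finset.range N, φ (P.coeff j) * y ^ j := by
    intro R S _ _ φ y P N h
    by_cases h0 : P = 0
    · simp [h0]
    · rw [degree_eq_natDegree h0] at h
      exact eval₂_eq_sum_range' _ (by exact_mod_cast h) _
  rw [subst, coe_eval₂RingHom, key _ _ _ _ h]
  refine Finset.sum_congr rfl fun j _ => ?_
  rw [coe_eval₂RingHom, key _ _ _ _ (hM _ ⟨j, rfl⟩)]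

/-- Remove the trailing zeros of a list. -/
noncomputable def trim {R : Type*} [Zero R] (l : List R) : List R :=
  open Classical in l.foldr (fun t acc => if t = 0 ∧ acc = [] then [] else t :: acc) []

/-- Passes from vectors of fixed length, on which the computations work, to the encoding of
polynomials, which ends with the leading coefficient. -/
theorem trim_vec {R : Type*} [Semiring R] (n : ℕ) (f : R[X]) (h : f.degree < n) :
    trim (vec n f) = vec f.degree.succ f := by
  classical
  induction n generalizing f with
  | zero =>
    have : f = 0 := by
      ext k; exact coeff_eq_zero_of_degree_lt (h.trans_le (by exact_mod_cast Nat.zero_le k))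
    simp [this, trim, vec]
  | succ n ih =>
    have hd : f.divX.degree < n := by
      rw [degree_lt_iff_coeff_zero] at h ⊢
      intro m hm
      rw [coeff_divX]; exact h _ (by omega)
    have h2 := ih f.divX hd
    rw [vec_succ]
    simp only [trim, List.foldr_cons] at h2 ⊢
    rw [h2]
    by_cases h0 : f.divX = 0
    · have hf : f = C (f.coeff 0) := by
        conv_lhs => rw [← divX_mul_X_add f, h0]
        simp
      by_cases h1 : f.coeff 0 = 0
      · have : f = 0 := by rw [hf, h1, C_0]
        simp [this, vec]
      · have h3 : f ≠ 0 := fun h3 => h1 (by simp [h3])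
        have h4 : f.natDegree = 0 := by rw [hf]; simp
        rw [withBotSucc_degree_eq_natDegree_add_one h3, h4, vec_succ, h0]
        simp [h1, vec]
    · have h3 : f ≠ 0 := by rintro rfl; simp at h0
      have h4 : f.natDegree = f.divX.natDegree + 1 := by
        have := natDegree_divX_eq_natDegree_tsub_one (p := f)
        have h5 : f.natDegree ≠ 0 := fun h5 => h0 (by
          rw [eq_C_of_natDegree_eq_zero h5]; simp)
        omega
      rw [withBotSucc_degree_eq_natDegree_add_one h3, h4, vec_succ,
        withBotSucc_degree_eq_natDegree_add_one h0]
      simp [vec]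

/-- The last nonzero element of a list. -/
noncomputable def lastNonzero {R : Type*} [Zero R] (l : List R) : R :=
  open Classical in l.foldr (fun t acc => if acc = 0 then t else acc) 0

theorem lastNonzero_vec {R : Type*} [Semiring R] (n : ℕ) (f : R[X]) (h : f.degree < n) :
    lastNonzero (vec n f) = f.leadingCoeff := by
  classical
  induction n generalizing f with
  | zero =>
    have : f = 0 := by
      ext k; exact coeff_eq_zero_of_degree_lt (h.trans_le (by exact_mod_cast Nat.zero_le k))
    simp [this, lastNonzero, vec]
  | succ n ih =>
    have hd : f.divX.degree < n := by
      rw [degree_lt_iff_coeff_zero] at h ⊢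
      intro m hm
      rw [coeff_divX]; exact h _ (by omega)
    have h2 := ih f.divX hd
    rw [vec_succ]
    simp only [lastNonzero, List.foldr_cons] at h2 ⊢
    rw [h2]
    by_cases h0 : f.divX = 0
    · have hf : f = C (f.coeff 0) := by
        conv_lhs => rw [← divX_mul_X_add f, h0]
        simp
      rw [h0, leadingCoeff_zero, if_pos rfl]
      conv_rhs => rw [hf]
      simp
    · rw [if_neg (by simpa using h0)]
      have h4 : f.natDegree = f.divX.natDegree + 1 := by
        have := natDegree_divX_eq_natDegree_tsub_one (p := f)
        have h5 : f.natDegree ≠ 0 := fun h5 => h0 (by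
          rw [eq_C_of_natDegree_eq_zero h5]; simp)
        omega
      rw [leadingCoeff, leadingCoeff, h4, coeff_divX]

namespace FieldPres

/-- Encoding of the first `m` coefficients of a polynomial. -/
noncomputable def encV (c : FieldPres.{u}) (m : ℕ) (f : c.F[X]) : Data :=
  encList ((vec m f).map c.enc)

/-- `encV m` sees a polynomial only modulo `X ^ m`, so the operations below are those of the
truncated polynomial ring. -/
theorem encV_congr (c : FieldPres.{u}) {m : ℕ} {f g : c.F[X]}
    (h : ∀ k < m, f.coeff k = g.coeff k) : c.encV m f = c.encV m g := by
  rw [encV, vec_eq_iff.2 h, encV]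

end FieldPres

namespace PT
variable {ι : Type v} {e : ι → Data} {c : ι → FieldPres.{u}} {m n : ι → ℕ}
  {f g h : ∀ i, (c i).F[X]} {a : ∀ i, (c i).F}

theorem size_list_bound (hc : PT e fun i => (c i).pres) {M : ι → ℕ} (hM : PB e M) :
    ∃ b, PB e b ∧ ∀ i (l : List (c i).F), l.length ≤ M i →
      (encList (l.map (c i).enc)).size ≤ b i := by
  obtain ⟨b, hb, hs⟩ := size_enc_bound hc
  refine ⟨_, (hM.mul (hb.add (.const 1))).add (.const 1), fun i l hl => ?_⟩
  refine (size_encList_le _ (b i) ?_).trans ?_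
  · simp only [List.mem_map]; rintro _ ⟨t, _, rfl⟩; exact hs _ _
  · rw [List.length_map]; gcongr

theorem size_encV_bound (hc : PT e fun i => (c i).pres) (hm : PB e m) :
    ∃ b, PB e b ∧ ∀ i f, ((c i).encV (m i) f).size ≤ b i :=
  let ⟨b, hb, hs⟩ := size_list_bound hc hm
  ⟨b, hb, fun i f => hs i _ (by simp)⟩

theorem V_list (hf : PT e fun i => (c i).encV (m i) (f i)) :
    PT e fun i => encList ((vec (m i) (f i)).map (c i).enc) := hf

theorem of_V_list {l : ∀ i, List (c i).F} (hl : PT e fun i => encList ((l i).map (c i).enc))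
    (h : ∀ i, l i = vec (m i) (f i)) : PT e fun i => (c i).encV (m i) (f i) :=
  hl.congr fun i => by rw [FieldPres.encV, h]

theorem V_zero (hc : PT e fun i => (c i).pres) (hm : PT e fun i => unary (m i)) :
    PT e fun i => (c i).encV (m i) 0 :=
  of_V_list (map (eδ := fun i => (c i).enc) (f := fun _ _ => 0) (range hm) (field_zero hc.wk))
    fun _ => List.map_congr_left fun _ _ => (coeff_zero _).symm

theorem V_C (hc : PT e fun i => (c i).pres) (hm : PT e fun i => unary (m i))
    (ha : PT e fun i => (c i).enc (a i)) : PT e fun i => (c i).encV (m i) (C (a i)) :=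
  of_V_list (take hm (cons ha (V_list (V_zero hc hm)))) fun i => by
    have : a i :: vec (m i) 0 = vec (m i + 1) (C (a i)) := by rw [vec_succ]; simp
    rw [this, take_vec]; congr 1; omega

theorem V_one (hc : PT e fun i => (c i).pres) (hm : PT e fun i => unary (m i)) :
    PT e fun i => (c i).encV (m i) 1 :=
  (V_C hc hm (field_one hc)).congr fun i => by rw [C_1]

theorem V_X_mul (hc : PT e fun i => (c i).pres) (hm : PT e fun i => unary (m i))
    (hf : PT e fun i => (c i).encV (m i) (f i)) : PT e fun i => (c i).encV (m i) (X * f i) :=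
  of_V_list (take hm (cons (field_zero hc) (V_list hf))) fun i => by
    rw [← vec_X_mul, take_vec]; congr 1; omega

theorem V_X (hc : PT e fun i => (c i).pres) (hm : PT e fun i => unary (m i)) :
    PT e fun i => (c i).encV (m i) X :=
  (V_X_mul hc hm (V_one hc hm)).congr fun i => by rw [mul_one]

theorem V_add (hc : PT e fun i => (c i).pres) (hf : PT e fun i => (c i).encV (m i) (f i))
    (hg : PT e fun i => (c i).encV (m i) (g i)) : PT e fun i => (c i).encV (m i) (f i + g i) := by
  have := zipWith (eε := fun i => (c i).enc) (f := fun _ x y => x + y) (V_list hf) (V_list hg)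
    (field_add hc.wk var₁ var₂)
  exact of_V_list this fun i => zipWith_vec _ _ _ _ _ fun k => by simp

theorem V_C_mul (hc : PT e fun i => (c i).pres) (ha : PT e fun i => (c i).enc (a i))
    (hf : PT e fun i => (c i).encV (m i) (f i)) : PT e fun i => (c i).encV (m i) (C (a i) * f i) := by
  have := map (eδ := fun i => (c i).enc) (f := fun i x => a i * x) (V_list hf)
    (field_mul hc.wk ha.wk (of_node_right id))
  exact of_V_list this fun i => map_vec _ _ _ _ fun k => by simp

theorem V_mul (hc : PT e fun i => (c i).pres) (hm : PT e fun i => unary (m i))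
    (hf : PT e fun i => (c i).encV (m i) (f i)) (hg : PT e fun i => (c i).encV (m i) (g i)) :
    PT e fun i => (c i).encV (m i) (f i * g i) := by
  obtain ⟨b, hb, hs⟩ := size_encV_bound hc hm.unary_bound
  have := foldr (eδ := fun i => (c i).encV (m i)) (s := fun i t acc => X * acc + C t * g i)
    (V_list hf) (V_zero hc hm) ⟨b, hb, fun i l' _ => hs i _⟩
    (V_add hc.wk (V_X_mul hc.wk hm.wk var₁) (V_C_mul hc.wk var₂ hg.wk))
  refine this.congr fun i => ?_
  rw [foldr_vec]
  -- Horner's rule was applied to the truncation of `f i`. A coefficient of the product below `m i`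
  -- involves only coefficients of `f i` below `m i`.
  refine FieldPres.encV_congr _ fun k hk => ?_
  rw [coeff_mul, coeff_mul]
  refine Finset.sum_congr rfl fun x hx => ?_
  have := Finset.HasAntidiagonal.mem_antidiagonal.1 hx
  congr 1
  simp only [finsetSum_coeff, coeff_C_mul, coeff_X_pow]
  rw [Finset.sum_eq_single x.1]
  · simp
  · intro j _ h; simp [Ne.symm h]
  · intro h; simp only [Finset.mem_range] at h; omega

theorem V_pow (hc : PT e fun i => (c i).pres) (hm : PT e fun i => unary (m i))
    (hf : PT e fun i => (c i).encV (m i) (f i)) (hn : PT e fun i => unary (n i)) :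
    PT e fun i => (c i).encV (m i) (f i ^ n i) := by
  obtain ⟨b, hb, hs⟩ := size_encV_bound hc hm.unary_bound
  have hp : ∀ i (l : List Unit), l.foldr (fun _ acc => acc * f i) 1 = f i ^ l.length := by
    intro i l
    induction l with
    | nil => rfl
    | cons _ l ih => rw [List.foldr_cons, ih, List.length_cons, pow_succ]
  have := foldr (eδ := fun i => (c i).encV (m i)) (s := fun i _ acc => acc * f i)
    hn.unary_list (V_one hc hm) ⟨b, hb, fun i l' _ => hs i _⟩ (V_mul hc.wk hm.wk var₁ hf.wk)
  simpa [hp] using this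

theorem V_of_trunc (hc : PT e fun i => (c i).pres) (hm : PT e fun i => unary (m i))
    (hn : PT e fun i => unary (n i)) (hf : PT e fun i => (c i).encV (m i) (f i))
    (h : ∀ i k, (g i).coeff k = if k < n i then (f i).coeff k else 0) :
    PT e fun i => (c i).encV (m i) (g i) := by
  refine of_V_list (take hm (append (take hn (V_list hf)) (V_list (V_zero hc hm)))) fun i => ?_
  apply List.ext_getElem
  · simp
  · intro k h1 h2
    simp only [length_vec] at h2
    rw [List.getElem_take, getElem_vec, h]
    by_cases hk : k < n i
    · rw [List.getElem_append_left (by simp; omega), List.getElem_take, getElem_vec, if_pos hk]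
    · rw [List.getElem_append_right (by simp; omega), getElem_vec, if_neg hk, coeff_zero]

/-- The degree bound is essential: division by a power of `X` moves coefficients down, and those
beyond the truncation must be known to be zero. -/
theorem V_iterate_divX (hc : PT e fun i => (c i).pres) (hm : PT e fun i => unary (m i))
    (hn : PT e fun i => unary (n i)) (hf : PT e fun i => (c i).encV (m i) (f i))
    (h : ∀ i, (f i).degree < m i) : PT e fun i => (c i).encV (m i) (divX^[n i] (f i)) := by
  refine of_V_list (take hm (append (drop hn (V_list hf)) (V_list (V_zero hc hm)))) fun i => ?_
  apply List.ext_getElem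
  · simp
  · intro k h1 h2
    simp only [length_vec] at h2
    rw [List.getElem_take, getElem_vec, coeff_iterate_divX]
    by_cases hk : k + n i < m i
    · rw [List.getElem_append_left (by simp; omega), List.getElem_drop, getElem_vec, add_comm]
    · rw [List.getElem_append_right (by simp; omega), getElem_vec, coeff_zero,
        coeff_eq_zero_of_degree_lt]
      exact (h i).trans_le (by exact_mod_cast not_lt.1 hk)

theorem V_strip {L : ι → ℕ} (hc : PT e fun i => (c i).pres) (hm : PT e fun i => unary (m i))
    (hL : PT e fun i => unary (L i)) (hn : PT e fun i => unary (n i)) (hLm : ∀ i, L i ≤ m i)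
    (hf : PT e fun i => (c i).encV (m i) (f i)) (h : ∀ i, (f i).degree < m i) :
    PT e fun i => (c i).encV (m i) (strip (L i) (n i) (f i)) := by
  classical
  obtain ⟨b, hb, hs⟩ := size_encV_bound hc hm.unary_bound
  -- The accumulator carries its degree bound, which the next division by `X ^ L` requires.
  let st : ∀ i, Unit → {f : (c i).F[X] // f.degree < m i} → {f : (c i).F[X] // f.degree < m i} :=
    fun i _ f => if X ^ L i ∣ f.1 then
      ⟨divX^[L i] f.1, (degree_iterate_divX_le _ _).trans_lt f.2⟩ else f
  have hp : ∀ i (l : List Unit), (l.foldr (st i) ⟨f i, h i⟩).1 = strip (L i) l.length (f i) := by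
    intro i l
    induction l with
    | nil => simp [strip]
    | cons _ l ih =>
      rw [List.foldr_cons, List.length_cons, strip, Function.iterate_succ_apply']
      simp only [strip] at ih
      simp only [st]
      rw [← ih]
      split <;> rfl
  have h1 : PT (fun q : Σ i, {f : (c i).F[X] // f.degree < m i} × Unit =>
      .node (e q.1) (.node ((c q.1).encV (m q.1) q.2.1.1) .leaf))
      fun q => (c q.1).encV (m q.1) q.2.1.1 := var₁
  have h2 : PT (fun q : Σ i, {f : (c i).F[X] // f.degree < m i} × Unit =>
      .node (e q.1) (.node ((c q.1).encV (m q.1) q.2.1.1) .leaf))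
      fun q => encProp (X ^ L q.1 ∣ q.2.1.1) :=
    (all (p := fun _ t => t = 0) (take hL.wk (V_list h1))
      (of_node_right id).field_eq_zero).congr fun q => by
        rw [take_vec, min_eq_left (hLm _), forall_vec_eq_zero]
  have := foldr (eδ := fun i (f : {f : (c i).F[X] // f.degree < m i}) => (c i).encV (m i) f.1)
    (s := st) (a := fun i => ⟨f i, h i⟩) hn.unary_list hf ⟨b, hb, fun i l' _ => hs i _⟩
    (ite (eα := fun q (f : {f : (c q.1).F[X] // f.degree < m q.1}) => (c q.1).encV (m q.1) f.1) h2
      (a := fun q => ⟨divX^[L q.1] q.2.1.1, (degree_iterate_divX_le _ _).trans_lt q.2.1.2⟩)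
      (V_iterate_divX hc.wk hm.wk hL.wk h1 fun q => q.2.1.2) h1)
  simpa [hp] using this

theorem V_eval {x : ∀ i, (c i).F[X]} {M : ι → ℕ} (hc : PT e fun i => (c i).pres)
    (hm : PT e fun i => unary (m i)) (hx : PT e fun i => (c i).encV (m i) (x i))
    (hf : PT e fun i => encList ((vec (M i) (f i)).map (c i).enc)) :
    PT e fun i => (c i).encV (m i)
      (∑ k ∈ Finset.range (M i), C ((f i).coeff k) * x i ^ k) := by
  obtain ⟨b, hb, hs⟩ := size_encV_bound hc hm.unary_bound
  have := foldr (eδ := fun i => (c i).encV (m i)) (s := fun i t acc => x i * acc + C t * 1)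
    hf (V_zero hc hm) ⟨b, hb, fun i l' _ => hs i _⟩
    (V_add hc.wk (V_mul hc.wk hm.wk hx.wk var₁) (V_C_mul hc.wk var₂ (V_one hc.wk hm.wk)))
  exact this.congr fun i => by rw [foldr_vec, mul_one]

theorem V_subst {x y : ∀ i, (c i).F[X]} {P : ∀ i, (c i).F[X][Y]} {N : ι → ℕ}
    {M : ∀ i, (c i).F[X] → ℕ} (hc : PT e fun i => (c i).pres) (hm : PT e fun i => unary (m i))
    (hx : PT e fun i => (c i).encV (m i) (x i)) (hy : PT e fun i => (c i).encV (m i) (y i))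
    (hP : PT e fun i => encList ((vec (N i) (P i)).map fun q =>
      encList ((vec (M i q) q).map (c i).enc)))
    (hN : ∀ i, (P i).degree < N i)
    (hM : ∀ i (q : (c i).F[X]), q ∈ Set.range (P i).coeff → q.degree < M i q) :
    PT e fun i => (c i).encV (m i) (subst (x i) (y i) (P i)) := by
  obtain ⟨b, hb, hs⟩ := size_encV_bound hc hm.unary_bound
  have hφ := V_eval (e := fun z : Σ i, (c i).F[X] × (c i).F[X] => .node (e z.1) (.node
      ((c z.1).encV (m z.1) z.2.1) (encList ((vec (M z.1 z.2.2) z.2.2).map (c z.1).enc))))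
    (f := fun z => z.2.2) (M := fun z => M z.1 z.2.2) hc.wk hm.wk hx.wk var₂
  have := foldr (eδ := fun i => (c i).encV (m i)) (s := fun i t acc => y i * acc +
      (∑ k ∈ Finset.range (M i t), C (t.coeff k) * x i ^ k) * 1)
    (a := fun _ => 0) hP (V_zero hc hm) ⟨b, hb, fun i l' _ => hs i _⟩
    (V_add hc.wk (V_mul hc.wk hm.wk hy.wk var₁) (hφ.congr fun z => by rw [mul_one]))
  refine this.congr fun i => ?_
  rw [foldr_vec (φ := fun t => ∑ k ∈ Finset.range (M i t), C (t.coeff k) * x i ^ k),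
    subst_eq_sum (x i) (y i) (hN i) (M i) (hM i), mul_one]

theorem trim {γ : ι → Type w} [∀ i, Zero (γ i)] {eγ : ∀ i, γ i → Data} {l : ∀ i, List (γ i)}
    (hl : PT e fun i => encList ((l i).map (eγ i)))
    (h0 : PT (fun q : Σ i, γ i => .node (e q.1) (eγ q.1 q.2)) fun q => encProp (q.2 = 0)) :
    PT e fun i => encList ((trim (l i)).map (eγ i)) := by
  classical
  have hz : PT (fun q : Σ i, List (γ i) × γ i => .node (e q.1) (.node
      (encList (q.2.1.map (eγ q.1))) (eγ q.1 q.2.2))) fun q => encProp (q.2.2 = 0) :=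
    ((of_node_left id).node var₂).trans (h0.reindex fun q : Σ i, List (γ i) × γ i =>
      (⟨q.1, q.2.2⟩ : Σ i, γ i))
  refine foldr (eδ := fun i (l : List (γ i)) => encList (l.map (eγ i))) hl nil
    ⟨_, hl.out_size, fun i l' h => ?_⟩
    (ite (eα := fun q (l : List (γ q.1)) => encList (l.map (eγ q.1))) (hz.and var₁.eq_nil) nil
      (cons (eγ := fun q : Σ i, List (γ i) × γ i => eγ q.1) var₂ var₁))
  have h1 : ∀ l : List (γ i), (encList ((l.foldr (fun t acc => if t = 0 ∧ acc = [] then []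
      else t :: acc) []).map (eγ i))).size ≤ (encList (l.map (eγ i))).size := by
    intro l
    induction l with
    | nil => simp
    | cons a l ih =>
      rw [List.foldr_cons]
      split
      · simp only [List.map_nil, encList_nil, Data.size]; exact Data.size_pos _
      · simp only [List.map_cons, encList_cons, Data.size]; omega
  refine (h1 l').trans ?_
  obtain ⟨k, hk⟩ := h
  have h2 := size_encList_append (k.map (eγ i)) (l'.map (eγ i))
  have hp := (encList (k.map (eγ i))).size_pos
  rw [← hk, List.map_append]
  omega

theorem lastNonzero {l : ∀ i, List (c i).F} (hc : PT e fun i => (c i).pres)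
    (hl : PT e fun i => encList ((l i).map (c i).enc)) :
    PT e fun i => (c i).enc (lastNonzero (l i)) := by
  classical
  obtain ⟨b, hb, hs⟩ := size_enc_bound hc
  exact foldr (eδ := fun i => (c i).enc) hl (field_zero hc) ⟨b, hb, fun i l' _ => hs i _⟩
    (ite (eα := fun q : Σ i, (c i).F × (c i).F => (c q.1).enc) var₁.field_eq_zero var₂ var₁)

theorem V_leadingCoeff (hc : PT e fun i => (c i).pres)
    (hf : PT e fun i => (c i).encV (m i) (f i)) (h : ∀ i, (f i).degree < m i) :
    PT e fun i => (c i).enc (f i).leadingCoeff :=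
  (lastNonzero hc (V_list hf)).congr fun i => by rw [lastNonzero_vec _ _ (h i)]

end PT
end TreeMachine

namespace TreeMachine

/-! ### Linear dependencies -/

section elimination
variable {K : Type*} [Field K]

open Classical in
/-- The entries of `r` and `v` at the first place where `r` does not vanish. -/
noncomputable def pivot (r v : List K) : K × K :=
  (r.zip v).foldr (fun x acc => if x.1 = 0 then acc else x) (0, 0)

/-- Cancel the entry of `v` at the first place where `r` does not vanish. -/
noncomputable def elim (r v : List K) : List K :=
  List.zipWith (fun x y => (pivot r v).1 * y - (pivot r v).2 * x) r v

/-- Reduce the row `v` modulo the rows `bs`, the last one first. -/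
noncomputable def reduceRow (bs : List (List K)) (v : List K) : List K := bs.foldr elim v

open Classical in
/-- Process one row; the state consists of the echelon rows so far and of the second part of the
first row whose first part is reduced to zero. -/
noncomputable def elimStep (m : ℕ) (st : List (List K) × List K) (v : List K) :
    List (List K) × List K :=
  if st.2 = [] then
    if ∀ x ∈ (reduceRow st.1 v).take m, x = 0 then (st.1, (reduceRow st.1 v).drop m)
    else (reduceRow st.1 v :: st.1, [])
  else st

/-- Find the first row whose first part depends linearly on the first parts of the previous rows;
return the second part of the relation. -/
noncomputable def firstDep (m : ℕ) (rows : List (List K)) : List K :=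
  (rows.foldl (elimStep m) ([], [])).2

theorem length_reduceRow_le (bs : List (List K)) (v : List K) :
    (reduceRow bs v).length ≤ v.length := by
  induction bs with
  | nil => simp [reduceRow]
  | cons b bs ih =>
    simp only [reduceRow, List.foldr_cons, elim, List.length_zipWith] at ih ⊢
    omega

/-- In the application the entries lie in a finite field and cannot grow, so the number and the
lengths of the rows control the size of the state. -/
theorem length_foldl_elimStep (m M : ℕ) (rows : List (List K)) (h : ∀ r ∈ rows, r.length ≤ M)
    (st : List (List K) × List K) (h₁ : ∀ r ∈ st.1, r.length ≤ M) (h₂ : st.2.length ≤ M) :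
    (∀ r ∈ (rows.foldl (elimStep m) st).1, r.length ≤ M) ∧
      (rows.foldl (elimStep m) st).1.length ≤ st.1.length + rows.length ∧
      (rows.foldl (elimStep m) st).2.length ≤ M := by
  induction rows generalizing st with
  | nil => exact ⟨h₁, by simp, h₂⟩
  | cons v rows ih =>
    have hv : v.length ≤ M := h v (by simp)
    have hr := (length_reduceRow_le st.1 v).trans hv
    have key : (∀ r ∈ (elimStep m st v).1, r.length ≤ M) ∧
        (elimStep m st v).1.length ≤ st.1.length + 1 ∧ (elimStep m st v).2.length ≤ M := by
      rw [elimStep]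
      split
      · split
        · refine ⟨h₁, by simp, ?_⟩
          simp only [List.length_drop]; omega
        · refine ⟨?_, by simp, by simp⟩
          intro r hr'
          rcases List.mem_cons.1 hr' with rfl | h
          · exact hr
          · exact h₁ r h
      · exact ⟨h₁, by simp, h₂⟩
    obtain ⟨h3, h4, h5⟩ := ih (fun r hr => h r (by simp [hr])) (elimStep m st v) key.1 key.2.2
    rw [List.foldl_cons, List.length_cons]
    exact ⟨h3, by omega, h5⟩

end elimination

namespace PT
universe u v
variable {ι : Type v} {e : ι → Data} {c : ι → FieldPres.{u}} {m : ι → ℕ}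
  {r w : ∀ i, List (c i).F}

theorem pivot (hc : PT e fun i => (c i).pres) (hr : PT e fun i => encList ((r i).map (c i).enc))
    (hw : PT e fun i => encList ((w i).map (c i).enc)) :
    PT e fun i => .node ((c i).enc (pivot (r i) (w i)).1) ((c i).enc (pivot (r i) (w i)).2) := by
  classical
  obtain ⟨b, hb, hs⟩ := size_enc_bound hc
  let eP : ∀ i, (c i).F × (c i).F → Data := fun i x => .node ((c i).enc x.1) ((c i).enc x.2)
  have h1 : PT (fun q : Σ i, ((c i).F × (c i).F) × ((c i).F × (c i).F) =>
      .node (e q.1) (.node (eP q.1 q.2.1) (eP q.1 q.2.2))) fun q => (c q.1).enc q.2.2.1 :=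
    var₂.left
  exact foldr (eγ := eP) (eδ := eP) (a := fun i => (0, 0)) (l := fun i => (r i).zip (w i))
    (s := fun i x acc => if x.1 = 0 then acc else x)
    (zip hr hw) ((field_zero hc).node (field_zero hc))
    ⟨_, (hb.add hb).add (.const 1), fun i l' _ => by
      have h1 := hs i (l'.foldr (fun x acc => if x.1 = 0 then acc else x) (0, 0)).1
      have h2 := hs i (l'.foldr (fun x acc => if x.1 = 0 then acc else x) (0, 0)).2
      simp only [eP, Data.size]; omega⟩
    (ite (eα := fun q : Σ i, ((c i).F × (c i).F) × ((c i).F × (c i).F) => eP q.1)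
      h1.field_eq_zero var₁ var₂)

theorem elim (hc : PT e fun i => (c i).pres) (hr : PT e fun i => encList ((r i).map (c i).enc))
    (hw : PT e fun i => encList ((w i).map (c i).enc)) :
    PT e fun i => encList ((elim (r i) (w i)).map (c i).enc) := by
  have hp := pivot hc hr hw
  have h1 : PT e fun i => (c i).enc (TreeMachine.pivot (r i) (w i)).1 := hp.left
  have h2 : PT e fun i => (c i).enc (TreeMachine.pivot (r i) (w i)).2 := hp.right
  have h3 : PT (fun q : Σ i, (c i).F × (c i).F => .node (e q.1)
      (.node ((c q.1).enc q.2.1) ((c q.1).enc q.2.2))) fun q => (c q.1).enc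
      ((TreeMachine.pivot (r q.1) (w q.1)).1 * q.2.2 -
        (TreeMachine.pivot (r q.1) (w q.1)).2 * q.2.1) :=
    field_sub hc.wk (field_mul hc.wk h1.wk var₂) (field_mul hc.wk h2.wk var₁)
  exact zipWith (eγ := fun i => (c i).enc) (eδ := fun i => (c i).enc) (eε := fun i => (c i).enc)
    (f := fun i x y => (TreeMachine.pivot (r i) (w i)).1 * y -
      (TreeMachine.pivot (r i) (w i)).2 * x) hr hw h3

theorem list_length_bound (hw : PT e fun i => encList ((w i).map (c i).enc)) :
    PB e fun i => (w i).length :=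
  hw.out_size.mono fun i => by simpa using length_le_size_encList ((w i).map (c i).enc)

theorem reduceRow {bs : ∀ i, List (List (c i).F)} (hc : PT e fun i => (c i).pres)
    (hb : PT e fun i => encList ((bs i).map fun r => encList (r.map (c i).enc)))
    (hw : PT e fun i => encList ((w i).map (c i).enc)) :
    PT e fun i => encList ((reduceRow (bs i) (w i)).map (c i).enc) := by
  obtain ⟨b, hb', hs⟩ := size_list_bound hc (list_length_bound hw)
  exact foldr (eγ := fun i (r : List (c i).F) => encList (r.map (c i).enc))
    (eδ := fun i (r : List (c i).F) => encList (r.map (c i).enc))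
    (s := fun _ r v => TreeMachine.elim r v) hb hw
    ⟨b, hb', fun i l' _ => hs i _ (length_reduceRow_le l' (w i))⟩
    (elim hc.wk var₂ var₁)

theorem firstDep {rows : ∀ i, List (List (c i).F)} (hc : PT e fun i => (c i).pres)
    (hm : PT e fun i => unary (m i))
    (hr : PT e fun i => encList ((rows i).map fun r => encList (r.map (c i).enc))) :
    PT e fun i => encList ((firstDep (m i) (rows i)).map (c i).enc) := by
  classical
  let eR : ∀ i, List (c i).F → Data := fun i r => encList (r.map (c i).enc)
  let eS : ∀ i, List (List (c i).F) × List (c i).F → Data := fun i st =>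
    .node (encList (st.1.map (eR i))) (eR i st.2)
  have hlen : PB e fun i => (rows i).length :=
    hr.out_size.mono fun i => by simpa using length_le_size_encList ((rows i).map (eR i))
  have hrl : ∀ i, ∀ r ∈ rows i, r.length ≤ (encList ((rows i).map (eR i))).size := fun i r hr => by
    have h1 := size_le_size_encList (List.mem_map_of_mem (f := eR i) hr)
    have h2 := length_le_size_encList (r.map (c i).enc)
    simp only [List.length_map, eR] at *; omega
  obtain ⟨b, hb, hs⟩ := size_list_bound hc hr.out_size
  have h1 : PT (fun q : Σ i, (List (List (c i).F) × List (c i).F) × List (c i).F =>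
      .node (e q.1) (.node (eS q.1 q.2.1) (eR q.1 q.2.2)))
      fun q => encList (q.2.1.1.map (eR q.1)) := var₁.left
  have h2 : PT (fun q : Σ i, (List (List (c i).F) × List (c i).F) × List (c i).F =>
      .node (e q.1) (.node (eS q.1 q.2.1) (eR q.1 q.2.2)))
      fun q => eR q.1 q.2.1.2 := var₁.right
  have h3 : PT (fun q : Σ i, (List (List (c i).F) × List (c i).F) × List (c i).F =>
      .node (e q.1) (.node (eS q.1 q.2.1) (eR q.1 q.2.2)))
      fun q => eR q.1 (TreeMachine.reduceRow q.2.1.1 q.2.2) := reduceRow hc.wk h1 var₂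
  have h4 : PT (fun q : Σ i, (List (List (c i).F) × List (c i).F) × List (c i).F =>
      .node (e q.1) (.node (eS q.1 q.2.1) (eR q.1 q.2.2)))
      fun q => encProp (∀ x ∈ (TreeMachine.reduceRow q.2.1.1 q.2.2).take (m q.1), x = 0) :=
    all (p := fun _ x => x = 0) (take hm.wk h3) (of_node_right id).field_eq_zero
  have h5 : PT (fun q : Σ i, (List (List (c i).F) × List (c i).F) × List (c i).F =>
      .node (e q.1) (.node (eS q.1 q.2.1) (eR q.1 q.2.2)))
      fun q => eS q.1 (elimStep (m q.1) q.2.1 q.2.2) :=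
    ite (eα := fun q : Σ i, (List (List (c i).F) × List (c i).F) × List (c i).F => eS q.1)
      h2.eq_nil
      (ite (eα := fun q : Σ i, (List (List (c i).F) × List (c i).F) × List (c i).F => eS q.1) h4
        (h1.node (drop hm.wk h3)) ((h3.node h1).node leaf)) var₁
  have h6 := foldl (eγ := eR) (eδ := eS) (s := fun i => elimStep (m i)) (a := fun _ => ([], []))
    hr (leaf.node leaf)
    ⟨_, (((hlen.mul (hb.add (.const 1))).add (.const 1)).add hb).add (.const 1), fun i l' h => by
      obtain ⟨g1, g2, g3⟩ := length_foldl_elimStep (m i) _ l'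
        (fun r hr => hrl i r (h.subset hr)) ([], []) (by simp) (by simp)
      have g4 := size_encList_le ((l'.foldl (elimStep (m i)) ([], [])).1.map (eR i)) (b i) (by
        simp only [List.mem_map]; rintro _ ⟨r, hr, rfl⟩; exact hs i r (g1 r hr))
      have g5 := hs i _ g3
      have g6 := h.length_le
      rw [List.length_map] at g4
      simp only [List.length_nil, zero_add] at g2
      have g7 := Nat.mul_le_mul_right (b i + 1) (g2.trans g6)
      simp only [eS, Data.size]
      simp only [eR] at *
      omega⟩ h5
  exact of_node_right h6

end PT

/-! ### Correctness of the elimination -/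

section elimination
variable {K : Type*} [Field K] {m s : ℕ}

/-- The row of a pair of polynomials. -/
noncomputable def row (m s : ℕ) (q : K[X] × K[X]) : List K := vec m q.1 ++ vec s q.2

/-- The first parts of the pairs are linearly independent modulo `X ^ m`. -/
def NoDep (m : ℕ) (qs : List (K[X] × K[X])) : Prop :=
  ∀ l₁ q l₂, qs = l₁ ++ q :: l₂ → ∀ g ∈ Submodule.span K {x | x ∈ l₁}, ¬X ^ m ∣ (q + g).1

theorem zipWith_row (F : K → K → K) (p q r : K[X] × K[X])
    (h₁ : ∀ k, F (p.1.coeff k) (q.1.coeff k) = r.1.coeff k)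
    (h₂ : ∀ k, F (p.2.coeff k) (q.2.coeff k) = r.2.coeff k) :
    List.zipWith F (row m s p) (row m s q) = row m s r := by
  rw [row, row, List.zipWith_append (by simp), zipWith_vec _ _ _ _ _ h₁, zipWith_vec _ _ _ _ _ h₂,
    row]

theorem pivot_of_getElem (r v : List K) (i : ℕ) (hr : i < r.length) (hv : i < v.length)
    (h₀ : r[i] ≠ 0) (h : ∀ j (hj : j < r.length), j < i → r[j] = 0) : pivot r v = (r[i], v[i]) := by
  induction i generalizing r v with
  | zero =>
    obtain ⟨a, r, rfl⟩ := List.exists_cons_of_length_pos (by omega : 0 < r.length)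
    obtain ⟨b, v, rfl⟩ := List.exists_cons_of_length_pos (by omega : 0 < v.length)
    simp only [List.getElem_cons_zero] at h₀
    simp [pivot, h₀]
  | succ i ih =>
    obtain ⟨a, r, rfl⟩ := List.exists_cons_of_length_pos (by omega : 0 < r.length)
    obtain ⟨b, v, rfl⟩ := List.exists_cons_of_length_pos (by omega : 0 < v.length)
    have ha : a = 0 := h 0 (by simp) (by omega)
    have := ih r v (by simpa using hr) (by simpa using hv) (by simpa using h₀)
      (fun j hj hji => h (j + 1) (by simpa using hj) (by omega))
    simpa [pivot, ha] using this

/-- The first nonzero place of the row of `b` is the trailing degree of `b.1`, which lies in the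
first part as it is less than `m`. Cross-multiplication avoids inverting the pivot, so the result is
only a nonzero multiple of the usual reduced row. -/
theorem elim_row {b q : K[X] × K[X]} (hb : b.1 ≠ 0) (hm : b.1.natTrailingDegree < m) :
    elim (row m s b) (row m s q) = row m s (b.1.coeff b.1.natTrailingDegree • q -
      q.1.coeff b.1.natTrailingDegree • b) := by
  have hrow : ∀ (p : K[X] × K[X]) j (hj : j < (row m s p).length), j < m →
      (row m s p)[j] = p.1.coeff j := by
    intro p j hj hjm
    simp only [row]
    rw [List.getElem_append_left (by simpa using hjm), getElem_vec]
  have hl : ∀ p : K[X] × K[X], (row m s p).length = m + s := by simp [row]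
  have h1 := pivot_of_getElem (row m s b) (row m s q) b.1.natTrailingDegree (by rw [hl]; omega)
    (by rw [hl]; omega) (by rw [hrow _ _ _ hm]; exact coeff_natTrailingDegree_ne_zero.2 hb)
    (fun j hj hji => by
      rw [hrow _ _ _ (by omega)]; exact coeff_eq_zero_of_lt_natTrailingDegree hji)
  rw [hrow _ _ _ hm, hrow _ _ _ hm] at h1
  rw [elim, h1]
  exact zipWith_row _ _ _ _ (fun k => by simp) fun k => by simp

/-- Echelon form, the newest row first. -/
def Echelon (m : ℕ) : List (K[X] × K[X]) → Prop
  | [] => True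
  | b :: bs => Echelon m bs ∧ b.1 ≠ 0 ∧ b.1.natTrailingDegree < m ∧
      ∀ b' ∈ bs, b.1.coeff b'.1.natTrailingDegree = 0

theorem span_cons (b : K[X] × K[X]) (bs : List (K[X] × K[X])) :
    Submodule.span K {x | x ∈ b :: bs} =
      Submodule.span K {b} ⊔ Submodule.span K {x | x ∈ bs} := by
  rw [← Submodule.span_insert]
  congr 1
  ext x; simp

theorem span_append_singleton (b : K[X] × K[X]) (bs : List (K[X] × K[X])) :
    Submodule.span K {x | x ∈ bs ++ [b]} =
      Submodule.span K {b} ⊔ Submodule.span K {x | x ∈ bs} := by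
  rw [← Submodule.span_insert]
  congr 1
  ext x; simp [or_comm]

/-- The newest row vanishes at all older pivots, so the combination of the older rows vanishes there
by itself and is zero by induction. The newest pivot then kills the remaining coefficient. -/
theorem Echelon.eq_zero {bs : List (K[X] × K[X])} (hbs : Echelon m bs) {h : K[X] × K[X]}
    (hh : h ∈ Submodule.span K {x | x ∈ bs})
    (h0 : ∀ b ∈ bs, h.1.coeff b.1.natTrailingDegree = 0) : h = 0 := by
  induction bs generalizing h with
  | nil => simpa using hh
  | cons b bs ih =>
    obtain ⟨h1, h2, h3, h4⟩ := hbs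
    rw [span_cons, Submodule.mem_sup] at hh
    obtain ⟨x, hx, y, hy, rfl⟩ := hh
    obtain ⟨t, rfl⟩ := Submodule.mem_span_singleton.1 hx
    have hy0 : y = 0 := ih h1 hy fun b' hb' => by
      have := h0 b' (by simp [hb'])
      simpa [h4 b' hb'] using this
    have := h0 b (by simp)
    simp only [hy0, add_zero, Prod.smul_fst, coeff_smul, smul_eq_mul, mul_eq_zero] at this
    rcases this with ht | ht
    · simp [ht, hy0]
    · exact absurd ht (coeff_natTrailingDegree_ne_zero.2 h2)

/-- The newest row is used last. Since it vanishes at the older pivots, it does not spoil the zeros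
produced there before. -/
theorem reduceRow_spec {bs : List (K[X] × K[X])} (hbs : Echelon m bs) (q : K[X] × K[X]) :
    ∃ r : K[X] × K[X], reduceRow (bs.map (row m s)) (row m s q) = row m s r ∧
      (∃ a : K, a ≠ 0 ∧ r - a • q ∈ Submodule.span K {x | x ∈ bs}) ∧
      ∀ b ∈ bs, r.1.coeff b.1.natTrailingDegree = 0 := by
  induction bs with
  | nil => exact ⟨q, rfl, ⟨1, one_ne_zero, by simp⟩, by simp⟩
  | cons b bs ih =>
    obtain ⟨h1, h2, h3, h4⟩ := hbs
    obtain ⟨r, hr, ⟨a, ha, hra⟩, hr0⟩ := ih h1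
    have hb := coeff_natTrailingDegree_ne_zero.2 h2
    refine ⟨b.1.coeff b.1.natTrailingDegree • r - r.1.coeff b.1.natTrailingDegree • b, ?_,
      ⟨b.1.coeff b.1.natTrailingDegree * a, mul_ne_zero hb ha, ?_⟩, ?_⟩
    · rw [reduceRow, List.map_cons, List.foldr_cons]
      rw [reduceRow] at hr
      rw [hr, elim_row h2 h3]
    · rw [span_cons]
      have : b.1.coeff b.1.natTrailingDegree • r - r.1.coeff b.1.natTrailingDegree • b -
          (b.1.coeff b.1.natTrailingDegree * a) • q =
          (-r.1.coeff b.1.natTrailingDegree) • b +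
            b.1.coeff b.1.natTrailingDegree • (r - a • q) := by
        rw [smul_sub, smul_smul, neg_smul]; abel
      rw [this]
      exact Submodule.add_mem_sup (Submodule.smul_mem _ _ (Submodule.mem_span_singleton_self b))
        (Submodule.smul_mem _ _ hra)
    · intro b' hb'
      rcases List.mem_cons.1 hb' with rfl | hb'
      · simp [mul_comm]
      · simp [hr0 b' hb', h4 b' hb']

theorem foldl_elimStep_of_ne (rows : List (List K)) (st : List (List K) × List K)
    (h : st.2 ≠ []) : rows.foldl (elimStep m) st = st := by
  induction rows with
  | nil => rfl
  | cons v rows ih => rw [List.foldl_cons, elimStep, if_neg h, ih]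

/-- The two alternatives describe the state before and after success. Before it, the echelon rows
span the same space as the rows read so far; after it, the state is frozen. The second component is
empty exactly before success, which needs `0 < s`: a recorded relation is then never the empty list.
-/
theorem firstDep_aux (hs : 0 < s) (qs : List (K[X] × K[X])) :
    (NoDep m qs ∧ ∃ bs : List (K[X] × K[X]), Echelon m bs ∧
      Submodule.span K {x | x ∈ bs} = Submodule.span K {x | x ∈ qs} ∧
      (qs.map (row m s)).foldl (elimStep m) ([], []) = (bs.map (row m s), [])) ∨
    (∃ l₁ q l₂, qs = l₁ ++ q :: l₂ ∧ NoDep m l₁ ∧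
      ∃ a : K, a ≠ 0 ∧ ∃ g ∈ Submodule.span K {x | x ∈ l₁}, X ^ m ∣ (a • q + g).1 ∧
        ((qs.map (row m s)).foldl (elimStep m) ([], [])).2 = vec s (a • q + g).2) := by
  induction qs using List.reverseRecOn with
  | nil => exact Or.inl ⟨by intro l₁ q l₂ h; simp at h, [], trivial, rfl, rfl⟩
  | append_singleton qs q ih =>
    rw [List.map_append, List.foldl_append]
    rcases ih with ⟨hno, bs, hbs, hspan, hst⟩ | ⟨l₁, q', l₂, hq, hno, a, ha, g, hg, hX, hst⟩
    · obtain ⟨r, hr, ⟨a, ha, hra⟩, hr0⟩ := reduceRow_spec (s := s) hbs q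
      have htake : (row m s r).take m = vec m r.1 := by
        rw [row, List.take_append_of_le_length (by simp), take_vec, min_self]
      have hdrop : (row m s r).drop m = vec s r.2 := by
        rw [row, List.drop_append_of_le_length (by simp), List.drop_of_length_le (by simp)]; rfl
      have hcond : (∀ x ∈ (reduceRow (bs.map (row m s)) (row m s q)).take m, x = 0) ↔
          X ^ m ∣ r.1 := by rw [hr, htake, forall_vec_eq_zero]
      rw [hst]
      by_cases hd : X ^ m ∣ r.1
      · refine Or.inr ⟨qs, q, [], rfl, hno, a, ha, r - a • q, hspan ▸ hra, by simpa using hd, ?_⟩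
        rw [List.map_cons, List.map_nil, List.foldl_cons, List.foldl_nil, elimStep, if_pos rfl,
          if_pos (hcond.2 hd), hr, hdrop, add_sub_cancel]
      · refine Or.inl ⟨?_, r :: bs, ⟨hbs, ?_, ?_, hr0⟩, ?_, ?_⟩
        · intro l₁ q' l₂ h g hg hX
          rcases l₂.eq_nil_or_concat with rfl | ⟨l₂, z, rfl⟩
          · obtain ⟨rfl, h2⟩ := List.append_inj' h rfl
            obtain rfl : q = q' := by simpa using h2
            -- If the first part of `q + g` vanished modulo `X ^ m`, this difference would be an
            -- element of the span that vanishes at all pivots, hence zero; then the first part of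
            -- `r` would vanish modulo `X ^ m` too.
            have h3 : r - a • (q + g) = 0 := by
              refine hbs.eq_zero ?_ fun b hb => ?_
              · rw [smul_add, ← sub_sub]
                exact Submodule.sub_mem _ hra (Submodule.smul_mem _ _ (hspan ▸ hg))
              · have h4 : b.1.natTrailingDegree < m := by
                  clear hcond hst hspan hr hra hr0
                  induction bs with
                  | nil => simp at hb
                  | cons b' bs ih =>
                    rcases List.mem_cons.1 hb with rfl | hb
                    · exact hbs.2.2.1
                    · exact ih hbs.1 hb
                have h5 := X_pow_dvd_iff.1 hX _ h4
                have h6 := hr0 b hb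
                simp only [Prod.fst_sub, Prod.smul_fst, coeff_sub, coeff_smul, h5, h6]
                simp
            rw [sub_eq_zero] at h3
            refine hd ?_
            rw [h3, Prod.smul_fst, smul_eq_C_mul]
            exact hX.mul_left _
          · rw [show l₁ ++ q' :: (l₂.concat z) = (l₁ ++ q' :: l₂) ++ [z] by simp] at h
            obtain ⟨h2, -⟩ := List.append_inj' h rfl
            exact hno l₁ q' l₂ h2 g hg hX
        · rintro h0; rw [h0] at hd; exact hd (dvd_zero _)
        · by_contra hlt
          exact hd (X_pow_dvd_iff.2 fun k hk =>
            coeff_eq_zero_of_lt_natTrailingDegree (hk.trans_le (not_lt.1 hlt)))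
        · rw [span_cons, span_append_singleton, hspan]
          rw [hspan] at hra
          refine le_antisymm (sup_le ?_ le_sup_right) (sup_le ?_ le_sup_right)
          · rw [Submodule.span_singleton_le_iff_mem]
            have : r = a • q + (r - a • q) := by abel
            rw [this]
            exact Submodule.add_mem_sup
              (Submodule.smul_mem _ _ (Submodule.mem_span_singleton_self q)) hra
          · rw [Submodule.span_singleton_le_iff_mem]
            have : q = a⁻¹ • r + -(a⁻¹ • (r - a • q)) := by
              rw [smul_sub, smul_smul, inv_mul_cancel₀ ha, one_smul]; abel
            rw [this]
            exact Submodule.add_mem_sup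
              (Submodule.smul_mem _ _ (Submodule.mem_span_singleton_self r))
              (Submodule.neg_mem _ (Submodule.smul_mem _ _ hra))
        · rw [List.map_cons, List.map_nil, List.foldl_cons, List.foldl_nil, elimStep, if_pos rfl,
            if_neg (hcond.not.2 hd), hr, List.map_cons]
    · refine Or.inr ⟨l₁, q', l₂ ++ [q], by simp [hq], hno, a, ha, g, hg, hX, ?_⟩
      rw [foldl_elimStep_of_ne, hst]
      rw [hst]
      intro h
      have := congrArg List.length h
      simp at this; omega

theorem firstDep_spec (hs : 0 < s) {qs : List (K[X] × K[X])} (h : ¬NoDep m qs) :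
    ∃ l₁ q l₂, qs = l₁ ++ q :: l₂ ∧ NoDep m l₁ ∧
      ∃ a : K, a ≠ 0 ∧ ∃ g ∈ Submodule.span K {x | x ∈ l₁}, X ^ m ∣ (a • q + g).1 ∧
        firstDep m (qs.map (row m s)) = vec s (a • q + g).2 :=
  (firstDep_aux hs qs).resolve_left fun h' => h h'.1

end elimination
end TreeMachine

namespace BivariateSplit

/-! ### Bivariate polynomials -/

section bivariate
variable {F : Type*} [Field F]

theorem coeff_coeff_swap (Q : F[X][Y]) (i j : ℕ) :
    ((Bivariate.swap Q).coeff i).coeff j = (Q.coeff j).coeff i := by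
  induction Q using Polynomial.induction_on' with
  | add p q hp hq => simp only [map_add, coeff_add, hp, hq]
  | monomial n f =>
    induction f using Polynomial.induction_on' with
    | add p q hp hq => simp only [map_add, coeff_add, hp, hq]
    | monomial k r =>
      rw [Bivariate.swap_monomial_monomial]
      simp only [coeff_monomial]
      by_cases h1 : k = i <;> by_cases h2 : n = j <;> simp [h1, h2, coeff_monomial]

/-- Both partial degrees are less than `n`. -/
def Small (n : ℕ) (Q : F[X][Y]) : Prop := Q.natDegree < n ∧ (Bivariate.swap Q).natDegree < n

theorem Small.coeff_natDegree {n : ℕ} {Q : F[X][Y]} (h : Small n Q) (j : ℕ) :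
    (Q.coeff j).natDegree < n := by
  refine lt_of_le_of_lt ?_ h.2
  rw [natDegree_le_iff_coeff_eq_zero]
  intro i hi
  rw [← coeff_coeff_swap, coeff_eq_zero_of_natDegree_lt hi, coeff_zero]

theorem small_of_coeff {n : ℕ} {Q : F[X][Y]} (h : Q.natDegree < n)
    (h' : ∀ j, (Q.coeff j).natDegree < n) : Small n Q := by
  refine ⟨h, ?_⟩
  rw [← Nat.le_sub_one_iff_lt (by omega), natDegree_le_iff_coeff_eq_zero]
  intro i hi
  ext j
  rw [coeff_coeff_swap, coeff_zero]
  exact coeff_eq_zero_of_natDegree_lt ((h' j).trans_le (by omega))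

theorem Small.of_dvd {n : ℕ} {Q R : F[X][Y]} (h : Small n R) (hR : R ≠ 0) (hQ : Q ∣ R) :
    Small n Q := by
  refine ⟨(natDegree_le_of_dvd hQ hR).trans_lt h.1, ?_⟩
  obtain ⟨S, rfl⟩ := hQ
  rw [Small, map_mul] at h
  refine (natDegree_le_of_dvd (dvd_mul_right _ _) ?_).trans_lt h.2
  rw [← map_mul]
  exact fun h0 => hR ((map_eq_zero_iff Bivariate.swap (AlgEquiv.injective _)).1 h0)

theorem prime_C_X : Prime (C X : F[X][Y]) := prime_C_iff.2 prime_X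

theorem C_X_dvd_iff {f : F[X][Y]} : C X ∣ f ↔ restrict 0 f = 0 := by
  rw [C_dvd_iff_dvd_coeff, restrict, Polynomial.ext_iff]
  simp [X_dvd_iff, coeff_zero_eq_eval_zero]

/-- Each term in the expansion of the Sylvester determinant is a product of `m + k` entries. -/
theorem natDegree_resultant_le {f g : F[X][Y]} {m k d : ℕ} (hf : ∀ j, (f.coeff j).natDegree ≤ d)
    (hg : ∀ j, (g.coeff j).natDegree ≤ d) : (resultant f g m k).natDegree ≤ (m + k) * d := by
  have hent : ∀ i j, (sylvester f g m k i j).natDegree ≤ d := by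
    intro i j
    simp only [sylvester, Matrix.of_apply]
    induction j using Fin.addCases with
    | left j => simp only [Fin.addCases_left]; split <;> simp [*]
    | right j => simp only [Fin.addCases_right]; split <;> simp [*]
  rw [resultant, Matrix.det_apply]
  refine natDegree_sum_le_of_forall_le _ _ fun σ _ => ?_
  refine (natDegree_smul_le _ _).trans ((natDegree_prod_le _ _).trans ?_)
  refine (Finset.sum_le_card_nsmul _ _ d fun i _ => hent _ _).trans ?_
  simp

-- The constant `ρ` is the resultant with respect to `Y`, or `q` itself if `q` does not involve `Y`.
-- Its degree bound `2 * n * n` is the origin of the precision `prec n`.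
open Classical in
theorem exists_combination {n : ℕ} {q Q : F[X][Y]} (hq : Irreducible q) (hqs : Small n q)
    (hQs : Small n Q) (h : ¬q ∣ Q) :
    ∃ ρ : F[X], ρ ≠ 0 ∧ ρ.natDegree < 2 * n * n ∧ ∃ a b, a * q + b * Q = C ρ := by
  by_cases h0 : q.natDegree = 0
  · refine ⟨q.coeff 0, ?_, ?_, 1, 0, ?_⟩
    · intro h1
      rw [eq_C_of_natDegree_eq_zero h0, h1, C_0] at hq
      exact hq.ne_zero rfl
    · have := hqs.coeff_natDegree 0
      nlinarith
    · rw [one_mul, zero_mul, add_zero]; exact eq_C_of_natDegree_eq_zero h0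
  · let _ : NormalizedGCDMonoid F[X] := Classical.arbitrary _
    have hprim : q.IsPrimitive := hq.isPrimitive h0
    obtain ⟨a, b, -, -, hab⟩ := exists_mul_add_mul_eq_C_resultant q Q le_rfl le_rfl (Or.inl h0)
    refine ⟨_, ?_, ?_, a, b, by rw [← hab]; ring⟩
    -- If the resultant vanished, `q`, which stays irreducible over the fraction field by Gauss's
    -- lemma, would divide `Q` there, and by primitivity already over `F[X]`.
    · intro hres
      have hinj := IsFractionRing.injective F[X] (FractionRing F[X])
      have h1 : resultant (q.map (algebraMap F[X] (FractionRing F[X])))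
          (Q.map (algebraMap F[X] (FractionRing F[X]))) = 0 := by
        rw [natDegree_map_eq_of_injective hinj, natDegree_map_eq_of_injective hinj,
          resultant_map_map, hres, map_zero]
      rw [resultant_eq_zero_iff] at h1
      have h2 := (hprim.irreducible_iff_irreducible_map_fraction_map (K := FractionRing F[X])).1 hq
      have h3 : q.map (algebraMap F[X] (FractionRing F[X])) ∣
          Q.map (algebraMap F[X] (FractionRing F[X])) := by
        by_contra h3
        exact h1.2 ((h2.coprime_iff_not_dvd).2 h3)
      have hQ0 : Q ≠ 0 := by rintro rfl; exact h (dvd_zero _)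
      rw [Q.eq_C_content_mul_primPart, Polynomial.map_mul, map_C] at h3
      have h4 := (IsUnit.dvd_mul_left (isUnit_C.2 (IsUnit.mk0 _ (by
        rw [ne_eq, FaithfulSMul.algebraMap_eq_zero_iff, content_eq_zero_iff]; exact hQ0)))).1 h3
      have h5 := hprim.dvd_of_fraction_map_dvd_fraction_map h4
      exact h (h5.trans (Q.primPart_dvd))
    · have h1 := hqs.1
      have h2 := hQs.1
      refine (natDegree_resultant_le (d := n) (fun j => (hqs.coeff_natDegree j).le)
        fun j => (hQs.coeff_natDegree j).le).trans_lt ?_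
      nlinarith

theorem restrict_mul (α : F) (P Q : F[X][Y]) : restrict α (P * Q) = restrict α P * restrict α Q :=
  Polynomial.map_mul _

theorem restrict_map_C (α : F) (G : F[X]) : restrict α (G.map C) = G := by
  rw [restrict, map_map]
  convert Polynomial.map_id
  ext; simp

theorem restrict_C (α : F) (ρ : F[X]) : restrict α (C ρ) = C (ρ.eval α) := by
  rw [restrict, map_C, coe_evalRingHom]

/-- An irreducible polynomial that divides `G * Q` modulo a high power of `X` divides `Q`. -/
theorem irreducible_dvd_of_modEq {n N : ℕ} {q Q B : F[X][Y]} {G : F[X]} (hq : Irreducible q)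
    (hX : ¬C X ∣ q) (hG : ¬restrict 0 q ∣ G) (hqs : Small n q) (hQs : Small n Q)
    (hN : 2 * n * n ≤ N) (h : C X ^ N ∣ G.map C * Q - q * B) : q ∣ Q := by
  by_contra hdvd
  obtain ⟨ρ, hρ, hρN, a, b, hab⟩ := exists_combination hq hqs hQs hdvd
  have h1 : C X ^ N ∣ G.map C * C ρ - q * (B * b + G.map C * a) := by
    have : G.map C * C ρ - q * (B * b + G.map C * a) = (G.map C * Q - q * B) * b := by
      rw [← hab]; ring
    rw [this]; exact h.mul_right _
  -- The power of `X` in `ρ` is split off, so that the cofactor `u` survives the substitution `X =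
  -- 0`.
  obtain ⟨u, hu, hu0⟩ : ∃ u : F[X], ρ = X ^ ρ.natTrailingDegree * u ∧ u.eval 0 ≠ 0 := by
    obtain ⟨u, hu⟩ : X ^ ρ.natTrailingDegree ∣ ρ :=
      X_pow_dvd_iff.2 fun d hd => coeff_eq_zero_of_lt_natTrailingDegree hd
    refine ⟨u, hu, ?_⟩
    have := coeff_natTrailingDegree_ne_zero.2 hρ
    rw [hu] at this
    rw [← coeff_zero_eq_eval_zero]
    rw [← hu] at this
    nth_rewrite 1 [hu] at this
    simpa [coeff_X_pow_mul'] using this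
  set s := ρ.natTrailingDegree with hs
  -- The inequality is strict, so one factor `X` is left in the congruence after `X ^ s` has been
  -- cancelled.
  have hsN : s < N := (natTrailingDegree_le_natDegree ρ).trans_lt (hρN.trans_le hN)
  have h2 : (C ρ : F[X][Y]) = C X ^ s * C u := by rw [hu, C_mul, C_pow]
  have h3 : C X ^ s ∣ q * (B * b + G.map C * a) := by
    have h4 := (pow_dvd_pow (C X) hsN.le).trans h1
    have h5 : C X ^ s ∣ G.map C * C ρ := by rw [h2]; exact (dvd_mul_right _ _).mul_left _
    exact (dvd_sub_right h5).1 h4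
  obtain ⟨B', hB'⟩ := prime_C_X.pow_dvd_of_dvd_mul_left s hX h3
  have h6 : C X ∣ G.map C * C u - q * B' := by
    have h7 : C X ^ s * C X ∣ C X ^ s * (G.map C * C u - q * B') := by
      rw [← pow_succ]
      refine ((pow_dvd_pow (C X) hsN).trans h1).trans (dvd_of_eq ?_)
      rw [hB', h2]; ring
    exact (mul_dvd_mul_iff_left (pow_ne_zero _ prime_C_X.ne_zero)).1 h7
  rw [C_X_dvd_iff, restrict, Polynomial.map_sub, ← restrict, ← restrict, restrict_mul, restrict_mul,
    restrict_map_C, restrict_C, sub_eq_zero] at h6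
  apply hG
  have : G = C (u.eval 0)⁻¹ * (restrict 0 q * restrict 0 B') := by
    rw [← h6, mul_comm G, ← mul_assoc, ← C_mul, inv_mul_cancel₀ hu0, C_1, one_mul]
  rw [this]
  exact (dvd_mul_right _ _).mul_left _

/-- The irreducible factors of `W` are taken one at a time. Once `q` is known to divide `Q`, it
cancels from the congruence without loss of precision because it is prime to `X`. -/
theorem dvd_of_modEq {n N : ℕ} {W : F[X][Y]} {G : F[X]} (hN : 2 * n * n ≤ N) (hW0 : W ≠ 0)
    (hWs : Small n W) (hW : ∀ q, Irreducible q → q ∣ W → ¬C X ∣ q ∧ ¬restrict 0 q ∣ G)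
    {Q R : F[X][Y]} (hQs : Small n Q) (h : C X ^ N ∣ G.map C * Q - W * R) : W ∣ Q := by
  induction W using WfDvdMonoid.induction_on_irreducible generalizing Q R with
  | zero => exact absurd rfl hW0
  | unit u hu => exact hu.dvd
  | mul a q ha hq ih =>
    obtain ⟨hqX, hqG⟩ := hW q hq (dvd_mul_right _ _)
    by_cases hQ0 : Q = 0
    · simp [hQ0]
    obtain ⟨Q', rfl⟩ := irreducible_dvd_of_modEq (B := a * R) hq hqX hqG
      (hWs.of_dvd hW0 (dvd_mul_right _ _)) hQs hN (by rwa [← mul_assoc])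
    refine mul_dvd_mul_left q (ih ha (hWs.of_dvd hW0 (dvd_mul_left _ _))
      (fun q' hq' h' => hW q' hq' (h'.mul_left _)) (hQs.of_dvd hQ0 (dvd_mul_left _ _)) (R := R) ?_)
    refine prime_C_X.pow_dvd_of_dvd_mul_left N hqX (h.trans (dvd_of_eq ?_))
    ring

/-- Let `T(0, Y) * h₀ = g ^ n`, `a = g ^ n` and `b = a - T * h₀`. Then `X` divides `b`, hence `a ^ N
≡ a ^ N - b ^ N` modulo `X ^ N`, and the right side is a multiple of `a - b = T * h₀`. The degree
bound for `H` fixes the number of unknowns in the linear system. -/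
theorem exists_inverse {n : ℕ} (N : ℕ) {T : F[X][Y]} {g : F[X]} (hT : restrict 0 T ∣ g ^ n)
    (hTn : T.natDegree < n) (hg : g.natDegree < n) (hg0 : g ≠ 0) :
    ∃ H : F[X][Y], H.natDegree ≤ N * (n * n + n) ∧ C X ^ N ∣ (g ^ (n * N)).map C - T * H := by
  obtain ⟨h₀, hh⟩ := hT
  have hd0 : (g ^ n).natDegree ≤ n * n := by
    rw [natDegree_pow]; gcongr
  have hh0 : h₀.natDegree ≤ n * n := by
    refine (natDegree_le_of_dvd ⟨restrict 0 T, ?_⟩ (pow_ne_zero n hg0)).trans hd0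
    rw [hh, mul_comm]
  have hX : C X ∣ (g ^ n).map C - T * h₀.map C := by
    rw [C_X_dvd_iff, restrict, Polynomial.map_sub, ← restrict, ← restrict, restrict_mul,
      restrict_map_C, restrict_map_C, hh, sub_self]
  have hd1 : ((g ^ n).map (C : F →+* F[X])).natDegree ≤ n * n + n :=
    natDegree_map_le.trans (hd0.trans (by omega))
  have hd2 : ((g ^ n).map C - T * h₀.map C).natDegree ≤ n * n + n := by
    refine (natDegree_sub_le _ _).trans (max_le hd1 (natDegree_mul_le.trans ?_))
    have := (natDegree_map_le (f := (C : F →+* F[X])) (p := h₀)).trans hh0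
    omega
  set a := (g ^ n).map (C : F →+* F[X]) with ha
  set b := a - T * h₀.map C with hb
  refine ⟨h₀.map C * ∑ k ∈ Finset.range N, a ^ k * b ^ (N - 1 - k), ?_, ?_⟩
  · rcases N with _ | N
    · simp
    refine natDegree_mul_le.trans ?_
    have h1 : (∑ k ∈ Finset.range (N + 1), a ^ k * b ^ (N + 1 - 1 - k)).natDegree ≤
        N * (n * n + n) := by
      refine natDegree_sum_le_of_forall_le _ _ fun k hk => ?_
      have hk' : k ≤ N := Nat.lt_succ_iff.1 (Finset.mem_range.1 hk)
      refine natDegree_mul_le.trans ?_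
      refine (add_le_add (natDegree_pow_le_of_le k hd1) (natDegree_pow_le_of_le _ hd2)).trans ?_
      rw [← add_mul]
      gcongr
      omega
    have h2 := (natDegree_map_le (f := (C : F →+* F[X])) (p := h₀)).trans hh0
    rw [add_mul, one_mul]; omega
  · have h1 := (Commute.all a b).mul_geom_sum₂ N
    have h2 : a - b = T * h₀.map C := by rw [hb]; ring
    rw [h2, mul_assoc] at h1
    rw [h1, pow_mul, Polynomial.map_pow, ← ha, sub_sub_cancel]
    exact pow_dvd_pow_of_dvd hX N

end bivariate
end BivariateSplit

/-! ### Packing two variables into one. -/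

namespace BivariateSplit

section pack
variable {F : Type*} [Field F]

theorem C_X_pow_dvd_iff {N : ℕ} {S : F[X][Y]} :
    C X ^ N ∣ S ↔ ∀ j i, i < N → (S.coeff j).coeff i = 0 := by
  rw [← C_pow, C_dvd_iff_dvd_coeff]
  simp only [X_pow_dvd_iff]

theorem subst_C_C (x y : F[X]) (a : F) : subst x y (C (C a)) = C a := by simp [subst]

theorem subst_C_X (x y : F[X]) : subst x y (C X) = x := by simp [subst]

theorem subst_Y (x y : F[X]) : subst x y Y = y := by simp [subst]

theorem smul_eq_C_C_mul (a : F) (Q : F[X][Y]) : a • Q = C (C a) * Q := by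
  ext i j; simp

theorem subst_smul (x y : F[X]) (a : F) (Q : F[X][Y]) : subst x y (a • Q) = a • subst x y Q := by
  rw [smul_eq_C_C_mul, map_mul, subst_C_C, smul_eq_C_mul]

/-- Substitution, as a linear map. -/
noncomputable def substₗ (x y : F[X]) : F[X][Y] →ₗ[F] F[X] where
  toFun := subst x y
  map_add' := map_add _
  map_smul' := subst_smul x y

theorem ringHom_ext {R : Type*} [CommSemiring R] {φ ψ : F[X][Y] →+* R}
    (h₁ : ∀ a, φ (C (C a)) = ψ (C (C a))) (h₂ : φ (C X) = ψ (C X)) (h₃ : φ Y = ψ Y) : φ = ψ := by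
  refine Polynomial.ringHom_ext' (Polynomial.ringHom_ext' (RingHom.ext fun a => ?_) ?_) h₃
  · exact h₁ a
  · exact h₂

/-- The coefficients have degree less than `b`, so they occupy disjoint blocks, as digits to base
`b` do. -/
theorem coeff_subst_X_pow {b : ℕ} {Q : F[X][Y]} (hQ : ∀ j, (Q.coeff j).natDegree < b) {i j : ℕ}
    (hi : i < b) : (subst X (X ^ b) Q).coeff (i + b * j) = (Q.coeff j).coeff i := by
  have h1 : subst X (X ^ b) Q = ∑ k ∈ Finset.range (max Q.natDegree j + 1),
      Q.coeff k * X ^ (b * k) := by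
    rw [subst, coe_eval₂RingHom, eval₂_eq_sum_range' _ (n := max Q.natDegree j + 1) (by omega)]
    refine Finset.sum_congr rfl fun k _ => ?_
    rw [coe_eval₂RingHom, eval₂_C_X, pow_mul]
  rw [h1, finsetSum_coeff, Finset.sum_eq_single j]
  · rw [coeff_mul_X_pow]
  · intro k _ hkj
    rw [coeff_mul_X_pow']
    split
    · rename_i h
      have : k < j := by
        rcases lt_or_gt_of_ne hkj with h' | h'
        · exact h'
        · nlinarith
      refine coeff_eq_zero_of_natDegree_lt ((hQ k).trans_le ?_)
      have : b * (k + 1) ≤ b * j := by gcongr; omega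
      rw [mul_add] at this
      omega
    · rfl
  · intro h; simp at h

theorem subst_swap (x y : F[X]) (Q : F[X][Y]) : subst x y (Bivariate.swap Q) = subst y x Q := by
  have : (subst x y).comp (Bivariate.swap (R := F) : F[X][Y] →+* F[X][Y]) = subst y x := by
    apply ringHom_ext
    · intro a; simp [subst, Bivariate.swap_C_C]
    · simp [subst, Bivariate.swap_X]
    · simp [subst, Bivariate.swap_Y]
  exact congrArg (fun φ => φ Q) this

theorem coeff_subst_pow_X {L : ℕ} {Q : F[X][Y]} (hQ : Q.natDegree < L) {i j : ℕ} (hj : j < L) :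
    (subst (X ^ L) X Q).coeff (j + L * i) = (Q.coeff j).coeff i := by
  rw [← subst_swap, coeff_subst_X_pow _ hj, coeff_coeff_swap]
  intro i
  refine lt_of_le_of_lt ?_ hQ
  rw [natDegree_le_iff_coeff_eq_zero]
  intro j hj
  rw [coeff_coeff_swap, coeff_eq_zero_of_natDegree_lt hj, coeff_zero]

/-- When the degree in `Y` is less than `L`, the block of length `L` with number `i` holds the
coefficient of `X ^ i`. Vanishing modulo `X ^ N` thus means that the first `N` blocks vanish, and
truncated arithmetic in one variable suffices. -/
theorem X_pow_dvd_subst_iff {L N : ℕ} {S : F[X][Y]} (hS : S.natDegree < L) :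
    X ^ (N * L) ∣ subst (X ^ L) X S ↔ C X ^ N ∣ S := by
  have hL : 0 < L := by omega
  rw [X_pow_dvd_iff, C_X_pow_dvd_iff]
  constructor
  · intro h j i hi
    by_cases hj : j < L
    · rw [← coeff_subst_pow_X hS hj]
      apply h
      have : L * (i + 1) ≤ L * N := by gcongr; omega
      rw [mul_comm N]
      rw [mul_add] at this
      omega
    · rw [coeff_eq_zero_of_natDegree_lt (p := S) (by omega), coeff_zero]
  · intro h k hk
    have := coeff_subst_pow_X hS (Nat.mod_lt k hL) (i := k / L)
    rw [Nat.mod_add_div] at this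
    rw [this]
    exact h _ _ (Nat.div_lt_of_lt_mul (by rwa [mul_comm L]))

/-- The polynomial in two variables with the same coefficients, chunks of length `b` giving the
coefficients of the powers of `Y`. -/
noncomputable def unpack (b : ℕ) : F[X] →ₗ[F] F[X][Y] :=
  Polynomial.lsum fun k => LinearMap.toSpanSingleton F F[X][Y] (C (X ^ (k % b)) * Y ^ (k / b))

theorem unpack_X_pow (b k : ℕ) : unpack (F := F) b (X ^ k) = C (X ^ (k % b)) * Y ^ (k / b) := by
  rw [← monomial_one_right_eq_X_pow, unpack, lsum_apply, sum_monomial_index] <;> simp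

theorem coeff_coeff_unpack {b : ℕ} (hb : 0 < b) (h : F[X]) (i j : ℕ) :
    ((unpack b h).coeff j).coeff i = if i < b then h.coeff (i + b * j) else 0 := by
  induction h using Polynomial.induction_on' with
  | add p q hp hq => simp only [map_add, coeff_add, hp, hq]; split <;> simp
  | monomial k a =>
    have h1 : (monomial k a : F[X]) = a • X ^ k := by rw [smul_eq_C_mul, C_mul_X_pow_eq_monomial]
    rw [h1, map_smul, unpack_X_pow]
    simp only [coeff_smul, coeff_C_mul, coeff_X_pow, smul_eq_mul]
    by_cases hi : i < b
    · have : i + b * j = k ↔ j = k / b ∧ i = k % b := by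
        constructor
        · rintro rfl
          rw [Nat.add_mul_div_left _ _ hb, Nat.add_mul_mod_self_left, Nat.mod_eq_of_lt hi,
            Nat.div_eq_of_lt hi]
          simp
        · rintro ⟨rfl, rfl⟩; exact Nat.mod_add_div k b
      by_cases h2 : j = k / b <;> by_cases h3 : i = k % b <;> simp [h2, h3, hi, this] <;>
        simp_all
    · rw [if_neg hi]
      have : i ≠ k % b := fun h => hi (h ▸ Nat.mod_lt k hb)
      by_cases h2 : j = k / b <;> simp [h2, this, coeff_X_pow]

theorem natDegree_coeff_unpack {b : ℕ} (hb : 0 < b) (h : F[X]) (j : ℕ) :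
    ((unpack b h).coeff j).natDegree < b := by
  rw [← Nat.le_sub_one_iff_lt hb, natDegree_le_iff_coeff_eq_zero]
  intro i hi
  rw [coeff_coeff_unpack hb, if_neg (by omega)]

theorem natDegree_unpack_lt {b s : ℕ} (hb : 0 < b) (hs : 0 < s) {h : F[X]}
    (hh : h.degree < (b * s : ℕ)) : (unpack b h).natDegree < s := by
  rw [← Nat.le_sub_one_iff_lt hs, natDegree_le_iff_coeff_eq_zero]
  intro j hj
  ext i
  rw [coeff_coeff_unpack hb, coeff_zero]
  split
  · refine coeff_eq_zero_of_degree_lt (hh.trans_le ?_)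
    have : b * s ≤ b * j := by gcongr; omega
    exact_mod_cast this.trans (by omega)
  · rfl

theorem small_unpack {n : ℕ} (hn : 0 < n) {h : F[X]} (hh : h.degree < (n * n : ℕ)) :
    Small n (unpack n h) :=
  small_of_coeff (natDegree_unpack_lt hn hn hh) (natDegree_coeff_unpack hn h)

theorem subst_unpack {b : ℕ} (hb : 0 < b) (h : F[X]) : subst X (X ^ b) (unpack b h) = h := by
  ext k
  have := coeff_subst_X_pow (natDegree_coeff_unpack hb h) (Nat.mod_lt k hb) (j := k / b)
  rwa [coeff_coeff_unpack hb, if_pos (Nat.mod_lt k hb), Nat.mod_add_div] at this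

theorem unpack_subst {b : ℕ} (hb : 0 < b) {Q : F[X][Y]} (hQ : ∀ j, (Q.coeff j).natDegree < b) :
    unpack b (subst X (X ^ b) Q) = Q := by
  ext j i
  rw [coeff_coeff_unpack hb]
  split
  · rename_i hi; exact coeff_subst_X_pow hQ hi
  · exact (coeff_eq_zero_of_natDegree_lt ((hQ j).trans_le (by omega))).symm

theorem unpack_eq_zero {b : ℕ} (hb : 0 < b) {h : F[X]} (hh : unpack b h = 0) : h = 0 := by
  rw [← subst_unpack hb h, hh, map_zero]

theorem Small.degree_subst_lt {n : ℕ} {Q : F[X][Y]} (hQ : Small n Q) :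
    (subst X (X ^ n) Q).degree < (n * n : ℕ) := by
  have hn : 0 < n := by have := hQ.1; omega
  rw [degree_lt_iff_coeff_zero]
  intro k hk
  have := coeff_subst_X_pow hQ.coeff_natDegree (Nat.mod_lt k hn) (j := k / n)
  rw [Nat.mod_add_div] at this
  rw [this, coeff_eq_zero_of_natDegree_lt (p := Q), coeff_zero]
  exact hQ.1.trans_le ((Nat.le_div_iff_mul_le hn).2 hk)

/-- Every polynomial agrees modulo a power of `X` with a packed one. -/
theorem exists_unpack_modEq {N s : ℕ} (hN : 0 < N) {H : F[X][Y]} (hH : H.natDegree < s) :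
    ∃ h : F[X], h.degree < (N * s : ℕ) ∧ C X ^ N ∣ H - unpack N h := by
  refine ⟨∑ k ∈ Finset.range (N * s), C ((H.coeff (k / N)).coeff (k % N)) * X ^ k, ?_, ?_⟩
  · rw [degree_lt_iff_coeff_zero]
    intro k hk
    simp only [finsetSum_coeff, coeff_C_mul, coeff_X_pow]
    refine Finset.sum_eq_zero fun x hx => ?_
    rw [Finset.mem_range] at hx
    simp [show k ≠ x by omega]
  · rw [C_X_pow_dvd_iff]
    intro j i hi
    rw [coeff_sub, coeff_sub, coeff_coeff_unpack hN, if_pos hi, sub_eq_zero]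
    simp only [finsetSum_coeff, coeff_C_mul, coeff_X_pow, mul_ite, mul_one, mul_zero]
    rw [Finset.sum_ite_eq]
    rw [Nat.add_mul_div_left _ _ hN, Nat.add_mul_mod_self_left, Nat.mod_eq_of_lt hi,
            Nat.div_eq_of_lt hi, zero_add]
    split
    · rfl
    · rename_i h
      rw [Finset.mem_range, not_lt] at h
      rw [coeff_eq_zero_of_natDegree_lt (p := H), coeff_zero]
      refine hH.trans_le ?_
      by_contra hlt
      have : N * (j + 1) ≤ N * s := by gcongr; omega
      rw [mul_add] at this
      omega

end pack
end BivariateSplit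

/-! ### Translation of the point to the origin. -/

namespace BivariateSplit

section shift
variable {F : Type*} [Field F]

/-- The substitution `X ↦ X + α`, `Y ↦ Y + β`. -/
noncomputable def shift (α β : F) : F[X][Y] ≃+* F[X][Y] :=
  (mapEquiv (taylorEquiv α).toRingEquiv).trans (taylorEquiv (C β)).toRingEquiv

theorem shift_apply (α β : F) (Q : F[X][Y]) :
    shift α β Q = taylor (C β) (Q.map (taylorEquiv α : F[X] →+* F[X])) := rfl

theorem shift_C_C (α β a : F) : shift α β (C (C a)) = C (C a) := by
  simp only [shift_apply, map_C, taylor_C]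
  exact congrArg C ((taylorEquiv α).commutes a)

theorem shift_C_X (α β : F) : shift α β (C X) = C (X + C α) := by
  simp only [shift_apply, map_C, taylor_C]
  exact congrArg C (taylor_X α)

theorem shift_Y (α β : F) : shift α β Y = Y + C (C β) := by
  simp [shift_apply, taylor_X]

theorem subst_shift (L : ℕ) (α β : F) (Q : F[X][Y]) :
    subst (X ^ L) X (shift α β Q) = subst (X ^ L + C α) (X + C β) Q := by
  have : (subst (X ^ L) X).comp (shift α β : F[X][Y] →+* F[X][Y]) =
      subst (X ^ L + C α) (X + C β) := by
    apply ringHom_ext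
    · intro a; simp [shift_C_C, subst_C_C]
    · simp [shift_C_X, subst_C_X, subst_C_C]
    · simp [shift_Y, subst_Y, subst_C_C]
  exact congrArg (fun φ => φ Q) this

theorem swap_shift (α β : F) (Q : F[X][Y]) :
    Bivariate.swap (shift α β Q) = shift β α (Bivariate.swap Q) := by
  have : (Bivariate.swap (R := F) : F[X][Y] →+* F[X][Y]).comp
      (shift α β : F[X][Y] →+* F[X][Y]) =
      (shift β α : F[X][Y] →+* F[X][Y]).comp (Bivariate.swap (R := F) : F[X][Y] →+* F[X][Y]) := by
    apply ringHom_ext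
    · intro a; simp [shift_C_C, Bivariate.swap_C_C]
    · simp [shift_C_X, shift_Y, Bivariate.swap_C_C, Bivariate.swap_X]
    · simp [shift_C_X, shift_Y, Bivariate.swap_C_C, Bivariate.swap_Y]
  exact congrArg (fun φ => φ Q) this

theorem natDegree_shift (α β : F) (Q : F[X][Y]) : (shift α β Q).natDegree = Q.natDegree := by
  rw [shift_apply, natDegree_taylor]
  exact natDegree_map_eq_of_injective (taylorEquiv α).injective _

theorem Small.shift {n : ℕ} {Q : F[X][Y]} (h : Small n Q) (α β : F) : Small n (shift α β Q) := by
  rw [Small, swap_shift, natDegree_shift, natDegree_shift]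
  exact h

theorem restrict_shift (α β : F) (Q : F[X][Y]) :
    restrict 0 (shift α β Q) = (restrict α Q).comp (X + C β) := by
  have : (mapRingHom (evalRingHom (0 : F))).comp (shift α β : F[X][Y] →+* F[X][Y]) =
      (compRingHom (X + C β)).comp (mapRingHom (evalRingHom α)) := by
    apply ringHom_ext
    · intro a; simp [shift_C_C]
    · simp [shift_C_X]
    · simp [shift_Y]
  exact congrArg (fun φ => φ Q) this

end shift

/-! ### Relations between rows -/

section rows
variable {F : Type*} [Field F]

theorem mem_span_map_range {Λ : F[X] →ₗ[F] F[X] × F[X]} {k : ℕ} {v : F[X] × F[X]} :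
    v ∈ Submodule.span F {x | x ∈ (List.range k).map fun i => Λ (X ^ i)} ↔
      ∃ h : F[X], h.degree < k ∧ Λ h = v := by
  classical
  have h1 : {x | x ∈ (List.range k).map fun i => Λ (X ^ i)} =
      Λ '' ((Finset.range k).image fun i => (X : F[X]) ^ i) := by
    ext x; simp
  rw [h1, ← Submodule.map_span, ← degreeLT_eq_span_X_pow]
  simp [Submodule.mem_map, mem_degreeLT]

theorem split_append_map_range {γ : Type*} {A l₁ l₂ : List γ} {q : γ} {f : ℕ → γ} {s : ℕ}
    (h : A ++ (List.range s).map f = l₁ ++ q :: l₂) :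
    (∃ l', A = l₁ ++ q :: l') ∨ ∃ k < s, l₁ = A ++ (List.range k).map f ∧ q = f k := by
  have key : ∀ B : List γ, (List.range s).map f = B ++ q :: l₂ →
      ∃ k < s, B = (List.range k).map f ∧ q = f k := by
    intro B hB
    have hlen := congrArg List.length hB
    simp only [List.length_map, List.length_range, List.length_append, List.length_cons] at hlen
    refine ⟨B.length, by omega, ?_, ?_⟩
    · have := congrArg (List.take B.length) hB
      rw [List.take_left', ← List.map_take, List.take_range, min_eq_left (by omega)] at this
      · exact this.symm
      · rfl
    · have := congrArg (fun l => l[B.length]?) hB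
      simp only [List.getElem?_map, List.getElem?_range (show B.length < s by omega)] at this
      simpa using this.symm
  rcases List.append_eq_append_iff.1 h with ⟨as, rfl, h2⟩ | ⟨bs, rfl, h2⟩
  · obtain ⟨k, hk, rfl, rfl⟩ := key as h2
    exact Or.inr ⟨k, hk, rfl, rfl⟩
  · rcases bs with _ | ⟨b, bs⟩
    · obtain ⟨k, hk, h3, rfl⟩ := key [] (by simpa using h2.symm)
      rw [List.append_nil]
      exact Or.inr ⟨k, hk, by rw [← h3, List.append_nil], rfl⟩
    · simp only [List.cons_append, List.cons.injEq] at h2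
      exact Or.inl ⟨bs, by rw [h2.1]⟩

theorem span_append (A B : List (F[X] × F[X])) : Submodule.span F {x | x ∈ A ++ B} =
    Submodule.span F {x | x ∈ A} ⊔ Submodule.span F {x | x ∈ B} := by
  rw [← Submodule.span_union]
  congr 1
  ext x; simp

/-- A dependency of the row of `X ^ k` on the preceding ones is a relation given by a polynomial `X
^ k + f` with `f` of smaller degree, in particular by a nonzero one. -/
theorem noDep_append_map_range {m s : ℕ} {A : List (F[X] × F[X])} (hA : NoDep m A)
    {Λ : F[X] →ₗ[F] F[X] × F[X]}
    (h : ∀ f : F[X], f ≠ 0 → f.degree < s → ∀ v ∈ Submodule.span F {x | x ∈ A},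
      ¬X ^ m ∣ (v + Λ f).1) :
    NoDep m (A ++ (List.range s).map fun i => Λ (X ^ i)) := by
  intro l₁ q l₂ hl g hg hX
  rcases split_append_map_range hl with ⟨l', hl'⟩ | ⟨k, hk, rfl, rfl⟩
  · exact hA l₁ q l' hl' g hg hX
  · rw [span_append, Submodule.mem_sup] at hg
    obtain ⟨v, hv, w, hw, rfl⟩ := hg
    obtain ⟨f, hf, rfl⟩ := mem_span_map_range.1 hw
    have hd : (X ^ k + f : F[X]).degree = k := by
      rw [degree_add_eq_left_of_degree_lt] <;> rw [degree_X_pow]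
      exact hf
    refine h (X ^ k + f) ?_ ?_ v hv ?_
    · rintro h0; rw [h0] at hd; simp at hd
    · rw [hd]; exact_mod_cast hk
    · rw [map_add]; convert hX using 2; abel

theorem noDep_nil (m : ℕ) : NoDep m ([] : List (F[X] × F[X])) := by
  intro l₁ q l₂ h; simp at h

theorem noDep_map_range {m s : ℕ} {Λ : F[X] →ₗ[F] F[X] × F[X]}
    (h : ∀ f : F[X], f ≠ 0 → f.degree < s → ¬X ^ m ∣ (Λ f).1) :
    NoDep m ((List.range s).map fun i => Λ (X ^ i)) := by
  refine noDep_append_map_range (noDep_nil m) fun f h0 hf v hv => ?_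
  have : v = 0 := by simpa using hv
  rw [this, zero_add]
  exact h f h0 hf

/-- After division by the leading coefficient of `f`, the relation expresses the row of `X ^
(natDegree f)` by the preceding rows. A relation is thus detected at the degree of its polynomial.
-/
theorem not_noDep {m s : ℕ} {A : List (F[X] × F[X])} {Λ : F[X] →ₗ[F] F[X] × F[X]} {f : F[X]}
    (h0 : f ≠ 0) (hf : f.degree < s) {v : F[X] × F[X]}
    (hv : v ∈ Submodule.span F {x | x ∈ A}) (hX : X ^ m ∣ (v + Λ f).1) :
    ¬NoDep m (A ++ (List.range s).map fun i => Λ (X ^ i)) := by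
  intro h
  rw [degree_eq_natDegree h0] at hf
  have hk : f.natDegree < s := by exact_mod_cast hf
  have hc : f.leadingCoeff ≠ 0 := leadingCoeff_ne_zero.2 h0
  obtain ⟨t, ht⟩ := Nat.exists_eq_add_of_lt hk
  have h1 : (List.range s).map (fun i => Λ (X ^ i)) = (List.range f.natDegree).map
      (fun i => Λ (X ^ i)) ++ Λ (X ^ f.natDegree) ::
        (List.range t).map fun i => Λ (X ^ (f.natDegree + (i + 1))) := by
    rw [ht, add_assoc, List.range_add, List.map_append, List.range_succ_eq_map]
    simp [Function.comp_def]
  refine h (A ++ (List.range f.natDegree).map fun i => Λ (X ^ i)) (Λ (X ^ f.natDegree)) _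
    (by rw [h1, List.append_assoc]) (f.leadingCoeff⁻¹ • (v + Λ f.eraseLead)) ?_ ?_
  · refine Submodule.smul_mem _ _ ?_
    rw [span_append]
    refine Submodule.add_mem_sup hv (mem_span_map_range.2 ⟨_, ?_, rfl⟩)
    rw [← degree_eq_natDegree h0]
    exact degree_eraseLead_lt h0
  · have h2 : v + Λ f = f.leadingCoeff • (Λ (X ^ f.natDegree) +
        f.leadingCoeff⁻¹ • (v + Λ f.eraseLead)) := by
      rw [smul_add, smul_smul, mul_inv_cancel₀ hc, one_smul, ← map_smul]
      nth_rewrite 1 [← eraseLead_add_C_mul_X_pow f]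
      rw [map_add, smul_eq_C_mul]
      abel
    rw [h2, Prod.smul_fst, smul_eq_C_mul] at hX
    exact ((isUnit_C.2 (IsUnit.mk0 _ hc)).dvd_mul_left).1 hX

/-- The relation of least degree. -/
theorem firstDep_append_map_range {m s s' : ℕ} (hs' : 0 < s') {A : List (F[X] × F[X])}
    (hA : NoDep m A) {Λ : F[X] →ₗ[F] F[X] × F[X]} {f : F[X]} (h0 : f ≠ 0) (hf : f.degree < s)
    {v : F[X] × F[X]} (hv : v ∈ Submodule.span F {x | x ∈ A}) (hX : X ^ m ∣ (v + Λ f).1) :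
    ∃ h : F[X], h ≠ 0 ∧ h.degree ≤ f.degree ∧ ∃ w ∈ Submodule.span F {x | x ∈ A},
      X ^ m ∣ (w + Λ h).1 ∧ firstDep m ((A ++ (List.range s).map fun i => Λ (X ^ i)).map
        (row m s')) = vec s' (w + Λ h).2 := by
  obtain ⟨l₁, q, l₂, hl, hno, a, ha, g, hg, hX', hr⟩ := firstDep_spec hs' (not_noDep h0 hf hv hX)
  rcases split_append_map_range hl with ⟨l', hl'⟩ | ⟨k, hk, rfl, rfl⟩
  · refine absurd ?_ (hA l₁ q l' hl' (a⁻¹ • g) (Submodule.smul_mem _ _ hg))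
    have : a • q + g = a • (q + a⁻¹ • g) := by
      rw [smul_add, smul_smul, mul_inv_cancel₀ ha, one_smul]
    rw [this, Prod.smul_fst, smul_eq_C_mul] at hX'
    exact ((isUnit_C.2 (IsUnit.mk0 _ ha)).dvd_mul_left).1 hX'
  · rw [span_append, Submodule.mem_sup] at hg
    obtain ⟨w, hw, z, hz, rfl⟩ := hg
    obtain ⟨f', hf', rfl⟩ := mem_span_map_range.1 hz
    have hd0 : (a • X ^ k : F[X]).degree = k := by
      rw [smul_eq_C_mul, degree_C_mul_X_pow k ha]
    have hd : (a • X ^ k + f' : F[X]).degree = k := by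
      rw [degree_add_eq_left_of_degree_lt] <;> rw [hd0]
      exact hf'
    have he : a • Λ (X ^ k) + (w + Λ f') = w + Λ (a • X ^ k + f') := by
      rw [map_add, map_smul]; abel
    rw [he] at hX' hr
    refine ⟨a • X ^ k + f', ?_, ?_, w, hw, hX', hr⟩
    · rintro h0; rw [h0] at hd; simp at hd
    · rw [hd]
      -- If `f` had smaller degree than the relation found, its own relation would already occur
      -- among the rows `l₁`, which are free of dependencies.
      by_contra hlt
      exact not_noDep h0 (not_le.1 hlt) hv hX hno

theorem firstDep_append_singleton {m s : ℕ} (hs : 0 < s) {A : List (F[X] × F[X])}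
    (hA : NoDep m A) {q v : F[X] × F[X]} (hv : v ∈ Submodule.span F {x | x ∈ A})
    (hX : X ^ m ∣ (q + v).1) :
    ∃ a : F, a ≠ 0 ∧ ∃ w ∈ Submodule.span F {x | x ∈ A}, X ^ m ∣ (a • q + w).1 ∧
      firstDep m ((A ++ [q]).map (row m s)) = vec s (a • q + w).2 := by
  obtain ⟨l₁, q', l₂, hl, hno, a, ha, g, hg, hX', hr⟩ :=
    firstDep_spec hs (fun h => h A q [] rfl v hv hX)
  rcases l₂.eq_nil_or_concat with rfl | ⟨l₂, z, rfl⟩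
  · obtain ⟨rfl, h2⟩ := List.append_inj' hl rfl
    obtain rfl : q = q' := by simpa using h2
    exact ⟨a, ha, g, hg, hX', hr⟩
  · rw [show l₁ ++ q' :: (l₂.concat z) = (l₁ ++ q' :: l₂) ++ [z] by simp] at hl
    obtain ⟨h2, -⟩ := List.append_inj' hl rfl
    refine absurd ?_ (hA l₁ q' l₂ h2 (a⁻¹ • g) (Submodule.smul_mem _ _ hg))
    have : a • q' + g = a • (q' + a⁻¹ • g) := by
      rw [smul_add, smul_smul, mul_inv_cancel₀ ha, one_smul]
    rw [this, Prod.smul_fst, smul_eq_C_mul] at hX'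
    exact ((isUnit_C.2 (IsUnit.mk0 _ ha)).dvd_mul_left).1 hX'

end rows
end BivariateSplit

/-! ### Separation of factors by the first linear relation. -/

namespace BivariateSplit

section separation
variable {F : Type*} [Field F]

/-- The row that belongs to a packed polynomial. -/
noncomputable def rowMap (f x y : F[X]) (b : ℕ) (t : F[X] →ₗ[F] F[X]) :
    F[X] →ₗ[F] F[X] × F[X] :=
  LinearMap.prod (LinearMap.mulLeft F f ∘ₗ substₗ x y ∘ₗ unpack b) t

theorem rowMap_apply (f x y : F[X]) (b : ℕ) (t : F[X] →ₗ[F] F[X]) (h : F[X]) :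
    rowMap f x y b t h = (f * subst x y (unpack b h), t h) := rfl

theorem rowMap_X_pow (f x y : F[X]) (b : ℕ) (t : F[X] →ₗ[F] F[X]) (k : ℕ) :
    rowMap f x y b t (X ^ k) = (f * (x ^ (k % b) * y ^ (k / b)), t (X ^ k)) := by
  rw [rowMap_apply, unpack_X_pow, C_pow, map_mul, map_pow, map_pow, subst_C_X, subst_Y]

/-- Precision in `X` for polynomials with both degrees less than `n`. -/
def prec (n : ℕ) : ℕ := 2 * n * n

/-- Bound for the degree of the cofactor. -/
def cofDeg (n : ℕ) : ℕ := prec n * (n * n + n) + 1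

/-- The exponent by which `X` is replaced. -/
def width (n : ℕ) : ℕ := cofDeg n + n

/-- The rows whose first relation gives the part of a polynomial that is prime to `g`
at `X = α`. -/
noncomputable def sepRows (n : ℕ) (α β : F) (f g : F[X]) : List (F[X] × F[X]) :=
  ((List.range (prec n * cofDeg n)).map fun k =>
    rowMap f (X ^ width n) X (prec n) 0 (X ^ k)) ++
  (List.range (n * n)).map fun k =>
    rowMap (g ^ (n * prec n)) (X ^ width n + C α) (X + C β) n LinearMap.id (X ^ k)

/-- The rows whose first relation gives the quotient. -/
noncomputable def quotRows (n : ℕ) (α β : F) (f w : F[X]) : List (F[X] × F[X]) :=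
  ((List.range (n * n)).map fun k =>
    rowMap w (X ^ width n + C α) (X + C β) n LinearMap.id (X ^ k)) ++ [(f, 0)]

theorem subst_map_C (x : F[X]) (g : F[X]) : subst x X (g.map C) = g := by
  rw [subst, coe_eval₂RingHom, eval₂_map]
  have : (eval₂RingHom C x).comp (C : F →+* F[X]) = C := by ext1; simp
  rw [this, eval₂_C_X]

/-- Packing is multiplicative, so packed degrees add. The cofactor `Q / W` therefore packs to a
constant and, being small, is a constant itself. -/
theorem dvd_of_subst_X_pow_dvd {n : ℕ} {W Q : F[X][Y]} (hn : 0 < n) (hW : W ≠ 0)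
    (hQ : Small n Q) (hQ0 : Q ≠ 0) (hd : W ∣ Q)
    (hdeg : (subst X (X ^ n) Q).degree ≤ (subst X (X ^ n) W).degree) :
    ∃ c : F, c ≠ 0 ∧ Q = C (C c) * W := by
  obtain ⟨U, rfl⟩ := hd
  have hU0 : U ≠ 0 := right_ne_zero_of_mul hQ0
  have hU : Small n U := hQ.of_dvd hQ0 (dvd_mul_left _ _)
  have hW' : Small n W := hQ.of_dvd hQ0 (dvd_mul_right _ _)
  have hk : ∀ {V : F[X][Y]}, Small n V → V ≠ 0 → subst X (X ^ n) V ≠ 0 := by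
    intro V hV hV0 h
    rw [← unpack_subst hn hV.coeff_natDegree, h, map_zero] at hV0
    exact hV0 rfl
  rw [map_mul, degree_mul] at hdeg
  have hUd : (subst X (X ^ n) U).degree ≤ 0 := by
    rw [degree_eq_natDegree (hk hW' hW), degree_eq_natDegree (hk hU hU0)] at hdeg
    have : (subst X (X ^ n) W).natDegree + (subst X (X ^ n) U).natDegree ≤
      (subst X (X ^ n) W).natDegree := by exact_mod_cast hdeg
    rw [degree_eq_natDegree (hk hU hU0)]
    exact_mod_cast (by omega : (subst X (X ^ n) U).natDegree ≤ 0)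
  have hUc := eq_C_of_degree_le_zero hUd
  have : U = C (C ((subst X (X ^ n) U).coeff 0)) := by
    rw [← unpack_subst hn (Q := C (C ((subst X (X ^ n) U).coeff 0))), subst_C_C, ← hUc,
      unpack_subst hn hU.coeff_natDegree]
    intro j; rw [coeff_C]; split <;> simp [hn]
  refine ⟨_, ?_, by rw [mul_comm, ← this]⟩
  intro h0
  rw [h0] at this
  exact hU0 (by simpa using this)

/-- A relation among the rows is a pair `(U, V)` with `P * U + G * V ≡ 0` modulo `X ^ N` after
translation. The rows for `U` come before those for `V` and carry no second part, so the first
relation minimizes the packed degree of `V` and its second part lists the coefficients of `V`. Such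
`V` are multiples of `W` by `dvd_of_modEq`, and `W` is one of them by `exists_inverse`. -/
theorem firstDep_sepRows {n : ℕ} {α β : F} {T W : F[X][Y]} {g : F[X]} (hP : Small n (T * W))
    (hX : ¬C X ∣ shift α β (T * W)) (hT : restrict 0 (shift α β T) ∣ g ^ n)
    (hW : ∀ q, Irreducible q → q ∣ W → ∀ M, ¬restrict 0 (shift α β q) ∣ g ^ M)
    (hg : g.natDegree < n) (hg0 : g ≠ 0) :
    ∃ c : F, c ≠ 0 ∧ firstDep (prec n * width n) ((sepRows n α β
      (subst (X ^ width n + C α) (X + C β) (T * W)) g).map (row (prec n * width n) (n * n))) =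
      vec (n * n) (subst X (X ^ n) (C (C c) * W)) := by
  have hn : 0 < n := by have := hP.1; omega
  have hnn : 0 < n * n := Nat.mul_pos hn hn
  have hN : 0 < prec n := by simp only [prec]; positivity
  have hP0 : T * W ≠ 0 := by rintro h0; rw [h0, map_zero] at hX; exact hX (dvd_zero _)
  have hT0 : T ≠ 0 := left_ne_zero_of_mul hP0
  have hW0 : W ≠ 0 := right_ne_zero_of_mul hP0
  have hWs : Small n W := hP.of_dvd hP0 (dvd_mul_left _ _)
  have hTs : Small n T := hP.of_dvd hP0 (dvd_mul_right _ _)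
  set σ := shift α β with hσ
  set L := width n with hL
  set N := prec n with hNd
  set G : F[X][Y] := (g ^ (n * N)).map C with hG
  set P := T * W with hPd
  clear_value P
  have hGdeg : G.natDegree ≤ N * (n * n) := by
    refine natDegree_map_le.trans (natDegree_pow_le.trans ?_)
    calc n * N * g.natDegree ≤ n * N * n := by gcongr
      _ = N * (n * n) := by ring
  -- the first components, in terms of bivariate polynomials
  set A := (List.range (N * cofDeg n)).map fun k =>
    rowMap (subst (X ^ L + C α) (X + C β) P) (X ^ L) X N 0 (X ^ k) with hA
  have hval : ∀ u h : F[X],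
      (rowMap (subst (X ^ L + C α) (X + C β) P) (X ^ L) X N 0 u +
        rowMap (g ^ (n * N)) (X ^ L + C α) (X + C β) n LinearMap.id h) =
      (subst (X ^ L) X (σ P * unpack N u + G * σ (unpack n h)), h) := by
    intro u h
    rw [rowMap_apply, rowMap_apply, map_add, map_mul, map_mul, hσ, subst_shift, subst_shift, hG,
      subst_map_C]
    simp
  -- The width is chosen for this: with degree in `Y` below `L`, the substitution loses no
  -- information.
  have hdeg : ∀ u h : F[X], u.degree < (N * cofDeg n : ℕ) → h.degree < (n * n : ℕ) →
      (σ P * unpack N u + G * σ (unpack n h)).natDegree < L := by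
    intro u h hu hh
    have h1 := natDegree_unpack_lt hN (by simp [cofDeg]) hu
    have h2 := (small_unpack hn hh).1
    have h3 := hP.1
    refine (natDegree_add_le _ _).trans_lt (max_lt ?_ ?_)
    · refine natDegree_mul_le.trans_lt ?_
      rw [hσ, natDegree_shift, hL, width]; omega
    · refine natDegree_mul_le.trans_lt ?_
      rw [hσ, natDegree_shift, hL, width, cofDeg, ← hNd, mul_add]; omega
  have hspan : ∀ v, v ∈ Submodule.span F {x | x ∈ A} ↔ ∃ u : F[X], u.degree < (N * cofDeg n : ℕ) ∧
      rowMap (subst (X ^ L + C α) (X + C β) P) (X ^ L) X N 0 u = v := fun v =>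
    mem_span_map_range
  -- A relation among the rows for `U` alone would say `P * U ≡ 0` modulo `X ^ N`; as `P` is prime
  -- to `X` after translation and `U` has degree less than `N` in `X`, this forces `U = 0`.
  have hAdep : NoDep (N * L) A := by
    refine noDep_map_range fun u hu0 hu hdvd => ?_
    have h1 := hval u 0
    rw [map_zero, add_zero, map_zero, map_zero, mul_zero, add_zero] at h1
    rw [h1] at hdvd
    have h2 := hdeg u 0 hu (by rw [degree_zero]; exact WithBot.bot_lt_coe _)
    rw [map_zero, map_zero, mul_zero, add_zero] at h2
    have h3 := (X_pow_dvd_subst_iff h2).1 hdvd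
    have h4 := prime_C_X.pow_dvd_of_dvd_mul_left N hX h3
    refine hu0 (unpack_eq_zero hN ?_)
    ext j i
    rw [coeff_zero, coeff_zero]
    by_cases hi : i < N
    · exact C_X_pow_dvd_iff.1 h4 j i hi
    · exact coeff_eq_zero_of_natDegree_lt ((natDegree_coeff_unpack hN u j).trans_le (not_lt.1 hi))
  -- the relation given by `W`
  obtain ⟨H, hHdeg, hH⟩ := exists_inverse N (T := σ T) (g := g) hT (hTs.shift α β).1 hg hg0
  obtain ⟨u, hu, huH⟩ := exists_unpack_modEq (N := N) (s := cofDeg n) hN (H := H)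
    (by rw [cofDeg, ← hNd]; omega)
  have hκW : subst X (X ^ n) W ≠ 0 := by
    intro h
    rw [← unpack_subst hn hWs.coeff_natDegree, h, map_zero] at hW0
    exact hW0 rfl
  -- With `T * H ≡ G` and `U ≡ H` one has `P * U ≡ T * W * H ≡ G * W` after translation, so `(-U,
  -- W)` is a relation.
  have hrel : X ^ (N * L) ∣ (rowMap (subst (X ^ L + C α) (X + C β) P) (X ^ L) X N 0 (-u) +
      rowMap (g ^ (n * N)) (X ^ L + C α) (X + C β) n LinearMap.id (subst X (X ^ n) W)).1 := by
    rw [hval]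
    refine (X_pow_dvd_subst_iff (hdeg _ _ (by rwa [degree_neg]) hWs.degree_subst_lt)).2 ?_
    rw [unpack_subst hn hWs.coeff_natDegree]
    have : σ P * unpack N (-u) + G * σ W = σ W * (G - σ T * H) + σ P * (H - unpack N u) := by
      rw [map_neg, hPd, map_mul]; ring
    rw [this]
    exact dvd_add (hH.mul_left _) (huH.mul_left _)
  obtain ⟨h, hh0, hhd, w, hw, hhX, hres⟩ := firstDep_append_map_range (s' := n * n) hnn hAdep hκW
    hWs.degree_subst_lt ((hspan _).2 ⟨-u, by rwa [degree_neg], rfl⟩) hrel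
  obtain ⟨u', hu', rfl⟩ := (hspan _).1 hw
  rw [hval] at hhX hres
  have hhdeg := hhd.trans_lt hWs.degree_subst_lt
  have hdvd := (X_pow_dvd_subst_iff (hdeg _ _ hu' hhdeg)).1 hhX
  have hQs := small_unpack hn hhdeg
  have hσd : σ W ∣ σ (unpack n h) := by
    refine dvd_of_modEq (n := n) (N := N) (G := g ^ (n * N)) (R := -(σ T * unpack N u')) le_rfl ?_
      (hWs.shift α β) ?_ (hQs.shift α β) ?_
    · exact (map_ne_zero_iff σ σ.injective).2 hW0
    · intro q hq hqW
      have hq' : σ (σ.symm q) = q := σ.apply_symm_apply q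
      refine ⟨fun hXq => hX ((hXq.trans hqW).trans ?_), ?_⟩
      · rw [hPd, map_mul]; exact dvd_mul_left _ _
      · rw [← hq']
        refine hW _ ?_ ?_ _
        · exact (MulEquiv.irreducible_iff σ.symm.toMulEquiv).2 hq
        · rw [← map_dvd_iff σ, hq']; exact hqW
    · convert hdvd using 1
      rw [hPd, map_mul]; ring
  have hd : W ∣ unpack n h := (map_dvd_iff σ).1 hσd
  have hQ0 : unpack n h ≠ 0 := fun h' => hh0 (unpack_eq_zero hn h')
  obtain ⟨c, hc, hcW⟩ := dvd_of_subst_X_pow_dvd hn hW0 hQs hQ0 hd (by rwa [subst_unpack hn])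
  refine ⟨c, hc, ?_⟩
  rw [← hcW, subst_unpack hn]
  exact hres

/-- The sum `a * P + W * V` has both degrees below `2n`, so here the congruence is an equality. As
`W ≠ 0`, the rows for `V` are independent; the single last row, that of `P`, yields `V = -a * T`. -/
theorem firstDep_quotRows {n : ℕ} {α β : F} {T W : F[X][Y]} (hP : Small n (T * W))
    (hP0 : T * W ≠ 0) :
    ∃ c : F, c ≠ 0 ∧ firstDep (prec n * width n) ((quotRows n α β
      (subst (X ^ width n + C α) (X + C β) (T * W))
      (subst (X ^ width n + C α) (X + C β) W)).map (row (prec n * width n) (n * n))) =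
      vec (n * n) (subst X (X ^ n) (C (C c) * T)) := by
  have hn : 0 < n := by have := hP.1; omega
  have hnn : 0 < n * n := Nat.mul_pos hn hn
  have hT0 : T ≠ 0 := left_ne_zero_of_mul hP0
  have hW0 : W ≠ 0 := right_ne_zero_of_mul hP0
  have hWs : Small n W := hP.of_dvd hP0 (dvd_mul_left _ _)
  have hTs : Small n T := hP.of_dvd hP0 (dvd_mul_right _ _)
  have hnw : 2 * n < width n + n := by
    rw [width, cofDeg, prec]; nlinarith
  set σ := shift α β with hσ
  set L := width n with hL
  set P := T * W with hPd
  clear_value P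
  set Λ := rowMap (subst (X ^ L + C α) (X + C β) W) (X ^ L + C α) (X + C β) n LinearMap.id with hΛ
  have hval : ∀ (a : F) (h : F[X]), a • ((subst (X ^ L + C α) (X + C β) P, 0) : F[X] × F[X]) + Λ h =
      (subst (X ^ L) X (σ (C (C a) * P + W * unpack n h)), h) := by
    intro a h
    rw [hΛ, rowMap_apply, hσ, subst_shift, map_add, map_mul, map_mul, subst_C_C, Prod.smul_mk,
      smul_eq_C_mul]
    simp
  have hzero : ∀ (a : F) (h : F[X]), h.degree < (n * n : ℕ) →
      X ^ (prec n * L) ∣ (a • ((subst (X ^ L + C α) (X + C β) P, 0) : F[X] × F[X]) + Λ h).1 →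
      C (C a) * P + W * unpack n h = 0 := by
    intro a h hh hX
    have h2 := small_unpack hn hh
    have hs : Small (2 * n) (C (C a) * P + W * unpack n h) := by
      refine small_of_coeff ?_ fun j => ?_
      · refine (natDegree_add_le _ _).trans_lt (max_lt ?_ ?_)
        · refine (natDegree_C_mul_le _ _).trans_lt ?_
          have := hP.1; omega
        · refine natDegree_mul_le.trans_lt ?_
          have := hWs.1; have := h2.1; omega
      · rw [coeff_add, coeff_C_mul]
        refine (natDegree_add_le _ _).trans_lt (max_lt ?_ ?_)
        · refine (natDegree_C_mul_le _ _).trans_lt ?_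
          have := hP.coeff_natDegree j; omega
        · rw [coeff_mul]
          rw [← Nat.le_sub_one_iff_lt (by omega)]
          refine natDegree_sum_le_of_forall_le _ _ fun x _ => natDegree_mul_le.trans ?_
          have := hWs.coeff_natDegree x.1
          have := h2.coeff_natDegree x.2
          omega
    rw [hval] at hX
    have hs' := hs.shift α β
    have h3 := (X_pow_dvd_subst_iff (hs'.1.trans_le (by rw [hL, width, cofDeg, prec]; nlinarith))).1 hX
    refine (map_eq_zero_iff σ σ.injective).1 ?_
    ext j i
    rw [coeff_zero, coeff_zero]
    by_cases hi : i < prec n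
    · exact C_X_pow_dvd_iff.1 h3 j i hi
    · refine coeff_eq_zero_of_natDegree_lt ((hs'.coeff_natDegree j).trans_le ?_)
      rw [prec] at hi
      nlinarith
  have hno : NoDep (prec n * L) ((List.range (n * n)).map fun k => Λ (X ^ k)) := by
    refine noDep_map_range fun h h0 hh hX => h0 ?_
    have := hzero 0 h hh (by rwa [zero_smul, zero_add])
    rw [C_0, C_0, zero_mul, zero_add] at this
    exact unpack_eq_zero hn ((mul_eq_zero.1 this).resolve_left hW0)
  obtain ⟨a, ha, w, hw, hX, hres⟩ := firstDep_append_singleton hnn hno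
    (q := (subst (X ^ L + C α) (X + C β) P, 0)) (v := Λ (-subst X (X ^ n) T))
    (mem_span_map_range.2 ⟨_, by rw [degree_neg]; exact hTs.degree_subst_lt, rfl⟩) (by
      rw [← one_smul F ((subst (X ^ L + C α) (X + C β) P, 0) : F[X] × F[X]), hval, map_neg,
        unpack_subst hn hTs.coeff_natDegree, C_1, C_1, hPd]
      have : 1 * (T * W) + W * -T = 0 := by ring
      rw [this, map_zero, map_zero]
      exact dvd_zero _)
  obtain ⟨h, hh, rfl⟩ := mem_span_map_range.1 hw
  have h0 := hzero a h hh hX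
  rw [hval] at hres
  refine ⟨-a, neg_ne_zero.2 ha, ?_⟩
  have h1 : unpack n h = C (C (-a)) * T := by
    have : W * (unpack n h - C (C (-a)) * T) = 0 := by
      rw [← h0, hPd, C_neg, C_neg]; ring
    exact sub_eq_zero.1 ((mul_eq_zero.1 this).resolve_left hW0)
  rw [← h1, subst_unpack hn]
  exact hres

end separation
end BivariateSplit

/-! ### Removal of the full power of `X ^ L`. -/

namespace TreeMachine

theorem strip_spec {K : Type*} [Field K] {L : ℕ} (n : ℕ) {f : K[X]} (hf : f ≠ 0)
    (hn : f.natDegree < L * n) :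
    ∃ (r : ℕ) (g : K[X]), f = X ^ (r * L) * g ∧ ¬X ^ L ∣ g ∧ strip L n f = g := by
  classical
  induction n generalizing f with
  | zero => omega
  | succ n ih =>
    by_cases hd : X ^ L ∣ f
    · have h1 := X_pow_mul_iterate_divX hd
      have h2 : divX^[L] f ≠ 0 := by rintro h; rw [h, mul_zero] at h1; exact hf h1.symm
      have h3 : (divX^[L] f).natDegree < L * n := by
        have := congrArg natDegree h1
        rw [natDegree_X_pow_mul _ h2] at this
        rw [mul_add] at hn; omega
      obtain ⟨r, g, h4, h5, h6⟩ := ih h2 h3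
      refine ⟨r + 1, g, ?_, h5, ?_⟩
      · rw [← h1, h4]; ring
      · rw [strip, Function.iterate_succ_apply, if_pos hd]
        exact h6
    · refine ⟨0, f, by simp, hd, ?_⟩
      rw [strip]
      have : ∀ k, (fun f : K[X] => if X ^ L ∣ f then divX^[L] f else f)^[k] f = f := by
        intro k
        induction k with
        | zero => rfl
        | succ k ih => rw [Function.iterate_succ_apply, if_neg hd, ih]
      exact this _

end TreeMachine

/-! ### Factors and their local types. -/

namespace BivariateSplit

section factors
variable {F : Type*} [Field F] {α β : F}

open Classical in
theorem associated_filter_prod {M : Type*} [CommMonoidWithZero M] {S S' : Multiset M}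
    (h : Multiset.Rel Associated S S') {p : M → Prop}
    (hp : ∀ a b, Associated a b → (p a ↔ p b)) :
    Associated (S.filter p).prod (S'.filter p).prod := by
  induction h with
  | zero => rfl
  | @cons a b _ _ hab _ ih =>
    by_cases ha : p a
    · rw [Multiset.filter_cons_of_pos _ ha, Multiset.filter_cons_of_pos _ ((hp _ _ hab).1 ha),
        Multiset.prod_cons, Multiset.prod_cons]
      exact hab.mul_mul ih
    · rwa [Multiset.filter_cons_of_neg _ ha, Multiset.filter_cons_of_neg _ (mt (hp _ _ hab).2 ha)]

theorem isUnit_iff_C_C {u : F[X][Y]} : IsUnit u ↔ ∃ a : F, a ≠ 0 ∧ u = C (C a) := by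
  rw [Polynomial.isUnit_iff]
  constructor
  · rintro ⟨r, hr, rfl⟩
    obtain ⟨a, ha, rfl⟩ := Polynomial.isUnit_iff.1 hr
    exact ⟨a, ha.ne_zero, rfl⟩
  · rintro ⟨a, ha, rfl⟩
    exact ⟨C a, isUnit_C.2 (IsUnit.mk0 _ ha), rfl⟩

theorem exists_C_C_mul_of_associated {P Q : F[X][Y]} (h : Associated P Q) :
    ∃ a : F, a ≠ 0 ∧ Q = C (C a) * P := by
  obtain ⟨u, rfl⟩ := h
  obtain ⟨a, ha, hu⟩ := isUnit_iff_C_C.1 u.isUnit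
  exact ⟨a, ha, by rw [hu, mul_comm]⟩

theorem associated_C_C_mul {a : F} (ha : a ≠ 0) (P : F[X][Y]) : Associated (C (C a) * P) P :=
  associated_unit_mul_left _ _ (isUnit_iff_C_C.2 ⟨a, ha, rfl⟩)

theorem evalEval_eq (α β : F) (Q : F[X][Y]) : Q.evalEval α β = (restrict α Q).eval β := by
  rw [restrict, ← coe_mapRingHom, ← eval₂_evalRingHom, eval₂_eq_eval_map, coe_mapRingHom]

theorem restrict_C_C_mul (a : F) (Q : F[X][Y]) :
    restrict α (C (C a) * Q) = C a * restrict α Q := by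
  rw [restrict_mul, restrict_C, eval_C]

theorem IsTypeA.of_associated {P Q : F[X][Y]} (h : Associated P Q) (hP : IsTypeA α β P) :
    IsTypeA α β Q := by
  obtain ⟨a, ha, rfl⟩ := exists_C_C_mul_of_associated h
  obtain ⟨m, hm, γ, hγ, h1⟩ := hP
  exact ⟨m, hm, a * γ, mul_ne_zero ha hγ, by rw [restrict_C_C_mul, h1, C_mul, mul_assoc]⟩

theorem IsTypeB.of_associated {P Q : F[X][Y]} (h : Associated P Q) (hP : IsTypeB α β P) :
    IsTypeB α β Q := by
  obtain ⟨a, ha, rfl⟩ := exists_C_C_mul_of_associated h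
  rw [IsTypeB, evalEval_eq] at hP ⊢
  rw [restrict_C_C_mul, eval_mul, eval_C, natDegree_C_mul ha]
  exact ⟨mul_ne_zero ha hP.1, hP.2⟩

theorem IsTypeD.of_associated {P Q : F[X][Y]} (h : Associated P Q) (hP : IsTypeD α β P) :
    IsTypeD α β Q := by
  obtain ⟨a, ha, rfl⟩ := exists_C_C_mul_of_associated h
  rw [IsTypeD, evalEval_eq] at hP ⊢
  rw [restrict_C_C_mul, eval_mul, eval_C, natDegree_C_mul ha]
  exact ⟨mul_ne_zero ha hP.1, hP.2⟩

theorem IsFactorization.rel {S S' : Multiset F[X][Y]} {P : F[X][Y]} (h : IsFactorization S P)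
    (h' : IsFactorization S' P) : Multiset.Rel Associated S S' :=
  UniqueFactorizationMonoid.factors_unique h.1 h'.1 (h.2.trans h'.2.symm)

theorem associated_partA {S S' : Multiset F[X][Y]} (h : Multiset.Rel Associated S S') :
    Associated (partA S α β) (partA S' α β) := by
  simp only [partA]
  exact associated_filter_prod h fun a b hab => ⟨.of_associated hab, .of_associated hab.symm⟩

theorem associated_partB {S S' : Multiset F[X][Y]} (h : Multiset.Rel Associated S S') :
    Associated (partB S α β) (partB S' α β) := by
  simp only [partB]
  exact associated_filter_prod h fun a b hab => ⟨.of_associated hab, .of_associated hab.symm⟩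

theorem associated_partD {S S' : Multiset F[X][Y]} (h : Multiset.Rel Associated S S') :
    Associated (partD S α β) (partD S' α β) := by
  simp only [partD]
  exact associated_filter_prod h fun a b hab => ⟨.of_associated hab, .of_associated hab.symm⟩

/-- Restriction to `X = α` and translation of `Y` by `β`. -/
noncomputable def localize (α β : F) : F[X][Y] →+* F[X] :=
  (compRingHom (X + C β)).comp (mapRingHom (evalRingHom α))

theorem localize_apply (α β : F) (Q : F[X][Y]) :
    localize α β Q = (restrict α Q).comp (X + C β) := rfl

theorem restrict_zero_shift (α β : F) (Q : F[X][Y]) :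
    restrict 0 (shift α β Q) = localize α β Q := restrict_shift α β Q

theorem natDegree_localize (α β : F) (Q : F[X][Y]) :
    (localize α β Q).natDegree = (restrict α Q).natDegree := by
  rw [localize_apply, natDegree_comp, natDegree_X_add_C, mul_one]

theorem natDegree_localize_le (α β : F) (Q : F[X][Y]) :
    (localize α β Q).natDegree ≤ Q.natDegree :=
  (natDegree_localize α β Q).le.trans natDegree_map_le

theorem eval_localize (α β : F) (Q : F[X][Y]) : (localize α β Q).eval 0 = Q.evalEval α β := by
  rw [localize_apply, eval_comp, evalEval_eq]; simp

theorem restrict_eq (α β : F) (Q : F[X][Y]) :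
    restrict α Q = (localize α β Q).comp (X - C β) := by
  rw [localize_apply, comp_assoc]; simp

theorem localize_eq_zero {Q : F[X][Y]} : localize α β Q = 0 ↔ restrict α Q = 0 := by
  constructor
  · intro h; rw [restrict_eq α β, h, zero_comp]
  · intro h; rw [localize_apply, h, zero_comp]

theorem isTypeB_iff {Q : F[X][Y]} :
    IsTypeB α β Q ↔ (localize α β Q).eval 0 ≠ 0 ∧ 1 ≤ (localize α β Q).natDegree := by
  rw [eval_localize, natDegree_localize, IsTypeB]

theorem isTypeD_iff {Q : F[X][Y]} :
    IsTypeD α β Q ↔ (localize α β Q).eval 0 ≠ 0 ∧ (localize α β Q).natDegree = 0 := by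
  rw [eval_localize, natDegree_localize, IsTypeD]

theorem isTypeA_iff {Q : F[X][Y]} :
    IsTypeA α β Q ↔ ∃ m : ℕ, 1 ≤ m ∧ ∃ γ : F, γ ≠ 0 ∧ localize α β Q = C γ * X ^ m := by
  constructor
  · rintro ⟨m, hm, γ, hγ, h⟩
    exact ⟨m, hm, γ, hγ, by rw [localize_apply, h]; simp⟩
  · rintro ⟨m, hm, γ, hγ, h⟩
    exact ⟨m, hm, γ, hγ, by rw [restrict_eq α β, h]; simp⟩

theorem dvd_X_pow_iff {f : F[X]} : (∃ M, f ∣ X ^ M) ↔ ∃ (m : ℕ) (γ : F), γ ≠ 0 ∧ f = C γ * X ^ m := by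
  constructor
  · rintro ⟨M, h⟩
    obtain ⟨m, -, hm⟩ := (dvd_prime_pow prime_X M).1 h
    obtain ⟨u, hu⟩ := hm.symm
    obtain ⟨a, ha, hua⟩ := Polynomial.isUnit_iff.1 u.isUnit
    exact ⟨m, a, ha.ne_zero, by rw [← hu, ← hua, mul_comm]⟩
  · rintro ⟨m, γ, hγ, rfl⟩
    exact ⟨m, ((isUnit_C.2 (IsUnit.mk0 _ hγ)).mul_left_dvd).2 dvd_rfl⟩

/-- The divisors of powers of `X` are the monomials `γ * X ^ m` with `γ ≠ 0`; type D is the case `m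
= 0`. The first separation can therefore isolate only A and D together. -/
theorem isTypeA_or_isTypeD_iff {Q : F[X][Y]} :
    IsTypeA α β Q ∨ IsTypeD α β Q ↔ ∃ M, localize α β Q ∣ X ^ M := by
  rw [dvd_X_pow_iff, isTypeA_iff, isTypeD_iff]
  constructor
  · rintro (⟨m, -, γ, hγ, h⟩ | ⟨h1, h2⟩)
    · exact ⟨m, γ, hγ, h⟩
    · rw [eq_C_of_natDegree_eq_zero h2, eval_C] at h1
      exact ⟨0, _, h1, by rw [pow_zero, mul_one]; exact eq_C_of_natDegree_eq_zero h2⟩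
  · rintro ⟨m, γ, hγ, h⟩
    rcases Nat.eq_zero_or_pos m with rfl | hm
    · right; rw [h]; simp [hγ]
    · exact Or.inl ⟨m, hm, γ, hγ, h⟩

theorem not_isTypeA_and_isTypeD {Q : F[X][Y]} (hA : IsTypeA α β Q) : ¬IsTypeD α β Q := by
  obtain ⟨m, hm, γ, hγ, h⟩ := isTypeA_iff.1 hA
  rw [isTypeD_iff, h]
  simp [show m ≠ 0 by omega]

open Classical in
theorem partA_mul_partD (S : Multiset F[X][Y]) :
    partA S α β * partD S α β = (S.filter fun q => ∃ M, localize α β q ∣ X ^ M).prod := by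
  rw [partA, partD, ← Multiset.prod_add]
  congr 1
  rw [Multiset.filter_add_filter, (Multiset.filter_eq_nil (p := fun a => IsTypeA α β a ∧ IsTypeD α β a)).2, add_zero]
  · exact Multiset.filter_congr fun q _ => isTypeA_or_isTypeD_iff
  · rintro q - ⟨h1, h2⟩
    exact not_isTypeA_and_isTypeD h1 h2

theorem irreducible_dvd_filter_prod {S : Multiset F[X][Y]} (hS : ∀ Q ∈ S, Irreducible Q)
    {p : F[X][Y] → Prop} [DecidablePred p] {q : F[X][Y]} (hq : Irreducible q) (h : q ∣ (S.filter p).prod) :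
    ∃ s ∈ S, p s ∧ Associated q s := by
  obtain ⟨s, hs, hqs⟩ := (UniqueFactorizationMonoid.irreducible_iff_prime.1 hq).exists_mem_multiset_dvd h
  rw [Multiset.mem_filter] at hs
  exact ⟨s, hs.1, hs.2, hq.associated_of_dvd (hS s hs.1) hqs⟩

open Classical in
theorem localize_filter_prod_dvd (S : Multiset F[X][Y]) (g : F[X]) :
    ∃ M, localize α β (S.filter fun q => ∃ M, localize α β q ∣ g ^ M).prod ∣ g ^ M := by
  induction S using Multiset.induction_on with
  | empty => exact ⟨0, by simp⟩
  | cons a S ih =>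
    by_cases h : ∃ M, localize α β a ∣ g ^ M
    · obtain ⟨M, hM⟩ := h
      obtain ⟨M', hM'⟩ := ih
      refine ⟨M + M', ?_⟩
      rw [Multiset.filter_cons_of_pos _ ⟨M, hM⟩, Multiset.prod_cons, map_mul, pow_add]
      exact mul_dvd_mul hM hM'
    · rwa [Multiset.filter_cons_of_neg (p := fun q => ∃ M, localize α β q ∣ g ^ M) _ h]

open Classical in
/-- The decomposition of a polynomial by the local types of its factors. -/
theorem exists_parts {P : F[X][Y]} {S : Multiset F[X][Y]}
    (hS : IsFactorization S P) :
    ∃ T W B V : F[X][Y], P = T * W ∧ W = B * V ∧ Associated T (partA S α β * partD S α β) ∧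
      Associated B (partB S α β) ∧ (∃ M, localize α β T ∣ X ^ M) ∧
      (∀ q, Irreducible q → q ∣ W → ∀ M, ¬localize α β q ∣ X ^ M) ∧
      ∀ (r : ℕ) (G : F[X]), localize α β W ∣ X ^ r * G → ¬X ∣ G →
        localize α β B ∣ G ∧ ∀ q, Irreducible q → q ∣ V → ∀ M, ¬localize α β q ∣ G ^ M := by
  obtain ⟨a, ha, hPa⟩ := exists_C_C_mul_of_associated hS.2
  set p : F[X][Y] → Prop := fun q => ∃ M, localize α β q ∣ X ^ M with hp
  have hassoc : ∀ (g : F[X]) q s, Associated q s → (∃ M, localize α β q ∣ g ^ M) →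
      ∃ M, localize α β s ∣ g ^ M := by
    rintro g q s h ⟨M, hM⟩
    exact ⟨M, (map_dvd (localize α β) h.symm.dvd).trans hM⟩
  -- A factor that does not vanish at the point is of type B exactly if it is not of type D, since
  -- it cannot be of type A.
  have hB : partB S α β = ((S.filter fun q => ¬p q).filter
      fun q => (localize α β q).eval 0 ≠ 0).prod := by
    rw [partB, Multiset.filter_filter]
    congr 1
    refine Multiset.filter_congr fun q _ => ?_
    rw [isTypeB_iff]
    refine and_congr_right fun h0 => ?_
    simp only [hp]
    rw [← isTypeA_or_isTypeD_iff, not_or, isTypeD_iff, isTypeA_iff]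
    constructor
    · intro h
      refine ⟨?_, fun h' => by omega⟩
      rintro ⟨m, hm, γ, hγ, h'⟩
      rw [h'] at h0
      simp [show m ≠ 0 by omega] at h0
    · rintro ⟨-, h⟩
      by_contra h'
      exact h ⟨h0, by omega⟩
  have hW : ∀ q, Irreducible q → q ∣ (S.filter fun q => ¬p q).prod →
      ∀ M, ¬localize α β q ∣ X ^ M := by
    intro q hq hqd M hM
    obtain ⟨s, -, hs, hqs⟩ := irreducible_dvd_filter_prod hS.1 hq hqd
    exact hs (hassoc X q s hqs ⟨M, hM⟩)
  have hsplit : (S.filter fun q => ¬p q).prod = partB S α β *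
      ((S.filter fun q => ¬p q).filter fun q => ¬(localize α β q).eval 0 ≠ 0).prod := by
    rw [hB, ← Multiset.prod_add, Multiset.filter_add_not]
  refine ⟨C (C a) * (S.filter p).prod, (S.filter fun q => ¬p q).prod, partB S α β,
    ((S.filter fun q => ¬p q).filter fun q => ¬(localize α β q).eval 0 ≠ 0).prod, ?_, hsplit, ?_,
    .refl _, ?_, hW, ?_⟩
  · rw [hPa, mul_assoc, ← Multiset.prod_add, Multiset.filter_add_not]
  · rw [partA_mul_partD]
    exact associated_C_C_mul ha _
  · obtain ⟨M, hM⟩ := localize_filter_prod_dvd (α := α) (β := β) S X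
    refine ⟨M, ?_⟩
    rw [map_mul, localize_apply, restrict_C, eval_C, C_comp,
      (isUnit_C.2 (IsUnit.mk0 _ ha)).mul_left_dvd]
    exact hM
  · intro r G hG hXG
    constructor
    · have h1 : localize α β (partB S α β) ∣ X ^ r * G := by
        refine dvd_trans ?_ hG
        rw [hsplit, map_mul]; exact dvd_mul_right _ _
      refine IsCoprime.dvd_of_dvd_mul_left (IsCoprime.pow_right ?_) h1
      -- No type B factor vanishes at the point, so the localization of their product is prime to
      -- `X` and must divide `G`.
      refine ((irreducible_X.coprime_iff_not_dvd).2 ?_).symm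
      rw [X_dvd_iff, coeff_zero_eq_eval_zero]
      rw [hB]
      generalize (S.filter fun q => ¬p q) = S'
      induction S' using Multiset.induction_on with
      | empty => simp
      | cons q S' ih =>
        by_cases h : (localize α β q).eval 0 ≠ 0
        · rw [Multiset.filter_cons_of_pos (p := fun q => (localize α β q).eval 0 ≠ 0) _ h,
            Multiset.prod_cons, map_mul, eval_mul]
          exact mul_ne_zero h ih
        · rwa [Multiset.filter_cons_of_neg (p := fun q => (localize α β q).eval 0 ≠ 0) _ h]
    · intro q hq hqd M hM
      obtain ⟨s, hs, hs', hqs⟩ := irreducible_dvd_filter_prod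
        (fun Q hQ => hS.1 Q (Multiset.mem_filter.1 hQ).1) hq hqd
      rw [not_not] at hs'
      obtain ⟨M', hM'⟩ := hassoc G q s hqs ⟨M, hM⟩
      -- The remaining factors vanish at the point but `G` does not vanish at `0`, so their
      -- localizations divide no power of `G`.
      rw [← coeff_zero_eq_eval_zero, ← X_dvd_iff] at hs'
      exact hXG (prime_X.dvd_of_dvd_pow (hs'.trans hM'))

end factors
end BivariateSplit

/-! ### Correctness of the two separations. -/

namespace BivariateSplit

section split
variable {F : Type*} [Field F] {α β : F}

/-- The substitution `X ↦ X ^ L + α`, `Y ↦ X + β` for a large exponent `L`. -/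
noncomputable abbrev kron (n : ℕ) (α β : F) : F[X][Y] →+* F[X] :=
  subst (X ^ width n + C α) (X + C β)

/-- The substitution `Y ↦ X ^ n`. -/
noncomputable abbrev pack (n : ℕ) : F[X][Y] →+* F[X] := subst X (X ^ n)

theorem lt_width (n : ℕ) : n < width n := by rw [width, cofDeg]; omega

theorem degree_kron_lt {n : ℕ} {P : F[X][Y]} (hP : Small n P) :
    (kron n α β P).degree < (width n * n : ℕ) := by
  have hP' := hP.shift α β
  have hL := hP'.1.trans (lt_width n)
  have hL0 : 0 < width n := by omega
  rw [kron, ← subst_shift, degree_lt_iff_coeff_zero]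
  intro k hk
  have h := coeff_subst_pow_X hL (Nat.mod_lt k hL0) (i := k / width n)
  rw [Nat.mod_add_div] at h
  rw [h]
  refine coeff_eq_zero_of_natDegree_lt ((hP'.coeff_natDegree _).trans_le ?_)
  rw [Nat.le_div_iff_mul_le hL0, mul_comm]
  exact hk

theorem kron_ne_zero {n : ℕ} {P : F[X][Y]} (hP : Small n P) (h0 : P ≠ 0) : kron n α β P ≠ 0 := by
  intro h
  refine h0 ((map_eq_zero_iff _ (shift α β).injective).1 ?_)
  rw [kron, ← subst_shift] at h
  ext j i
  rw [coeff_zero, coeff_zero]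
  by_cases hj : j < width n
  · rw [← coeff_subst_pow_X ((hP.shift α β).1.trans (lt_width n)) hj, h, coeff_zero]
  · rw [coeff_eq_zero_of_natDegree_lt (p := shift α β P), coeff_zero]
    have := (hP.shift α β).1.trans (lt_width n)
    omega

theorem shift_X_sub_C (α β : F) : shift α β (C (X - C α)) = C X := by
  rw [C_sub, map_sub, shift_C_C, shift_C_X, ← C_sub, add_sub_cancel_right]

/-- Removal of the factors that vanish for `X = α`. -/
theorem exists_strip_kron {n : ℕ} {P : F[X][Y]} (hP : Small n P) (h0 : P ≠ 0) :
    ∃ (r : ℕ) (Q : F[X][Y]), P = C (X - C α) ^ r * Q ∧ localize α β Q ≠ 0 ∧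
      strip (width n) n (kron n α β P) = kron n α β Q := by
  have hk := kron_ne_zero (α := α) (β := β) hP h0
  obtain ⟨r, g, h1, h2, h3⟩ := strip_spec n hk (by
    have := degree_kron_lt (α := α) (β := β) hP
    rw [degree_eq_natDegree hk] at this
    exact_mod_cast this)
  have hd : X ^ (r * width n) ∣ kron n α β P := by rw [h1]; exact dvd_mul_right _ _
  rw [kron, ← subst_shift] at hd
  obtain ⟨S, hS⟩ := (X_pow_dvd_subst_iff ((hP.shift α β).1.trans (lt_width n))).1 hd
  have hS' : S = shift α β ((shift α β).symm S) := ((shift α β).apply_symm_apply S).symm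
  have hPS : P = C (X - C α) ^ r * (shift α β).symm S := by
    apply (shift α β).injective
    rw [map_mul, ← hS', map_pow, shift_X_sub_C, hS]
  -- The stripping takes place in one variable; cancelling the power of `X` shows that its result is
  -- the image of the bivariate quotient.
  have hg : g = kron n α β ((shift α β).symm S) := by
    have h4 : X ^ (r * width n) * kron n α β ((shift α β).symm S) = X ^ (r * width n) * g := by
      rw [← h1]
      conv_rhs => rw [hPS]
      rw [map_mul, map_pow, kron, ← subst_shift, ← subst_shift, shift_X_sub_C, subst_C_X, ← pow_mul,
        mul_comm r]
    exact (mul_left_cancel₀ (pow_ne_zero _ X_ne_zero) h4).symm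
  refine ⟨r, (shift α β).symm S, hPS, ?_, h3.trans hg⟩
  intro h5
  rw [← restrict_zero_shift, ← C_X_dvd_iff, ← hS'] at h5
  apply h2
  have hS0 : shift α β P ≠ 0 := (map_ne_zero_iff _ (shift α β).injective).2 h0
  have hSs : Small n S := (hP.shift α β).of_dvd hS0 ⟨_, by rw [hS, mul_comm]⟩
  rw [hg, kron, ← subst_shift, ← hS', ← one_mul (width n)]
  conv_rhs => rw [one_mul]
  rw [X_pow_dvd_subst_iff (hSs.1.trans (lt_width n)), pow_one]
  exact h5

theorem irreducible_C_X_sub_C (α : F) : Irreducible (C (X - C α) : F[X][Y]) :=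
  (prime_C_iff.2 (prime_X_sub_C α)).irreducible

/-- The factor `X - α` restricts to zero on the line, so it has none of the three types and removing
it does not change the parts. -/
theorem associated_parts_of_eq_mul {P Q : F[X][Y]} {r : ℕ} (h : P = C (X - C α) ^ r * Q)
    {S S' : Multiset F[X][Y]} (hS : IsFactorization S P) (hS' : IsFactorization S' Q) :
    Associated (partA S' α β) (partA S α β) ∧ Associated (partB S' α β) (partB S α β) ∧
      Associated (partD S' α β) (partD S α β) := by
  classical
  have h1 : IsFactorization (Multiset.replicate r (C (X - C α)) + S') P := by
    constructor
    · intro q hq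
      rcases Multiset.mem_add.1 hq with hq | hq
      · rw [Multiset.eq_of_mem_replicate hq]; exact irreducible_C_X_sub_C α
      · exact hS'.1 q hq
    · rw [Multiset.prod_add, Multiset.prod_replicate, h]
      exact hS'.2.mul_left _
  have hrel := h1.rel hS
  have hz : localize α β (C (X - C α)) = 0 := by
    rw [localize_eq_zero, restrict_C]; simp
  have key : ∀ p : F[X][Y] → Prop, ¬p (C (X - C α)) →
      (Multiset.filter p (Multiset.replicate r (C (X - C α)) + S')) = S'.filter p := by
    intro p hp
    rw [Multiset.filter_add, Multiset.filter_eq_nil.2, zero_add]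
    intro q hq
    rwa [Multiset.eq_of_mem_replicate hq]
  refine ⟨?_, ?_, ?_⟩
  · have := associated_partA (α := α) (β := β) hrel
    rw [partA, key] at this
    · exact this
    · rw [isTypeA_iff, hz]
      rintro ⟨m, -, γ, hγ, h⟩
      simp [hγ] at h
  · have := associated_partB (α := α) (β := β) hrel
    rw [partB, key] at this
    · exact this
    · rw [isTypeB_iff, hz]; simp
  · have := associated_partD (α := α) (β := β) hrel
    rw [partD, key] at this
    · exact this
    · rw [isTypeD_iff, hz]; simp

/-- Everything the procedure computes. -/
theorem exists_split {n : ℕ} (hn1 : 1 < n) {P : F[X][Y]} (hP : Small n P) (h0 : P ≠ 0) (α β : F) :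
    ∃ Q W V T B : F[X][Y], Small n Q ∧ Small n W ∧ Small n V ∧ Small n T ∧ Small n B ∧
      T ≠ 0 ∧ B ≠ 0 ∧ strip (width n) n (kron n α β P) = kron n α β Q ∧
      firstDep (prec n * width n) ((sepRows n α β (kron n α β Q) X).map
        (row (prec n * width n) (n * n))) = vec (n * n) (pack n W) ∧
      firstDep (prec n * width n) ((sepRows n α β (kron n α β W) (strip 1 n (localize α β W))).map
        (row (prec n * width n) (n * n))) = vec (n * n) (pack n V) ∧
      firstDep (prec n * width n) ((quotRows n α β (kron n α β Q) (kron n α β W)).map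
        (row (prec n * width n) (n * n))) = vec (n * n) (pack n T) ∧
      firstDep (prec n * width n) ((quotRows n α β (kron n α β W) (kron n α β V)).map
        (row (prec n * width n) (n * n))) = vec (n * n) (pack n B) ∧
      ∀ S, IsFactorization S P → Associated T (partA S α β * partD S α β) ∧
        Associated B (partB S α β) := by
  obtain ⟨r, Q, hPQ, hQl, hstrip⟩ := exists_strip_kron (α := α) (β := β) hP h0
  have hQ0 : Q ≠ 0 := by rintro rfl; rw [mul_zero] at hPQ; exact h0 hPQ
  have hQ : Small n Q := hP.of_dvd h0 ⟨_, by rw [hPQ, mul_comm]⟩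
  obtain ⟨S', hS'⟩ := exists_isFactorization hQ0
  obtain ⟨T₀, W₀, B₀, V₀, hQT, hWB, hT, hB, ⟨M, hTX⟩, hWX, hG⟩ :=
    exists_parts (α := α) (β := β) hS'
  have hn : 0 < n := by have := hP.1; omega
  have hassoc : ∀ {A A' : F[X][Y]} {c : F}, c ≠ 0 → A = C (C c) * A' → Associated A A' := by
    rintro A A' c hc rfl; exact associated_C_C_mul hc _
  have hnd : ∀ {A : F[X][Y]}, A ∣ Q → A ≠ 0 := by
    rintro A hA rfl; exact hQ0 (zero_dvd_iff.1 hA)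
  -- first separation
  have hnX : ¬C X ∣ shift α β (T₀ * W₀) := by
    rw [C_X_dvd_iff, restrict_zero_shift, ← hQT]; exact hQl
  have hT₀ : Small n T₀ := hQ.of_dvd hQ0 ⟨_, hQT⟩
  have hsep : ∃ W, Associated W W₀ ∧ firstDep (prec n * width n)
      ((sepRows n α β (kron n α β Q) X).map (row (prec n * width n) (n * n))) =
        vec (n * n) (pack n W) := by
    obtain ⟨c, hc, h⟩ := firstDep_sepRows (g := X) (hQT ▸ hQ) hnX (by
        rw [restrict_zero_shift]
        -- The localization of `T₀` is `γ * X ^ m`, and `m` is at most the degree of `T₀` in `Y`; so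
        -- the exponent `n` is large enough.
        obtain ⟨m, γ, hγ, h⟩ := dvd_X_pow_iff.1 ⟨M, hTX⟩
        have h1 := natDegree_localize_le α β T₀
        rw [h, natDegree_C_mul_X_pow m γ hγ] at h1
        rw [h, (isUnit_C.2 (IsUnit.mk0 _ hγ)).mul_left_dvd]
        exact pow_dvd_pow _ (h1.trans hT₀.1.le))
      (by simpa only [restrict_zero_shift] using hWX) (by rwa [natDegree_X]) X_ne_zero
    rw [← hQT] at h
    exact ⟨_, associated_C_C_mul hc _, h⟩
  obtain ⟨W, hWW, hsep⟩ := hsep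
  obtain ⟨u, hu⟩ := hWW
  have hQW : Q = T₀ * u * W := by rw [hQT, ← hu]; ring
  have hW : Small n W := hQ.of_dvd hQ0 ⟨_, by rw [hQW, mul_comm]⟩
  have hW0 : W ≠ 0 := hnd ⟨_, by rw [hQW, mul_comm]⟩
  have hWBV : W = B₀ * (V₀ * ↑u⁻¹) := by
    rw [← mul_assoc, ← hWB, ← hu, mul_assoc, Units.mul_inv, mul_one]
  -- second separation
  have hlW : localize α β W ≠ 0 := by
    intro h; rw [hQW, map_mul, h, mul_zero] at hQl; exact hQl rfl
  have hlWn := (natDegree_localize_le α β W).trans_lt hW.1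
  -- Here `G` is the part of the localization of `W` prime to `X`; it plays the role of `g` in the
  -- second separation.
  obtain ⟨s, G, hs, hGX, hGs⟩ := strip_spec (L := 1) n hlW (by rwa [one_mul])
  rw [mul_one] at hs
  rw [pow_one] at hGX
  have hG0 : G ≠ 0 := by rintro rfl; exact hGX (dvd_zero _)
  obtain ⟨hBG, hVG⟩ := hG s G (by
    rw [← hs]; exact _root_.map_dvd (localize α β) (Associated.symm ⟨u, hu⟩).dvd) hGX
  obtain ⟨c₂, hc₂, hsep₂⟩ := firstDep_sepRows (α := α) (β := β) (g := G) (hWBV ▸ hW) (by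
      rw [C_X_dvd_iff, restrict_zero_shift, ← hWBV]; exact hlW) (by
      rw [restrict_zero_shift]
      exact hBG.trans (dvd_pow_self G hn.ne')) (by
      intro q hq hqd
      rw [restrict_zero_shift]
      exact hVG q hq (by simpa using hqd)) (by
      refine (natDegree_le_of_dvd ⟨X ^ s, ?_⟩ hlW).trans_lt hlWn
      rw [hs, mul_comm]) hG0
  rw [← hWBV, ← hGs] at hsep₂
  obtain ⟨c₃, hc₃, hquot⟩ := firstDep_quotRows (α := α) (β := β) (hQW ▸ hQ) (hQW ▸ hQ0)
  rw [← hQW] at hquot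
  set V := C (C c₂) * (V₀ * ↑u⁻¹) with hV
  -- The second separation yields the cofactor only up to `c₂`. The inverse constant goes to `B₀`,
  -- so that the product is exactly `W` and the quotient can be formed.
  have hWBV' : W = C (C c₂⁻¹) * B₀ * V := by
    rw [hV, hWBV]
    have : (C (C c₂⁻¹) * C (C c₂) : F[X][Y]) = 1 := by
      rw [← C_mul, ← C_mul, inv_mul_cancel₀ hc₂, C_1, C_1]
    calc B₀ * (V₀ * ↑u⁻¹) = (C (C c₂⁻¹) * C (C c₂)) * (B₀ * (V₀ * ↑u⁻¹)) := by rw [this, one_mul]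
      _ = _ := by ring
  obtain ⟨c₄, hc₄, hquot₂⟩ := firstDep_quotRows (α := α) (β := β) (hWBV' ▸ hW) (hWBV' ▸ hW0)
  rw [← hWBV'] at hquot₂
  have hTa : Associated (C (C c₃) * (T₀ * u)) T₀ :=
    (associated_C_C_mul hc₃ _).trans (associated_mul_unit_left _ _ u.isUnit)
  have hBa : Associated (C (C c₄) * (C (C c₂⁻¹) * B₀)) B₀ :=
    (associated_C_C_mul hc₄ _).trans (associated_C_C_mul (inv_ne_zero hc₂) _)
  have hB₀ : B₀ ∣ Q := ((dvd_mul_right _ _).trans hWB.symm.dvd).trans ⟨_, by rw [hQT, mul_comm]⟩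
  refine ⟨Q, W, V, C (C c₃) * (T₀ * u), C (C c₄) * (C (C c₂⁻¹) * B₀), hQ, hW, ?_, ?_, ?_, ?_, ?_,
    hstrip, hsep, hsep₂, hquot, hquot₂, ?_⟩
  · exact hW.of_dvd hW0 ⟨_, by rw [hWBV', mul_comm]⟩
  · exact hQ.of_dvd hQ0 (hTa.dvd.trans ⟨_, hQT⟩)
  · exact hQ.of_dvd hQ0 (hBa.dvd.trans hB₀)
  · exact hnd (hTa.dvd.trans ⟨_, hQT⟩)
  · exact hnd (hBa.dvd.trans hB₀)
  · intro S hS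
    obtain ⟨hA', hB', hD'⟩ := associated_parts_of_eq_mul (β := β) hPQ hS hS'
    exact ⟨hTa.trans (hT.trans (hA'.mul_mul hD')), hBa.trans (hB.trans hB')⟩

end split
end BivariateSplit

/-! ### Computing the rows and decoding the results. -/

namespace TreeMachine

universe u v

theorem range_flatMap_map {γ : Type*} (b s : ℕ) (g : ℕ → γ) :
    ((List.range s).flatMap fun j => (List.range b).map fun i => g (i + b * j)) =
      (List.range (b * s)).map g := by
  induction s with
  | zero => simp
  | succ s ih =>
    rw [List.range_succ, List.flatMap_append, ih, mul_add, mul_one, List.range_add, List.map_append]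
    simp [Function.comp_def, add_comm]

theorem degree_lt_succ {R : Type*} [Semiring R] (f : R[X]) : f.degree < (f.degree.succ : ℕ) := by
  by_cases h : f = 0
  · rw [h, degree_zero]; exact WithBot.bot_lt_coe _
  · rw [withBotSucc_degree_eq_natDegree_add_one h, degree_eq_natDegree h]
    exact_mod_cast Nat.lt_succ_self _

namespace PT
variable {ι : Type v} {e : ι → Data} {c : ι → FieldPres.{u}} {n m b s s' : ι → ℕ}
  {α β : ∀ i, (c i).F}

theorem unary_prec (hn : PT e fun i => unary (n i)) : PT e fun i => unary (prec (n i)) :=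
  unary_mul (unary_mul (unary_const 2) hn) hn

theorem unary_cofDeg (hn : PT e fun i => unary (n i)) : PT e fun i => unary (cofDeg (n i)) :=
  unary_add (unary_mul (unary_prec hn) (unary_add (unary_mul hn hn) hn)) (unary_const 1)

theorem unary_width (hn : PT e fun i => unary (n i)) : PT e fun i => unary (width (n i)) :=
  unary_add (unary_cofDeg hn) hn

theorem unary_total (hn : PT e fun i => unary (n i)) :
    PT e fun i => unary (prec (n i) * width (n i)) :=
  unary_mul (unary_prec hn) (unary_width hn)

theorem row {f g : ∀ i, (c i).F[X]} (hf : PT e fun i => (c i).encV (m i) (f i))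
    (hg : PT e fun i => (c i).encV (s i) (g i)) :
    PT e fun i => encList ((row (m i) (s i) (f i, g i)).map (c i).enc) :=
  append (eγ := fun i => (c i).enc) (V_list hf) (V_list hg)

/-- Two nested ranges run over `j` and `i` with `k = i + b * j`, so that `k % b` and `k / b` need
not be computed. -/
theorem rowMap {f x y : ∀ i, (c i).F[X]} {t : ∀ i, (c i).F[X] →ₗ[(c i).F] (c i).F[X]}
    (hc : PT e fun i => (c i).pres) (hm : PT e fun i => unary (m i))
    (hb : PT e fun i => unary (b i)) (hb0 : ∀ i, 0 < b i) (hs : PT e fun i => unary (s i))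
    (hf : PT e fun i => (c i).encV (m i) (f i)) (hx : PT e fun i => (c i).encV (m i) (x i))
    (hy : PT e fun i => (c i).encV (m i) (y i))
    (ht : PT (fun q : Σ _ : ι, ℕ => .node (e q.1) (unary q.2))
      fun q => (c q.1).encV (s' q.1) (t q.1 (X ^ q.2))) :
    PT e fun i => encList ((((List.range (b i * s i)).map fun k =>
      rowMap (f i) (x i) (y i) (b i) (t i) (X ^ k)).map (TreeMachine.row (m i) (s' i))).map
        fun r => encList (r.map (c i).enc)) := by
  let E : (Σ _ : (Σ _ : ι, ℕ), ℕ) → Data := fun z =>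
    .node (.node (e z.1.1) (unary z.1.2)) (unary z.2)
  have he : PT E fun z => e z.1.1 := id.left.left
  have hj : PT E fun z => unary z.1.2 := id.left.right
  have hi : PT E fun z => unary z.2 := id.right
  have up : ∀ {g : ι → Data}, PT e g → PT E fun z => g z.1.1 := fun h =>
    he.trans (h.reindex fun z : (Σ _ : (Σ _ : ι, ℕ), ℕ) => z.1.1)
  have hk : PT E fun z => unary (z.2 + b z.1.1 * z.1.2) := unary_add hi (unary_mul (up hb) hj)
  have hrow : PT E fun z => encList ((TreeMachine.row (m z.1.1) (s' z.1.1)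
      (f z.1.1 * (x z.1.1 ^ z.2 * y z.1.1 ^ z.1.2),
        t z.1.1 (X ^ (z.2 + b z.1.1 * z.1.2)))).map (c z.1.1).enc) :=
    row (c := fun z : (Σ _ : (Σ _ : ι, ℕ), ℕ) => c z.1.1)
      (V_mul (c := fun z : (Σ _ : (Σ _ : ι, ℕ), ℕ) => c z.1.1) (up hc) (up hm) (up hf)
        (V_mul (c := fun z : (Σ _ : (Σ _ : ι, ℕ), ℕ) => c z.1.1) (up hc) (up hm)
          (V_pow (c := fun z : (Σ _ : (Σ _ : ι, ℕ), ℕ) => c z.1.1) (up hc) (up hm) (up hx) hi)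
          (V_pow (c := fun z : (Σ _ : (Σ _ : ι, ℕ), ℕ) => c z.1.1) (up hc) (up hm) (up hy) hj)))
      ((he.node hk).trans (ht.reindex fun z : (Σ _ : (Σ _ : ι, ℕ), ℕ) =>
        (⟨z.1.1, z.2 + b z.1.1 * z.1.2⟩ : Σ _ : ι, ℕ)))
  have hmap := map (e := fun q : Σ _ : ι, ℕ => .node (e q.1) (unary q.2))
    (γ := fun _ => ℕ) (eγ := fun _ => unary) (l := fun q => List.range (b q.1))
    (δ := fun q => List (c q.1).F) (eδ := fun q r => encList (r.map (c q.1).enc))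
    (f := fun q i => TreeMachine.row (m q.1) (s' q.1) (f q.1 * (x q.1 ^ i * y q.1 ^ q.2),
        t q.1 (X ^ (i + b q.1 * q.2)))) (range hb.wk) hrow
  have := flatMap (γ := fun _ => ℕ) (eγ := fun _ => unary) (l := fun i => List.range (s i))
    (δ := fun i => List (c i).F) (eδ := fun i r => encList (r.map (c i).enc))
    (f := fun i j => (List.range (b i)).map fun k => TreeMachine.row (m i) (s' i)
      (f i * (x i ^ k * y i ^ j), t i (X ^ (k + b i * j)))) (range hs) hmap
  refine this.congr fun i => ?_
  rw [← range_flatMap_map]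
  congr 2
  rw [List.map_flatMap]
  refine List.flatMap_congr fun j _ => ?_
  rw [List.map_map]
  refine List.map_congr_left fun k hk => ?_
  rw [List.mem_range] at hk
  rw [Function.comp_apply, rowMap_X_pow, Nat.add_mul_mod_self_left, Nat.mod_eq_of_lt hk,
    Nat.add_mul_div_left _ _ (hb0 i), Nat.div_eq_of_lt hk, zero_add]

theorem kron_X (hc : PT e fun i => (c i).pres) (hm : PT e fun i => unary (m i))
    (hn : PT e fun i => unary (n i)) (hα : PT e fun i => (c i).enc (α i)) :
    PT e fun i => (c i).encV (m i) (X ^ width (n i) + C (α i)) :=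
  V_add hc (V_pow hc hm (V_X hc hm) (unary_width hn)) (V_C hc hm hα)

theorem kron_Y (hc : PT e fun i => (c i).pres) (hm : PT e fun i => unary (m i))
    (hβ : PT e fun i => (c i).enc (β i)) : PT e fun i => (c i).encV (m i) (X + C (β i)) :=
  V_add hc (V_X hc hm) (V_C hc hm hβ)

theorem tracked_rows {f : ∀ i, (c i).F[X]} (hc : PT e fun i => (c i).pres)
    (hn : PT e fun i => unary (n i)) (hn0 : ∀ i, 0 < n i)
    (hα : PT e fun i => (c i).enc (α i)) (hβ : PT e fun i => (c i).enc (β i))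
    (hf : PT e fun i => (c i).encV (prec (n i) * width (n i)) (f i)) :
    PT e fun i => encList ((((List.range (n i * n i)).map fun k =>
      BivariateSplit.rowMap (f i) (X ^ width (n i) + C (α i)) (X + C (β i)) (n i) LinearMap.id
        (X ^ k)).map (TreeMachine.row (prec (n i) * width (n i)) (n i * n i))).map
          fun r => encList (r.map (c i).enc)) :=
  rowMap hc (unary_total hn) hn hn0 hn hf (kron_X hc (unary_total hn) hn hα)
    (kron_Y hc (unary_total hn) hβ)
    (V_pow hc.wk (unary_mul hn hn).wk (V_X hc.wk (unary_mul hn hn).wk) (of_node_right id))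

theorem firstDep_sepRows {f g : ∀ i, (c i).F[X]} (hc : PT e fun i => (c i).pres)
    (hn : PT e fun i => unary (n i)) (hn0 : ∀ i, 0 < n i)
    (hα : PT e fun i => (c i).enc (α i)) (hβ : PT e fun i => (c i).enc (β i))
    (hf : PT e fun i => (c i).encV (prec (n i) * width (n i)) (f i))
    (hg : PT e fun i => (c i).encV (prec (n i) * width (n i)) (g i)) :
    PT e fun i => encList ((TreeMachine.firstDep (prec (n i) * width (n i))
      ((sepRows (n i) (α i) (β i) (f i) (g i)).map
        (TreeMachine.row (prec (n i) * width (n i)) (n i * n i)))).map (c i).enc) := by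
  have hm := unary_total hn
  have h1 := rowMap (c := c) (m := fun i => prec (n i) * width (n i)) (b := fun i => prec (n i))
    (s := fun i => cofDeg (n i)) (s' := fun i => n i * n i) (t := fun _ => 0)
    hc hm (unary_prec hn)
    (fun i => by have := hn0 i; simp only [prec]; positivity) (unary_cofDeg hn) hf
    (V_pow hc hm (V_X hc hm) (unary_width hn)) (V_X hc hm)
    (V_zero hc.wk (unary_mul hn hn).wk)
  have h2 := tracked_rows hc hn hn0 hα hβ (V_pow hc hm hg (unary_mul hn (unary_prec hn)))
  refine firstDep hc hm ((append (eγ := fun i (r : List (c i).F) => encList (r.map (c i).enc))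
    h1 h2).congr fun i => ?_)
  simp only [sepRows, List.map_append]

theorem firstDep_quotRows {f w : ∀ i, (c i).F[X]} (hc : PT e fun i => (c i).pres)
    (hn : PT e fun i => unary (n i)) (hn0 : ∀ i, 0 < n i)
    (hα : PT e fun i => (c i).enc (α i)) (hβ : PT e fun i => (c i).enc (β i))
    (hf : PT e fun i => (c i).encV (prec (n i) * width (n i)) (f i))
    (hw : PT e fun i => (c i).encV (prec (n i) * width (n i)) (w i)) :
    PT e fun i => encList ((TreeMachine.firstDep (prec (n i) * width (n i))
      ((quotRows (n i) (α i) (β i) (f i) (w i)).map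
        (TreeMachine.row (prec (n i) * width (n i)) (n i * n i)))).map (c i).enc) := by
  have h1 := tracked_rows hc hn hn0 hα hβ hw
  have h2 := row (s := fun i => n i * n i) hf (V_zero hc (unary_mul hn hn))
  refine firstDep hc (unary_total hn)
    ((append (eγ := fun i (r : List (c i).F) => encList (r.map (c i).enc)) h1
      (singleton (eγ := fun i (r : List (c i).F) => encList (r.map (c i).enc)) h2)).congr
        fun i => ?_)
  simp only [quotRows, List.map_append, List.map_cons, List.map_nil]

/-- Smallness keeps the blocks of the packed polynomial apart, so cutting it into `n` pieces of
length `n` recovers the coefficients with respect to `Y`. -/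
theorem chunks {W : ∀ i, (c i).F[X][Y]} (hn : PT e fun i => unary (n i))
    (hW : ∀ i, Small (n i) (W i))
    (h : PT e fun i => encList ((vec (n i * n i) (pack (n i) (W i))).map (c i).enc)) :
    PT e fun i => encList ((vec (n i) (W i)).map fun q => encList ((vec (n i) q).map (c i).enc)) := by
  have h1 : PT (fun q : Σ _ : ι, ℕ => .node (e q.1) (unary q.2)) fun q => encList
      ((((vec (n q.1 * n q.1) (pack (n q.1) (W q.1))).drop (n q.1 * q.2)).take (n q.1)).map
        (c q.1).enc) :=
    take hn.wk (drop (unary_mul hn.wk (of_node_right id)) h.wk)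
  have h2 := map (γ := fun _ => ℕ) (eγ := fun _ => unary) (l := fun i => List.range (n i))
    (δ := fun i => List (c i).F) (eδ := fun i r => encList (r.map (c i).enc))
    (f := fun i j => ((vec (n i * n i) (pack (n i) (W i))).drop (n i * j)).take (n i))
    (range hn) h1
  refine h2.congr fun i => ?_
  rw [vec.eq_def (n i) (W i), List.map_map, List.map_map]
  congr 1
  refine List.map_congr_left fun j hj => ?_
  rw [List.mem_range] at hj
  simp only [Function.comp_apply]
  congr 2
  have hb : n i * j + n i ≤ n i * n i := by
    calc n i * j + n i = n i * (j + 1) := by ring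
      _ ≤ _ := by gcongr; omega
  apply List.ext_getElem
  · simp; omega
  · intro k h1 h2
    rw [length_vec] at h2
    rw [List.getElem_take, List.getElem_drop, getElem_vec, getElem_vec, add_comm,
      coeff_subst_X_pow (hW i).coeff_natDegree h2]

theorem kron {P : ∀ i, (c i).F[X][Y]} {N : ι → ℕ} {M : ∀ i, (c i).F[X] → ℕ}
    (hc : PT e fun i => (c i).pres) (hn : PT e fun i => unary (n i))
    (hα : PT e fun i => (c i).enc (α i)) (hβ : PT e fun i => (c i).enc (β i))
    (hP : PT e fun i => encList ((vec (N i) (P i)).map fun q =>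
      encList ((vec (M i q) q).map (c i).enc)))
    (hN : ∀ i, (P i).degree < N i)
    (hM : ∀ i (q : (c i).F[X]), q ∈ Set.range (P i).coeff → q.degree < M i q) :
    PT e fun i => (c i).encV (prec (n i) * width (n i)) (kron (n i) (α i) (β i) (P i)) :=
  V_subst hc (unary_total hn) (kron_X hc (unary_total hn) hn hα) (kron_Y hc (unary_total hn) hβ)
    hP hN hM

theorem _root_.BivariateSplit.Small.degree_lt {F : Type*} [Field F] {n : ℕ} {W : F[X][Y]}
    (h : Small n W) : W.degree < n :=
  degree_le_natDegree.trans_lt (by exact_mod_cast h.1)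

theorem _root_.BivariateSplit.Small.degree_coeff_lt {F : Type*} [Field F] {n : ℕ} {W : F[X][Y]}
    (h : Small n W) (q : F[X]) (hq : q ∈ Set.range W.coeff) : q.degree < n := by
  obtain ⟨j, rfl⟩ := hq
  exact degree_le_natDegree.trans_lt (by exact_mod_cast h.coeff_natDegree j)

theorem kron_of_pack {W : ∀ i, (c i).F[X][Y]} (hc : PT e fun i => (c i).pres)
    (hn : PT e fun i => unary (n i)) (hα : PT e fun i => (c i).enc (α i))
    (hβ : PT e fun i => (c i).enc (β i)) (hW : ∀ i, Small (n i) (W i))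
    (h : PT e fun i => (c i).encV (n i * n i) (pack (n i) (W i))) :
    PT e fun i => (c i).encV (prec (n i) * width (n i)) (BivariateSplit.kron (n i) (α i) (β i) (W i)) :=
  kron hc hn hα hβ (N := n) (M := fun i _ => n i) (chunks hn hW h) (fun i => (hW i).degree_lt)
    fun i => (hW i).degree_coeff_lt

/-- The encoding admits no trailing zeros, neither within a coefficient nor among the coefficients,
so trimming takes place on both levels. -/
theorem encBiv_of_pack {W : ∀ i, (c i).F[X][Y]} (hn : PT e fun i => unary (n i))
    (hW : ∀ i, Small (n i) (W i))
    (h : PT e fun i => (c i).encV (n i * n i) (pack (n i) (W i))) :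
    PT e fun i => encBiv (c i).pb (W i) := by
  have h1 := chunks hn hW h
  have h2 := map (γ := fun i => List (c i).F) (eγ := fun i r => encList (r.map (c i).enc))
    (l := fun i => (vec (n i) (W i)).map (vec (n i)))
    (δ := fun i => List (c i).F) (eδ := fun i r => encList (r.map (c i).enc))
    (f := fun _ => TreeMachine.trim) (h1.congr fun i => by rw [List.map_map]; rfl)
    (trim (of_node_right id) (of_node_right id).field_eq_zero)
  have h3 : PT e fun i => encList ((vec (n i) (W i)).map (encPoly (c i).enc)) := by
    refine h2.congr fun i => ?_
    rw [List.map_map, List.map_map]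
    congr 1
    refine List.map_congr_left fun q hq => ?_
    simp only [Function.comp_apply]
    rw [trim_vec, encPoly_eq]
    refine (hW i).degree_coeff_lt q ?_
    obtain ⟨j, -, rfl⟩ := List.mem_map.1 hq
    exact ⟨j, rfl⟩
  have h4 : PT (fun q : Σ i, (c i).F[X] => .node (e q.1) (encPoly (c q.1).enc q.2))
      fun q => encProp (q.2 = 0) := by
    refine (eq_nil (eγ := fun q : Σ i, (c i).F[X] => (c q.1).enc)
      (l := fun q => vec q.2.degree.succ q.2) ?_).congr fun q => ?_
    · exact (of_node_right id).congr fun q => by rw [encPoly_eq]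
    · congr 1
      rw [← List.length_eq_zero_iff, length_vec, eq_iff_iff]
      constructor
      · intro h
        by_contra h'
        rw [withBotSucc_degree_eq_natDegree_add_one h'] at h
        omega
      · rintro h; rw [h, degree_zero]; rfl
  refine (trim h3 h4).congr fun i => ?_
  rw [trim_vec _ _ (hW i).degree_lt, encBiv, encPoly_eq]
  rfl

end PT
end TreeMachine

/-! ### Scaling and the required properties of the output. -/

namespace BivariateSplit

section output
variable {F : Type*} [Field F] {α β : F}

/-- The required properties of the output. -/
def IsSplit (P : F[X][Y]) (α β : F) (P₁ P₂ : F[X][Y]) : Prop :=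
  (∀ S : Multiset F[X][Y], IsFactorization S P →
    (∃ R₁ R₂ : F[X][Y],
      P₁ = partA S α β * R₁ ∧ P₂ = partB S α β * R₂ ∧ R₁ * R₂ ∣ partD S α β) ∧
    (P.Monic → (∀ Q ∈ S, Q.Monic) → P₁ = partA S α β ∧ P₂ = partB S α β)) ∧
  (StableA P α β → P₁ = P ∧ P₂ = 1) ∧
  (StableB P α β → P₁ = 1 ∧ P₂ = P)

/-- Restriction preserves the degree of a monic polynomial, so a monic factor of type D has degree
zero in `Y`; it is then `1`, which is not irreducible. -/
theorem partD_eq_one {S : Multiset F[X][Y]} (hS : ∀ Q ∈ S, Irreducible Q)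
    (hm : ∀ Q ∈ S, Q.Monic) : partD S α β = 1 := by
  classical
  rw [partD, Multiset.filter_eq_nil.2, Multiset.prod_zero]
  rintro Q hQ ⟨-, h⟩
  rw [restrict, (hm Q hQ).natDegree_map] at h
  have := (hm Q hQ).natDegree_eq_zero.1 h
  exact (hS Q hQ).not_isUnit (this ▸ isUnit_one)

theorem partA_dvd {S : Multiset F[X][Y]} {P : F[X][Y]} (hS : IsFactorization S P) :
    partA S α β ∣ P := by
  classical
  exact (Multiset.prod_dvd_prod_of_le (Multiset.filter_le _ S)).trans hS.2.dvd

theorem partB_dvd {S : Multiset F[X][Y]} {P : F[X][Y]} (hS : IsFactorization S P) :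
    partB S α β ∣ P := by
  classical
  exact (Multiset.prod_dvd_prod_of_le (Multiset.filter_le _ S)).trans hS.2.dvd

theorem monic_filter_prod {S : Multiset F[X][Y]} (hm : ∀ Q ∈ S, Q.Monic) (p : F[X][Y] → Prop)
    [DecidablePred p] : (S.filter p).prod.Monic := by
  have := monic_multiset_prod_of_monic (S.filter p) (fun Q => Q)
    fun Q hQ => hm Q (Multiset.mem_filter.1 hQ).1
  rwa [Multiset.map_id'] at this

/-- If `P` does not vanish at the point, neither does any factor. Hence there are no factors of type
A, every factor is of type B or D, and the constant can be absorbed in `R₂`. -/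
theorem isSplit_of_ne_zero {P : F[X][Y]} (h : P.evalEval α β ≠ 0) : IsSplit P α β 1 P := by
  classical
  have hA : ∀ S, IsFactorization S P → partA S α β = 1 := by
    intro S hS
    rw [partA, Multiset.filter_eq_nil.2, Multiset.prod_zero]
    intro Q hQ hQA
    obtain ⟨m, hm, γ, hγ, h1⟩ := isTypeA_iff.1 hQA
    obtain ⟨R, rfl⟩ := (Multiset.dvd_prod hQ).trans hS.2.dvd
    rw [← eval_localize, map_mul, eval_mul, h1] at h
    simp [show m ≠ 0 by omega] at h
  have hBD : ∀ S, IsFactorization S P → partB S α β * partD S α β = S.prod := by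
    intro S hS
    rw [partB, partD, ← Multiset.prod_add, Multiset.filter_add_filter, Multiset.filter_eq_self.2,
      Multiset.filter_eq_nil.2, add_zero]
    · rintro Q - ⟨h1, h2⟩
      have := h1.2; have := h2.2; omega
    · intro Q hQ
      obtain ⟨R, rfl⟩ := (Multiset.dvd_prod hQ).trans hS.2.dvd
      have h1 : Q.evalEval α β ≠ 0 := by
        rw [← eval_localize, map_mul, eval_mul, eval_localize] at h
        exact left_ne_zero_of_mul h
      rcases Nat.eq_zero_or_pos (restrict α Q).natDegree with h2 | h2
      · exact Or.inr ⟨h1, h2⟩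
      · exact Or.inl ⟨h1, h2⟩
  refine ⟨fun S hS => ⟨?_, fun hP hm => ?_⟩, ?_, fun _ => ⟨rfl, rfl⟩⟩
  · obtain ⟨a, ha, h1⟩ := exists_C_C_mul_of_associated hS.2
    refine ⟨1, C (C a) * partD S α β, by rw [hA S hS, mul_one], ?_, ?_⟩
    · rw [h1, ← hBD S hS]; ring
    · rw [one_mul]; exact (associated_C_C_mul ha _).dvd
  · refine ⟨(hA S hS).symm, ?_⟩
    have h1 := hBD S hS
    rw [partD_eq_one hS.1 hm, mul_one] at h1
    rw [h1]
    refine (eq_of_monic_of_associated ?_ hP hS.2).symm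
    have := monic_multiset_prod_of_monic S (fun Q => Q) hm
    rwa [Multiset.map_id'] at this
  · rintro ⟨-, γ, -, r, hr, h1⟩
    rw [evalEval_eq, h1] at h
    simp [show r ≠ 0 by omega] at h

theorem leadingCoeff_pack_C_C_mul (n : ℕ) (a : F) (Q : F[X][Y]) :
    (pack n (C (C a) * Q)).leadingCoeff = a * (pack n Q).leadingCoeff := by
  rw [map_mul, subst_C_C, leadingCoeff_mul, leadingCoeff_C]

theorem pack_ne_zero {n : ℕ} {Q : F[X][Y]} (hQ : Small n Q) (h0 : Q ≠ 0) : pack n Q ≠ 0 := by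
  intro h
  have hn : 0 < n := by have := hQ.1; omega
  rw [← unpack_subst hn hQ.coeff_natDegree, h, map_zero] at h0
  exact h0 rfl

/-- For a small monic polynomial the power `Y ^ d` with `d` its degree is the top monomial after
packing. -/
theorem leadingCoeff_pack_of_monic {n : ℕ} {Q : F[X][Y]} (hQ : Small n Q) (hm : Q.Monic) :
    (pack n Q).leadingCoeff = 1 := by
  have hn : 0 < n := by have := hQ.1; omega
  refine monic_of_natDegree_le_of_coeff_eq_one (0 + n * Q.natDegree) ?_ ?_
  · rw [natDegree_le_iff_coeff_eq_zero]
    intro k hk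
    have h := coeff_subst_X_pow hQ.coeff_natDegree (Nat.mod_lt k hn) (j := k / n)
    rw [Nat.mod_add_div] at h
    rw [h]
    have hk' : Q.natDegree ≤ k / n := (Nat.le_div_iff_mul_le hn).2 (by rw [mul_comm]; omega)
    rcases hk'.lt_or_eq with h1 | h1
    · rw [coeff_eq_zero_of_natDegree_lt (p := Q) h1, coeff_zero]
    · rw [← h1, hm.coeff_natDegree, coeff_one, if_neg]
      intro h2
      have := Nat.mod_add_div k n
      rw [← h1, h2] at this
      omega
  · rw [coeff_subst_X_pow hQ.coeff_natDegree hn, hm.coeff_natDegree, coeff_one_zero]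

/-- The parts are known only up to constants. The first output is scaled to the packed leading
coefficient of `P`, the second to `1`; these values are right both when everything is monic and when
the output must be `(P, 1)`. Since `P` vanishes at the point, the second stable case does not arise.
-/
theorem isSplit_of_eq_zero {n : ℕ} {P T B : F[X][Y]} (hP : Small n P) (h0 : P ≠ 0)
    (hT : Small n T) (hB : Small n B) (hT0 : T ≠ 0) (hB0 : B ≠ 0)
    (hTB : ∀ S, IsFactorization S P → Associated T (partA S α β * partD S α β) ∧
        Associated B (partB S α β))
    (h : P.evalEval α β = 0) :
    IsSplit P α β (C (C ((pack n P).leadingCoeff * (pack n T).leadingCoeff⁻¹)) * T)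
      (C (C (pack n B).leadingCoeff⁻¹) * B) := by
  classical
  have hTl := leadingCoeff_ne_zero.2 (pack_ne_zero hT hT0)
  have hBl := leadingCoeff_ne_zero.2 (pack_ne_zero hB hB0)
  have hPl := leadingCoeff_ne_zero.2 (pack_ne_zero hP h0)
  set P₁ := C (C ((pack n P).leadingCoeff * (pack n T).leadingCoeff⁻¹)) * T with hP₁
  set P₂ := C (C (pack n B).leadingCoeff⁻¹) * B with hP₂
  have hl₁ : (pack n P₁).leadingCoeff = (pack n P).leadingCoeff := by
    rw [hP₁, leadingCoeff_pack_C_C_mul, mul_assoc, inv_mul_cancel₀ hTl, mul_one]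
  have hl₂ : (pack n P₂).leadingCoeff = 1 := by
    rw [hP₂, leadingCoeff_pack_C_C_mul, inv_mul_cancel₀ hBl]
  have ha₁ : Associated P₁ T := associated_C_C_mul (mul_ne_zero hPl (inv_ne_zero hTl)) _
  have ha₂ : Associated P₂ B := associated_C_C_mul (inv_ne_zero hBl) _
  -- Associated polynomials differ by a constant, which the packed leading coefficient detects.
  have key : ∀ {A A' : F[X][Y]}, Small n A → A ≠ 0 → Associated A' A →
      (pack n A').leadingCoeff = (pack n A).leadingCoeff → A' = A := by
    intro A A' hA hA0 hAA hl
    obtain ⟨a, ha, rfl⟩ := exists_C_C_mul_of_associated hAA.symm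
    rw [leadingCoeff_pack_C_C_mul, mul_eq_right₀ (leadingCoeff_ne_zero.2 (pack_ne_zero hA hA0))]
      at hl
    rw [hl, C_1, C_1, one_mul]
  have h1s : Small n (1 : F[X][Y]) := hP.of_dvd h0 (one_dvd _)
  refine ⟨fun S hS => ⟨?_, fun hPm hm => ?_⟩, fun hst => ?_, fun hst => absurd h hst.2⟩
  · obtain ⟨h1, h2⟩ := hTB S hS
    obtain ⟨a, ha, hPa⟩ := exists_C_C_mul_of_associated (ha₁.trans h1).symm
    obtain ⟨b, hb, hPb⟩ := exists_C_C_mul_of_associated (ha₂.trans h2).symm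
    refine ⟨C (C a) * partD S α β, C (C b), by rw [hPa]; ring, by rw [hPb]; ring, ?_⟩
    rw [mul_comm, ← mul_assoc, ← C_mul, ← C_mul]
    exact (associated_C_C_mul (mul_ne_zero hb ha) _).dvd
  · obtain ⟨h1, h2⟩ := hTB S hS
    rw [partD_eq_one hS.1 hm, mul_one] at h1
    have hA : (partA S α β).Monic := by rw [partA]; exact monic_filter_prod hm _
    have hB : (partB S α β).Monic := by rw [partB]; exact monic_filter_prod hm _
    have hAs := hP.of_dvd h0 (partA_dvd (α := α) (β := β) hS)
    have hBs := hP.of_dvd h0 (partB_dvd (α := α) (β := β) hS)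
    constructor
    · refine key hAs hA.ne_zero (ha₁.trans h1) ?_
      rw [hl₁, leadingCoeff_pack_of_monic hP hPm, leadingCoeff_pack_of_monic hAs hA]
    · refine key hBs hB.ne_zero (ha₂.trans h2) ?_
      rw [hl₂, leadingCoeff_pack_of_monic hBs hB]
  · obtain ⟨-, γ, hγ, r, hr, hPr⟩ := hst
    have hlP : localize α β P = C γ * X ^ r := by rw [localize_apply, hPr]; simp
    obtain ⟨S, hS⟩ := exists_isFactorization h0
    obtain ⟨h1, h2⟩ := hTB S hS
    -- In the first stable case the localization of `P` is a monomial, so every factor is of type A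
    -- or D; thus `T` is associated to `P` and there are no factors of type B.
    have hall : ∀ Q ∈ S, ∃ M, localize α β Q ∣ X ^ M := by
      intro Q hQ
      refine ⟨r, ?_⟩
      have := map_dvd (localize α β) ((Multiset.dvd_prod hQ).trans hS.2.dvd)
      rw [hlP] at this
      exact ((isUnit_C.2 (IsUnit.mk0 _ hγ)).dvd_mul_left).1 this
    rw [partA_mul_partD, Multiset.filter_eq_self.2 hall] at h1
    have hB1 : partB S α β = 1 := by
      rw [partB, Multiset.filter_eq_nil.2, Multiset.prod_zero]
      intro Q hQ hQB
      rw [isTypeB_iff] at hQB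
      rcases isTypeA_or_isTypeD_iff.2 (hall Q hQ) with hA | hD
      · obtain ⟨m, hm, δ, -, h3⟩ := isTypeA_iff.1 hA
        rw [h3] at hQB
        simp [show m ≠ 0 by omega] at hQB
      · have := (isTypeD_iff.1 hD).2; omega
    rw [hB1] at h2
    refine ⟨key hP h0 (ha₁.trans (h1.trans hS.2)) hl₁, key h1s one_ne_zero (ha₂.trans h2) ?_⟩
    rw [hl₂, leadingCoeff_pack_of_monic h1s monic_one]

theorem X_pow_one_dvd_kron_iff {n : ℕ} {P : F[X][Y]} (hP : Small n P) :
    X ^ 1 ∣ kron n α β P ↔ P.evalEval α β = 0 := by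
  have hs := (hP.shift α β).1.trans (lt_width n)
  have h := coeff_subst_pow_X hs (i := 0) (j := 0) (by omega)
  rw [subst_shift, mul_zero, add_zero] at h
  rw [pow_one, X_dvd_iff, kron, h, ← eval_localize, ← restrict_zero_shift, restrict,
    ← coeff_zero_eq_eval_zero, coeff_map, coe_evalRingHom, coeff_zero_eq_eval_zero]

/-- The restriction to `X = α` is the lowest block of the packed polynomial, so truncation after
`width n` coefficients computes it. -/
theorem coeff_localize {n : ℕ} {P : F[X][Y]} (hP : Small n P) (k : ℕ) :
    (localize α β P).coeff k = if k < width n then (kron n α β P).coeff k else 0 := by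
  have hs := (hP.shift α β).1.trans (lt_width n)
  split
  · rename_i hk
    have h := coeff_subst_pow_X hs (i := 0) hk
    rw [subst_shift, mul_zero, add_zero] at h
    rw [kron, h, ← restrict_zero_shift, restrict, coeff_map, coe_evalRingHom,
      coeff_zero_eq_eval_zero]
  · refine coeff_eq_zero_of_natDegree_lt (lt_of_le_of_lt (natDegree_localize_le α β P) ?_)
    have := hP.1.trans (lt_width n)
    omega

end output
end BivariateSplit

namespace TreeMachine

/-! ### The program -/

universe u

/-- An input of the procedure. -/
structure Input where
  c : FieldPres.{u}
  P : c.F[X][Y]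
  ne : P ≠ 0
  α : c.F
  β : c.F

namespace Input

noncomputable def enc (i : Input.{u}) : Data := encInput i.c.pb i.P i.α i.β

/-- The lists of coefficients. -/
noncomputable def rows (i : Input.{u}) : List (List i.c.F) :=
  (vec i.P.degree.succ i.P).map fun q => vec q.degree.succ q

/-- A bound for all the degrees. -/
noncomputable def bound (i : Input.{u}) : ℕ := i.rows.length + i.rows.flatten.length + 1

theorem natDegree_lt_length (i : Input.{u}) : i.P.natDegree < i.rows.length := by
  rw [rows, List.length_map, length_vec, withBotSucc_degree_eq_natDegree_add_one i.ne]
  exact Nat.lt_succ_self _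

/-- The first separation uses a polynomial `g` of degree one, which has to be below the bound. -/
theorem one_lt_bound (i : Input.{u}) : 1 < i.bound := by
  have := i.natDegree_lt_length
  rw [bound]; omega

theorem small (i : Input.{u}) : Small i.bound i.P := by
  have h1 := i.natDegree_lt_length
  refine small_of_coeff (by rw [bound]; omega) fun j => ?_
  by_cases h0 : i.P.coeff j = 0
  · rw [h0, natDegree_zero, bound]; omega
  have hj : j < i.P.natDegree + 1 := Nat.lt_succ_of_le (le_natDegree_of_ne_zero h0)
  have hmem : vec (i.P.coeff j).degree.succ (i.P.coeff j) ∈ i.rows := by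
    rw [rows, List.mem_map]
    refine ⟨_, ?_, rfl⟩
    rw [withBotSucc_degree_eq_natDegree_add_one i.ne, vec]
    exact List.mem_map.2 ⟨j, List.mem_range.2 hj, rfl⟩
  have h2 := (List.sublist_flatten_of_mem hmem).length_le
  rw [length_vec, withBotSucc_degree_eq_natDegree_add_one h0] at h2
  rw [bound]; omega

theorem enc_pres : PT enc fun i => i.c.pres :=
  (PT.id.left.node PT.id.right.left).congr fun _ => rfl

theorem enc_poly : PT enc fun i => encBiv i.c.pb i.P := PT.id.right.right.left

theorem enc_α : PT enc fun i => i.c.enc i.α := PT.id.right.right.right.left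

theorem enc_β : PT enc fun i => i.c.enc i.β := PT.id.right.right.right.right.left

theorem enc_coeffs : PT enc fun i => encList ((vec i.P.degree.succ i.P).map fun q =>
    encList ((vec q.degree.succ q).map i.c.enc)) :=
  enc_poly.congr fun i => by
    rw [encBiv, encPoly_eq]
    congr 1
    exact List.map_congr_left fun q _ => encPoly_eq _ _

theorem enc_bound : PT enc fun i : Input.{u} => unary i.bound := by
  have h : PT enc fun i : Input.{u} => encList (i.rows.map fun r => encList (r.map i.c.enc)) :=
    enc_coeffs.congr fun i => by rw [rows, List.map_map]; rfl
  exact PT.unary_add (PT.unary_add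
    (PT.length (eγ := fun (i : Input.{u}) (r : List i.c.F) => encList (r.map i.c.enc)) h)
    (PT.length (eγ := fun i : Input.{u} => i.c.enc) (PT.flatten (eγ := fun i : Input.{u} => i.c.enc) h)))
    (PT.unary_const 1)

/-- The polynomials chosen from `exists_split` are names for results of the algorithm: the equations
there identify their coefficient vectors with values of `strip` and `firstDep`, which are computed
in polynomial time. -/
theorem exists_output : ∃ P₁ P₂ : ∀ i : Input.{u}, i.c.F[X][Y],
    (∀ i, IsSplit i.P i.α i.β (P₁ i) (P₂ i)) ∧
      PT enc fun i => encOutput i.c.pb (P₁ i) (P₂ i) := by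
  classical
  choose Q W V T B hQ hW hV hT hB hT0 hB0 hstrip hsep hsep₂ hquot hquot₂ hTB using
    fun i : Input.{u} => exists_split i.one_lt_bound i.small i.ne i.α i.β
  have hn0 : ∀ i : Input.{u}, 0 < i.bound := fun i => by have := i.one_lt_bound; omega
  have hc := enc_pres.{u}
  have hn := enc_bound.{u}
  have hm := PT.unary_total hn
  have hnn := PT.unary_mul hn hn
  have hα := enc_α.{u}
  have hβ := enc_β.{u}
  have hnm : ∀ i : Input.{u}, width i.bound * i.bound ≤ prec i.bound * width i.bound := fun i => by
    rw [mul_comm]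
    gcongr
    rw [prec]
    have := hn0 i
    nlinarith
  have hkdeg : ∀ (i : Input.{u}) (S : i.c.F[X][Y]), Small i.bound S →
      (kron i.bound i.α i.β S).degree < (prec i.bound * width i.bound : ℕ) := fun i S hS =>
    (degree_kron_lt hS).trans_le (by exact_mod_cast hnm i)
  have hP : PT enc fun i : Input.{u} => i.c.encV (prec i.bound * width i.bound)
      (kron i.bound i.α i.β i.P) :=
    PT.kron hc hn hα hβ enc_coeffs (fun i => degree_lt_succ _) fun i q _ => degree_lt_succ q
  have hPp : PT enc fun i : Input.{u} => i.c.encV (i.bound * i.bound) (pack i.bound i.P) :=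
    PT.V_subst hc hnn (PT.V_X hc hnn) (PT.V_pow hc hnn (PT.V_X hc hnn) hn) enc_coeffs
      (fun i => degree_lt_succ _) fun i q _ => degree_lt_succ q
  have hQ' : PT enc fun i : Input.{u} => i.c.encV (prec i.bound * width i.bound)
      (kron i.bound i.α i.β (Q i)) :=
    (PT.V_strip hc hm (PT.unary_width hn) hn (fun i => by
      have := hn0 i
      refine le_mul_of_one_le_left (Nat.zero_le _) ?_
      rw [prec]; nlinarith) hP fun i => hkdeg i _ i.small).congr fun i => by rw [hstrip]
  have hW' : PT enc fun i : Input.{u} => i.c.encV (i.bound * i.bound) (pack i.bound (W i)) :=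
    PT.of_V_list (PT.firstDep_sepRows hc hn hn0 hα hβ hQ' (PT.V_X hc hm)) hsep
  have hWk := PT.kron_of_pack hc hn hα hβ hW hW'
  have hWl : PT enc fun i : Input.{u} => i.c.encV (prec i.bound * width i.bound)
      (localize i.α i.β (W i)) :=
    PT.V_of_trunc hc hm (PT.unary_width hn) hWk fun i k => coeff_localize (hW i) k
  have hG : PT enc fun i : Input.{u} => i.c.encV (prec i.bound * width i.bound)
      (strip 1 i.bound (localize i.α i.β (W i))) :=
    PT.V_strip hc hm (PT.unary_const 1) hn (fun i => by
      have h1 := hn0 i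
      have h2 := lt_width i.bound
      have h3 := hnm i
      nlinarith) hWl fun i => by
        refine degree_le_natDegree.trans_lt ?_
        have h1 := (natDegree_localize_le i.α i.β (W i)).trans_lt (hW i).1
        have h2 := lt_width i.bound
        have h3 := hnm i
        exact_mod_cast (show (localize i.α i.β (W i)).natDegree < prec i.bound * width i.bound by
          nlinarith)
  have hV' : PT enc fun i : Input.{u} => i.c.encV (i.bound * i.bound) (pack i.bound (V i)) :=
    PT.of_V_list (PT.firstDep_sepRows hc hn hn0 hα hβ hWk hG) hsep₂
  have hVk := PT.kron_of_pack hc hn hα hβ hV hV'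
  have hT' : PT enc fun i : Input.{u} => i.c.encV (i.bound * i.bound) (pack i.bound (T i)) :=
    PT.of_V_list (PT.firstDep_quotRows hc hn hn0 hα hβ hQ' hWk) hquot
  have hB' : PT enc fun i : Input.{u} => i.c.encV (i.bound * i.bound) (pack i.bound (B i)) :=
    PT.of_V_list (PT.firstDep_quotRows hc hn hn0 hα hβ hWk hVk) hquot₂
  have hsmul : ∀ (i : Input.{u}) (a : i.c.F) (S : i.c.F[X][Y]), Small i.bound S →
      Small i.bound (C (C a) * S) := fun i a S hS => by
    refine small_of_coeff ((natDegree_C_mul_le _ _).trans_lt hS.1) fun j => ?_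
    rw [coeff_C_mul]
    exact (natDegree_C_mul_le _ _).trans_lt (hS.coeff_natDegree j)
  have hscale : ∀ (a : ∀ i : Input.{u}, i.c.F) (S : ∀ i : Input.{u}, i.c.F[X][Y]),
      (∀ i, Small i.bound (S i)) → PT enc (fun i => i.c.enc (a i)) →
      PT enc (fun i => i.c.encV (i.bound * i.bound) (pack i.bound (S i))) →
      PT enc fun i => encBiv i.c.pb (C (C (a i)) * S i) := fun a S hS ha h =>
    PT.encBiv_of_pack hn (fun i => hsmul i _ _ (hS i)) ((PT.V_C_mul hc ha h).congr fun i => by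
      rw [map_mul, subst_C_C])
  have hlT := PT.V_leadingCoeff hc hT' fun i => (hT i).degree_subst_lt
  have hlB := PT.V_leadingCoeff hc hB' fun i => (hB i).degree_subst_lt
  have hlP := PT.V_leadingCoeff hc hPp fun i => i.small.degree_subst_lt
  have ho₁ := hscale _ T hT (PT.field_mul hc hlP (PT.field_inv hc hlT)) hT'
  have ho₂ := hscale _ B hB (PT.field_inv hc hlB) hB'
  have ho : PT enc fun i : Input.{u} => encBiv i.c.pb (1 : i.c.F[X][Y]) :=
    (PT.encBiv_of_pack hn (W := fun i : Input.{u} => 1)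
      (fun i => i.small.of_dvd i.ne (one_dvd _))
      ((PT.V_one hc hnn).congr fun i => by rw [map_one]))
  -- Whether `P(α, β) = 0` is read off from the constant coefficient of the substituted polynomial.
  have hcond : PT enc fun i : Input.{u} => encProp (X ^ 1 ∣ kron i.bound i.α i.β i.P) :=
    (PT.all (p := fun _ t => t = 0) (PT.take (PT.unary_const 1) (PT.V_list hP))
      (PT.of_node_right PT.id).field_eq_zero).congr fun i => by
        rw [take_vec, min_eq_left, forall_vec_eq_zero]
        have h1 := hn0 i
        have h2 := lt_width i.bound
        have h3 := hnm i
        nlinarith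
  have hout := PT.ite (eα := fun i (R : i.c.F[X][Y] × i.c.F[X][Y]) => encOutput i.c.pb R.1 R.2)
    (a := fun i : Input.{u} => (C (C ((pack i.bound i.P).leadingCoeff *
      (pack i.bound (T i)).leadingCoeff⁻¹)) * T i, C (C (pack i.bound (B i)).leadingCoeff⁻¹) * B i))
    (b := fun i : Input.{u} => (1, i.P)) hcond (ho₁.node ho₂) (ho.node enc_poly)
  refine ⟨_, _, fun i => ?_, hout⟩
  split
  · rename_i h
    exact isSplit_of_eq_zero i.small i.ne (hT i) (hB i) (hT0 i) (hB0 i) (hTB i)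
      ((X_pow_one_dvd_kron_iff i.small).1 h)
  · rename_i h
    exact isSplit_of_ne_zero fun h' => h ((X_pow_one_dvd_kron_iff i.small).2 h')

end Input
end TreeMachine

/-! ### Size of the input in terms of degree and field. -/

namespace TreeMachine

universe u

theorem eval_mul_le (B : ℕ[X]) (a : ℕ) {b : ℕ} (hb : 1 ≤ b) :
    B.eval (a * b) ≤ B.eval a * b ^ B.natDegree := by
  rw [eval_eq_sum_range, eval_eq_sum_range, Finset.sum_mul]
  refine Finset.sum_le_sum fun k hk => ?_
  have : k ≤ B.natDegree := Nat.lt_succ_iff.1 (Finset.mem_range.1 hk)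
  rw [mul_pow, mul_assoc]
  gcongr

theorem size_encPoly_le {R : Type*} [Semiring R] (enc : R → Data) (f : R[X]) (b : ℕ)
    (h : ∀ k, (enc (f.coeff k)).size ≤ b) :
    (encPoly enc f).size ≤ (f.natDegree + 1) * (b + 1) + 1 := by
  rw [encPoly_eq]
  refine (size_encList_le _ b ?_).trans ?_
  · simp only [List.mem_map, vec]
    rintro _ ⟨t, ⟨k, -, rfl⟩, rfl⟩; exact h k
  · rw [List.length_map, length_vec]
    gcongr
    by_cases h0 : f = 0
    · rw [h0, degree_zero]; exact Nat.zero_le _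
    · rw [withBotSucc_degree_eq_natDegree_add_one h0]

theorem natDegree_le_totalDeg {F : Type*} [Field F] (P : F[X][Y]) : P.natDegree ≤ totalDeg P := by
  by_cases h : P = 0
  · simp [h]
  · have := Finset.le_sup (f := fun j => (P.coeff j).natDegree + j) (natDegree_mem_support_of_nonzero h)
    exact (Nat.le_add_left _ _).trans this

theorem natDegree_coeff_le_totalDeg {F : Type*} [Field F] (P : F[X][Y]) (j : ℕ) :
    (P.coeff j).natDegree ≤ totalDeg P := by
  by_cases h : P.coeff j = 0
  · simp [h]
  · have := Finset.le_sup (f := fun j => (P.coeff j).natDegree + j) (mem_support_iff.2 h)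
    exact (Nat.le_add_right _ _).trans this

/-- With `s` the sum on the right, `p` takes `O(s)`, a field element `O(s ^ 2)`, a coefficient in
`F[X]` `O(s ^ 3)`, and `P` itself `O(s ^ 4)`. The degree of the field is at most `log₂ |F|` because
`p ≥ 2`. -/
theorem Input.size_enc_le (i : Input.{u}) :
    i.enc.size ≤ 200 * (totalDeg i.P + Nat.log 2 (Nat.card i.c.F) + 1) ^ 4 := by
  set s := totalDeg i.P + Nat.log 2 (Nat.card i.c.F) + 1 with hs
  have hp2 := i.c.prime.out.two_le
  have hdim0 : 0 < i.c.pb.dim := i.c.pb.dim_pos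
  have hcard : 0 < Nat.card i.c.F := by
    have := i.c.finite; exact Nat.card_pos
  have hdim : i.c.pb.dim ≤ Nat.log 2 (Nat.card i.c.F) := by
    refine Nat.le_log_of_pow_le one_lt_two ?_
    rw [i.c.natCard]; gcongr
  have hpsize : i.c.p.size ≤ s := by
    refine Nat.size_le.2 ?_
    have h1 : i.c.p ≤ Nat.card i.c.F := by
      rw [i.c.natCard]; exact Nat.le_self_pow hdim0.ne' _
    refine h1.trans_lt ((Nat.lt_pow_succ_log_self one_lt_two _).trans_le ?_)
    refine Nat.pow_le_pow_right (by norm_num) ?_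
    omega
  have hs1 : 1 ≤ s := by omega
  have hp : (encNat i.c.p).size ≤ 5 * s := (size_encNat_le _).trans (by omega)
  have hds : i.c.pb.dim + 1 ≤ s := by omega
  have h2 : s ≤ s ^ 2 := Nat.le_self_pow (by norm_num) _
  have h3 : s ^ 2 ≤ s ^ 3 := Nat.pow_le_pow_right hs1 (by norm_num)
  have h4 : s ^ 3 ≤ s ^ 4 := Nat.pow_le_pow_right hs1 (by norm_num)
  have ha : ∀ a, (i.c.enc a).size ≤ 23 * s ^ 2 := fun a => by
    refine (i.c.size_enc_le a).trans ?_
    have : i.c.pb.dim * ((encNat i.c.p).size * 4 + 1 + 1) ≤ s * (22 * s) :=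
      Nat.mul_le_mul (by omega) (by omega)
    nlinarith
  have hmin : (encPoly encZMod (minpoly (ZMod i.c.p) i.c.pb.gen)).size ≤ 23 * s ^ 2 := by
    refine (size_encPoly_le _ _ ((encNat i.c.p).size * 4 + 1) fun k => size_encZMod_le _).trans ?_
    have : ((minpoly (ZMod i.c.p) i.c.pb.gen).natDegree + 1) * ((encNat i.c.p).size * 4 + 1 + 1) ≤
        s * (22 * s) := Nat.mul_le_mul (by rw [FieldPres.natDegree_minpoly]; omega) (by omega)
    nlinarith
  have hrow : ∀ j, (encPoly i.c.enc (i.P.coeff j)).size ≤ 25 * s ^ 3 := fun j => by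
    refine (size_encPoly_le _ _ (23 * s ^ 2) fun k => ha _).trans ?_
    have hj := natDegree_coeff_le_totalDeg i.P j
    have : ((i.P.coeff j).natDegree + 1) * (23 * s ^ 2 + 1) ≤ s * (24 * s ^ 2) :=
      Nat.mul_le_mul (by omega) (by omega)
    have h5 : s * (24 * s ^ 2) = 24 * s ^ 3 := by ring
    omega
  have hpoly : (encBiv i.c.pb i.P).size ≤ 27 * s ^ 4 := by
    refine (size_encPoly_le _ _ (25 * s ^ 3) hrow).trans ?_
    have hj := natDegree_le_totalDeg i.P
    have : (i.P.natDegree + 1) * (25 * s ^ 3 + 1) ≤ s * (26 * s ^ 3) :=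
      Nat.mul_le_mul (by omega) (by omega)
    have h5 : s * (26 * s ^ 3) = 26 * s ^ 4 := by ring
    omega
  have h5 : i.enc.size = (encNat i.c.p).size +
      ((encPoly encZMod (minpoly (ZMod i.c.p) i.c.pb.gen)).size + ((encBiv i.c.pb i.P).size +
        ((i.c.enc i.α).size + ((i.c.enc i.β).size + 1 + 1) + 1) + 1) + 1) + 1 := rfl
  have h6 := ha i.α
  have h7 := ha i.β
  omega

end TreeMachine

theorem mainTheorem4 :
    ∃ (split : Prog) (K k : ℕ),
      ∀ (p : ℕ) [Fact p.Prime] (F : Type*) [Field F] [Finite F] [Algebra (ZMod p) F]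
        (pb : PowerBasis (ZMod p) F) (P : F[X][Y]) (α β : F), P ≠ 0 →
        ∃ (P₁ P₂ : F[X][Y]) (t : ℕ),
          Runs split (encInput pb P α β) (encOutput pb P₁ P₂) t ∧
          t ≤ K * (totalDeg P + Nat.log 2 (Nat.card F) + 1) ^ k ∧
          (∀ S : Multiset F[X][Y], IsFactorization S P →
            (∃ R₁ R₂ : F[X][Y],
              P₁ = partA S α β * R₁ ∧ P₂ = partB S α β * R₂ ∧ R₁ * R₂ ∣ partD S α β) ∧
            (P.Monic → (∀ Q ∈ S, Q.Monic) → P₁ = partA S α β ∧ P₂ = partB S α β)) ∧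
          (StableA P α β → P₁ = P ∧ P₂ = 1) ∧
          (StableB P α β → P₁ = 1 ∧ P₂ = P) := by
  obtain ⟨P₁, P₂, hspec, split, t, ⟨B, hB⟩, hrun⟩ := Input.exists_output
  -- The input has size at most `200 * s ^ 4`, and `B (200 * s ^ 4) ≤ B 200 * (s ^ 4) ^ deg B` by
  -- `eval_mul_le`.
  refine ⟨split, B.eval 200, 4 * B.natDegree, ?_⟩
  intro p _ F _ _ _ pb P α β hP
  let i : Input := ⟨⟨p, F, pb⟩, P, hP, α, β⟩
  refine ⟨P₁ i, P₂ i, t i, hrun i, ?_, hspec i⟩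
  refine (hB i).trans ((eval_mono_nat B i.size_enc_le).trans ?_)
  rw [pow_mul]
  exact eval_mul_le _ _ (Nat.one_le_pow _ _ (by omega))
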